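/- Notation. A real realization $(A,B,C,D)$ has transfer function matrix $G(s)=C(sI-A)^{-1}B+D$, and is minimal if no realization of the same transfer function matrix has smaller state dimension. "Pole" of $G$ means pole of some entry; $M>0$ ($\succeq 0$) means Hermitian positive (semi)definite; $M^{1/2}$ is the positive semidefinite square root of $M\succeq0$; $j$ is the imaginary unit. A square $G(s)$ is negative imaginary (NI) if (1) $G$ has no pole in $\mathrm{Re}\,s>0$; (2) $j(G(j\omega)-G(j\omega)^*)\succeq 0$ for all $\omega>0$ such that $j\omega$ is not a pole of $G$; (3) every pole $j\omega_0$ with $\omega_0>0$ is simple and $\lim_{s\to j\omega_0}(s-j\omega_0)\,jG(s)$ is Hermitian positive semidefinite; (4) if $0$ is a pole of $G$, then $\lim_{s\to0}s^lG(s)=0$ for all $l\ge3$ and $\lim_{s\to0}s^2G(s)$ is Hermitian positive semidefinite. A square $\bar G(s)$ is strictly negative imaginary (SNI) if it has no pole in $\mathrm{Re}\,s\ge 0$ and $j(\bar G(j\omega)-\bar G(j\omega)^*)>0$ for all $\omega>0$. The positive-feedback interconnection of $(A,B,C,D)$ and $(\bar A,\bar B,\bar C,\bar D)$, with $I-D\bar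 D$ nonsingular, is internally stable if all eigenvalues of $$\breve A=\begin{bmatrix}A+B\bar D(I-D\bar D)^{-1}C & B\bar C+B\bar D(I-D\bar D)^{-1}D\bar C\\ \bar B(I-D\bar D)^{-1}C & \bar A+\bar B(I-D\bar D)^{-1}D\bar C\end{bmatrix}$$ have negative real part. For $X\in\mathbb R^{m\times m}$ and $Y\in\mathbb R^{m\times r}$ with $Y^TXY$ nonsingular put $\mathcal P(X,Y)=X-XY(Y^TXY)^{-1}Y^TX$. Theorem. Let $k\ge1$ and $n_1,n_2,m,\bar n\ge 0$ be integers. Let $(A,B,C,0)$ be a minimal real realization with $$A=\begin{bmatrix}A_1&0&0\\0&0&0\\0&0&A_3\end{bmatrix},\quad A_3=\begin{bmatrix}0&I_k\\0&0\end{bmatrix},\quad B=\begin{bmatrix}B_1\\B_2\\B_{3a}\\B_{3b}\end{bmatrix},\quad C=\begin{bmatrix}C_1&C_2&C_{3a}&C_{3b}\end{bmatrix},$$ where $A_1\in\mathbb R^{n_1\times n_1}$ is nonsingular, the middle zero block $A_2=0$ of $A$ is $n_2\times n_2$, $B_1,B_2,B_{3a},B_{3b}$ have $n_1,n_2,k,k$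 rows and $m$ columns, and $C_1,C_2,C_{3a},C_{3b}$ have $m$ rows and $n_1,n_2,k,k$ columns; suppose that its transfer function matrix $G(s)$ is NI. Let $(\bar A,\bar B,\bar C,\bar D)$ be a minimal real realization of state dimension $\bar n$ whose $m\times m$ transfer function matrix $\bar G(s)$ is SNI. Suppose that $$\Xi=\begin{bmatrix}C_2&C_{3a}\end{bmatrix}^T\bar G(0)\begin{bmatrix}C_2&C_{3a}\end{bmatrix}$$ is nonsingular, and put $N=\mathcal P(\bar G(0),[\,C_2\ \ C_{3a}\,])$ and $P_2=C_{3a}^TB_{3b}^T(B_{3b}B_{3b}^T)^{-1}$. (i) If $N\succeq0$, then the closed-loop positive-feedback interconnection of $G$ and $\bar G$ is internally stable if and only if $\Xi<0$ and $$I+N^{1/2}C_1A_1^{-1}B_1N^{1/2}-N^{1/2}C_{3b}P_2^{-1}C_{3b}^TN^{1/2}>0.$$ (ii) If $N\preceq0$, then, with $\tilde N=(-N)^{1/2}$, it is internally stable if and only if $\Xi<0$ and $$\det\bigl(I-\tilde NC_1A_1^{-1}B_1\tilde N+\tilde NC_{3b}P_2^{-1}C_{3b}^T\tilde N\bigr)\neq0.$$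 -/

import Mathlib

open Matrix Filter Topology
open scoped MatrixOrder

noncomputable section

namespace NegImag

/-- The transfer function matrix `G(s) = C (sI - A)⁻¹ B + D` of a real state-space realization
`(A, B, C, D)`, evaluated at a point `s` of an extension field `𝕂` of `ℝ`: the usual transfer
function for `𝕂 = ℂ`, and its real values at real points for `𝕂 = ℝ`. -/
def transfer {𝕂 : Type*} [Field 𝕂] [Algebra ℝ 𝕂] {ι μ : Type*}
    [Fintype ι] [DecidableEq ι]
    (A : Matrix ι ι ℝ) (B : Matrix ι μ ℝ) (C : Matrix μ ι ℝ) (D : Matrix μ μ ℝ) (s : 𝕂) :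
    Matrix μ μ 𝕂 :=
  C.map (algebraMap ℝ 𝕂) * (s • (1 : Matrix ι ι 𝕂) - A.map (algebraMap ℝ 𝕂))⁻¹ *
    B.map (algebraMap ℝ 𝕂) + D.map (algebraMap ℝ 𝕂)

/-- Two realizations have the same (rational) transfer function matrix: the two formulas agree at
every complex point at which both are defined. -/
def SameTransfer {ι κ μ : Type*} [Fintype ι] [DecidableEq ι] [Fintype κ] [DecidableEq κ]
    (A : Matrix ι ι ℝ) (B : Matrix ι μ ℝ) (C : Matrix μ ι ℝ) (D : Matrix μ μ ℝ)
    (A' : Matrix κ κ ℝ) (B' : Matrix κ μ ℝ) (C' : Matrix μ κ ℝ) (D' : Matrix μ μ ℝ) : Prop :=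
  ∀ s : ℂ, s ∉ spectrum ℂ (A.map (algebraMap ℝ ℂ)) → s ∉ spectrum ℂ (A'.map (algebraMap ℝ ℂ)) →
    transfer A B C D s = transfer A' B' C' D' s

/-- A realization is minimal if no real realization of the same transfer function matrix has a
smaller state dimension. -/
def IsMinimal {ι μ : Type*} [Fintype ι] [DecidableEq ι]
    (A : Matrix ι ι ℝ) (B : Matrix ι μ ℝ) (C : Matrix μ ι ℝ) (D : Matrix μ μ ℝ) : Prop :=
  ∀ (r : ℕ) (A' : Matrix (Fin r) (Fin r) ℝ) (B' : Matrix (Fin r) μ ℝ) (C' : Matrix μ (Fin r) ℝ)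
    (D' : Matrix μ μ ℝ), SameTransfer A B C D A' B' C' D' → Fintype.card ι ≤ r

/-- `s₀` is a pole of the matrix function `G`: it is a pole of some entry. -/
def IsPole {μ : Type*} (G : ℂ → Matrix μ μ ℂ) (s₀ : ℂ) : Prop :=
  ∃ i j, meromorphicOrderAt (fun s => G s i j) s₀ < 0

/-- `s₀` is a simple pole of `G`: it is a pole and no entry has a pole of order two or more. -/
def IsSimplePole {μ : Type*} (G : ℂ → Matrix μ μ ℂ) (s₀ : ℂ) : Prop :=
  IsPole G s₀ ∧ ∀ i j, ((-1 : ℤ) : WithTop ℤ) ≤ meromorphicOrderAt (fun s => G s i j) s₀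

open scoped ComplexOrder in
/-- Negative imaginary (NI) transfer function matrices, with poles at the origin allowed. -/
structure IsNI {μ : Type*} [Fintype μ] (G : ℂ → Matrix μ μ ℂ) : Prop where
  no_pole : ∀ s : ℂ, 0 < s.re → ¬ IsPole G s
  freq : ∀ ω : ℝ, 0 < ω → ¬ IsPole G (Complex.I * ω) →
    (Complex.I • (G (Complex.I * ω) - (G (Complex.I * ω))ᴴ)).PosSemidef
  imag_pole : ∀ ω : ℝ, 0 < ω → IsPole G (Complex.I * ω) →
    IsSimplePole G (Complex.I * ω) ∧
    ∃ K : Matrix μ μ ℂ,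
      Tendsto (fun s : ℂ => ((s - Complex.I * ω) * Complex.I) • G s) (𝓝[≠] (Complex.I * ω)) (𝓝 K) ∧
      K.PosSemidef
  zero_pole : IsPole G 0 →
    (∀ l : ℕ, 3 ≤ l → Tendsto (fun s : ℂ => s ^ l • G s) (𝓝[≠] 0) (𝓝 0)) ∧
    ∃ K : Matrix μ μ ℂ, Tendsto (fun s : ℂ => s ^ 2 • G s) (𝓝[≠] 0) (𝓝 K) ∧ K.PosSemidef

open scoped ComplexOrder in
/-- Strictly negative imaginary (SNI) transfer function matrices. -/
structure IsSNI {μ : Type*} [Fintype μ] (G : ℂ → Matrix μ μ ℂ) : Prop where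
  no_pole : ∀ s : ℂ, 0 ≤ s.re → ¬ IsPole G s
  freq : ∀ ω : ℝ, 0 < ω →
    (Complex.I • (G (Complex.I * ω) - (G (Complex.I * ω))ᴴ)).PosDef

/-- A real square matrix is Hurwitz if all its complex eigenvalues have negative real part. -/
def IsHurwitz {ι : Type*} [Fintype ι] [DecidableEq ι] (A : Matrix ι ι ℝ) : Prop :=
  ∀ z ∈ spectrum ℂ (A.map (algebraMap ℝ ℂ)), z.re < 0

/-- The system matrix of the positive-feedback interconnection of `(A, B, C, D)` and
`(A', B', C', D')`. -/
def closedLoop {ι κ μ : Type*} [Fintype ι] [Fintype κ] [Fintype μ] [DecidableEq μ]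
    (A : Matrix ι ι ℝ) (B : Matrix ι μ ℝ) (C : Matrix μ ι ℝ) (D : Matrix μ μ ℝ)
    (A' : Matrix κ κ ℝ) (B' : Matrix κ μ ℝ) (C' : Matrix μ κ ℝ) (D' : Matrix μ μ ℝ) :
    Matrix (ι ⊕ κ) (ι ⊕ κ) ℝ :=
  fromBlocks
    (A + B * D' * (1 - D * D')⁻¹ * C) (B * C' + B * D' * (1 - D * D')⁻¹ * D * C')
    (B' * (1 - D * D')⁻¹ * C) (A' + B' * (1 - D * D')⁻¹ * D * C')

/-- Internal stability of the positive-feedback interconnection: it is well posed and its system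
matrix is Hurwitz. -/
def InternallyStable {ι κ μ : Type*} [Fintype ι] [DecidableEq ι] [Fintype κ] [DecidableEq κ]
    [Fintype μ] [DecidableEq μ]
    (A : Matrix ι ι ℝ) (B : Matrix ι μ ℝ) (C : Matrix μ ι ℝ) (D : Matrix μ μ ℝ)
    (A' : Matrix κ κ ℝ) (B' : Matrix κ μ ℝ) (C' : Matrix μ κ ℝ) (D' : Matrix μ μ ℝ) : Prop :=
  IsUnit (1 - D * D') ∧ IsHurwitz (closedLoop A B C D A' B' C' D')

/-- `𝒫(X, Y) = X - X Y (Yᵀ X Y)⁻¹ Yᵀ X`, meant for nonsingular `Yᵀ X Y`. -/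
def calP {μ ν : Type*} [Fintype μ] [Fintype ν] [DecidableEq ν]
    (X : Matrix μ μ ℝ) (Y : Matrix μ ν ℝ) : Matrix μ μ ℝ :=
  X - X * Y * (Yᵀ * X * Y)⁻¹ * Yᵀ * X

/-- The matrix `diag(A₁, A₂, A₃)` with `A₂ = 0` and `A₃ = [[0, I], [0, 0]]`. -/
def plantA {n₁ n₂ k : ℕ} (A₁ : Matrix (Fin n₁) (Fin n₁) ℝ) :
    Matrix (Fin n₁ ⊕ (Fin n₂ ⊕ (Fin k ⊕ Fin k))) (Fin n₁ ⊕ (Fin n₂ ⊕ (Fin k ⊕ Fin k))) ℝ :=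
  fromBlocks A₁ 0 0 (fromBlocks 0 0 0 (fromBlocks 0 1 0 0))

end NegImag

end

/-! The theorem is a Lyapunov argument whose storage function can be read off from the data.
Minimality enters only as controllability and observability. A controllable realization of an NI or
SNI function has a symmetric `P` with xᵀP(Ax+Bu) ≤ uᵀC(Ax+Bu) for all x and u (`exists_storage`). It
is obtained by convex separation from the frequency inequality along sinusoidal trajectories, so
imaginary poles do no harm. Where the inequality is tight its gradient vanishes
(`Dissipative.gradient`); most algebraic identities below are this fact evaluated at a well-chosen
state and input.

For the loop, the two storages minus the coupling terms give a quadratic form, `loopStorage`, that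
does not increase along trajectories. The strict SNI inequality excludes nonzero imaginary
eigenvalues, and equilibria lie in the kernel of the form, so the loop is Hurwitz exactly when the
form is positive definite (`isHurwitz_closedLoop_iff`). A Schur complement that eliminates the
controller state leaves P − CᵀḠ(0)C > 0.

For the plant, P = diag(P₁, 0, 0, P₂), where P₁ > 0 and P₂ > 0 because of the NI pole conditions,
and P₂ is the matrix of the theorem. On the zero blocks the form is −Ξ, and a second Schur
complement turns the rest into diag(P₁, P₂) − EᵀNE > 0 with E = [C₁ C₃b]
(`plantStorage_sub_posDef_iff`). If N = S² with S ⪰ 0, this says I − SE diag(P₁, P₂)⁻¹EᵀS > 0, and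
as [C₂ C₃a]ᵀS = 0, the gradient identities give SC₁A₁⁻¹B₁S = −SC₁P₁⁻¹C₁ᵀS
(`Dissipative.restricted_gain`). If N ⪯ 0, both this definiteness and the determinant condition hold
automatically, and stability is just Ξ < 0. -/

noncomputable section

namespace NegImag

variable {ι κ μ ν : Type*}

/-! ### Controllability, observability and complexification -/

/-- The pair `(A, B)` is controllable: the only `A`-invariant subspace containing the range of `B`
is the whole state space. -/
def Controllable [Fintype ι] [Fintype μ] (A : Matrix ι ι ℝ) (B : Matrix ι μ ℝ) : Prop :=
  ∀ U : Submodule ℝ (ι → ℝ), (∀ x ∈ U, A *ᵥ x ∈ U) → (∀ v, B *ᵥ v ∈ U) → U = ⊤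

/-- The pair `(A, C)` is observable: the only `A`-invariant subspace in the kernel of `C` is
zero. -/
def Observable [Fintype ι] (A : Matrix ι ι ℝ) (C : Matrix μ ι ℝ) : Prop :=
  ∀ U : Submodule ℝ (ι → ℝ), (∀ x ∈ U, A *ᵥ x ∈ U) → (∀ x ∈ U, C *ᵥ x = 0) → U = ⊥

/-- The complexification of a real matrix. -/
abbrev cx (A : Matrix ι κ ℝ) : Matrix ι κ ℂ := A.map (algebraMap ℝ ℂ)

lemma cx_mul [Fintype κ] (A : Matrix ι κ ℝ) (B : Matrix κ ν ℝ) : cx (A * B) = cx A * cx B :=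
  Matrix.map_mul

lemma cx_mulVec_ofReal [Fintype κ] (A : Matrix ι κ ℝ) (x : κ → ℝ) :
    cx A *ᵥ (fun i => (x i : ℂ)) = fun i => ((A *ᵥ x) i : ℂ) := by
  ext i; simp [mulVec, dotProduct]

lemma cx_mulVec_re [Fintype κ] (A : Matrix ι κ ℝ) (x : κ → ℂ) (i : ι) :
    ((cx A *ᵥ x) i).re = (A *ᵥ fun j => (x j).re) i := by
  simp [mulVec, dotProduct]

lemma cx_mulVec_im [Fintype κ] (A : Matrix ι κ ℝ) (x : κ → ℂ) (i : ι) :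
    ((cx A *ᵥ x) i).im = (A *ᵥ fun j => (x j).im) i := by
  simp [mulVec, dotProduct]

lemma star_dotProduct_re [Fintype ι] (x y : ι → ℂ) :
    (star x ⬝ᵥ y).re =
      (fun i => (x i).re) ⬝ᵥ (fun i => (y i).re) + (fun i => (x i).im) ⬝ᵥ (fun i => (y i).im) := by
  simp [dotProduct, Finset.sum_add_distrib]

/-! ### Eigenvalues, resolvents and transfer functions -/

section Spectrum

variable [Fintype ι] [DecidableEq ι]

lemma mem_spectrum_iff_exists_mulVec {M : Matrix ι ι ℂ} {s : ℂ} :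
    s ∈ spectrum ℂ M ↔ ∃ x, x ≠ 0 ∧ M *ᵥ x = s • x := by
  rw [spectrum.mem_iff, Matrix.isUnit_iff_isUnit_det, isUnit_iff_ne_zero, not_not,
    ← Matrix.exists_mulVec_eq_zero_iff]
  refine exists_congr fun x => and_congr_right fun _ => ?_
  rw [Algebra.algebraMap_eq_smul_one, sub_mulVec, smul_mulVec, one_mulVec, sub_eq_zero, eq_comm]

lemma isUnit_of_notMem_spectrum {M : Matrix ι ι ℂ} {s : ℂ} (hs : s ∉ spectrum ℂ M) :
    IsUnit (s • (1 : Matrix ι ι ℂ) - M) := by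
  rwa [spectrum.notMem_iff, Algebra.algebraMap_eq_smul_one] at hs

lemma exists_resolvent_mulVec {M : Matrix ι ι ℂ} {s : ℂ} (hs : s ∉ spectrum ℂ M) (y : ι → ℂ) :
    ∃ x, s • x = M *ᵥ x + y := by
  have h := isUnit_of_notMem_spectrum hs
  rw [Matrix.isUnit_iff_isUnit_det] at h
  refine ⟨(s • (1 : Matrix ι ι ℂ) - M)⁻¹ *ᵥ y, ?_⟩
  have h2 : (s • (1 : Matrix ι ι ℂ) - M) *ᵥ ((s • (1 : Matrix ι ι ℂ) - M)⁻¹ *ᵥ y) = y := by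
    rw [mulVec_mulVec, Matrix.mul_nonsing_inv _ h, one_mulVec]
  rw [sub_mulVec, smul_mulVec, one_mulVec, sub_eq_iff_eq_add'] at h2
  exact h2

lemma resolvent_mulVec_eq {M : Matrix ι ι ℂ} {s : ℂ} (hs : s ∉ spectrum ℂ M) {x y : ι → ℂ}
    (h : s • x = M *ᵥ x + y) : (s • (1 : Matrix ι ι ℂ) - M)⁻¹ *ᵥ y = x := by
  have hu := isUnit_of_notMem_spectrum hs
  rw [Matrix.isUnit_iff_isUnit_det] at hu
  have : y = (s • (1 : Matrix ι ι ℂ) - M) *ᵥ x := by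
    rw [sub_mulVec, smul_mulVec, one_mulVec, h, add_sub_cancel_left]
  rw [this, mulVec_mulVec, Matrix.nonsing_inv_mul _ hu, one_mulVec]

/-- This turns statements about the transfer matrix into statements about triples s, x, u with sx =
Ax + Bu, which still make sense when s is an eigenvalue. -/
lemma transfer_mulVec [Fintype μ] {A : Matrix ι ι ℝ} {B : Matrix ι μ ℝ} {C : Matrix μ ι ℝ}
    {D : Matrix μ μ ℝ} {s : ℂ} (hs : s ∉ spectrum ℂ (cx A)) {x : ι → ℂ} {u : μ → ℂ}
    (h : s • x = cx A *ᵥ x + cx B *ᵥ u) :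
    transfer A B C D s *ᵥ u = cx C *ᵥ x + cx D *ᵥ u := by
  rw [transfer, add_mulVec, ← mulVec_mulVec, ← mulVec_mulVec, resolvent_mulVec_eq hs h]

lemma eventually_notMem_spectrum (M : Matrix ι ι ℂ) (s₀ : ℂ) :
    ∀ᶠ s in 𝓝[≠] s₀, s ∉ spectrum ℂ M := by
  have hfin : (spectrum ℂ M).Finite := Matrix.finite_spectrum M
  have := (hfin.subset (Set.sdiff_subset (t := {s₀}))).isClosed.isOpen_compl.mem_nhds
    (x := s₀) (by simp)
  filter_upwards [nhdsWithin_le_nhds this, self_mem_nhdsWithin] with s hs hne hmem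
  exact hs ⟨hmem, hne⟩

end Spectrum

/-! ### Minimality gives controllability and observability -/

section Minimal

variable [Fintype ι] [DecidableEq ι] [Fintype κ] [DecidableEq κ]

/-- `X` carries a response of the second realization to a response of the first with the same
output. As `X` need be neither injective nor surjective, inclusions of subspaces and quotient maps
are both covered. -/
lemma sameTransfer_of_intertwining [Fintype μ] [DecidableEq μ] {A : Matrix ι ι ℝ} {B : Matrix ι μ ℝ}
    {C : Matrix μ ι ℝ} {D : Matrix μ μ ℝ} {A' : Matrix κ κ ℝ} {B' : Matrix κ μ ℝ}
    {C' : Matrix μ κ ℝ}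
    (X : Matrix ι κ ℝ) (hA : A * X = X * A') (hB : B = X * B') (hC : C' = C * X) :
    SameTransfer A B C D A' B' C' D := by
  intro s hs hs'
  refine Matrix.toLin'.injective (LinearMap.ext fun u => ?_)
  obtain ⟨x, hx⟩ := exists_resolvent_mulVec hs' (cx B' *ᵥ u)
  rw [toLin'_apply, toLin'_apply, transfer_mulVec hs' hx,
    transfer_mulVec hs (x := cx X *ᵥ x) (u := u)]
  · rw [mulVec_mulVec, ← cx_mul, hC]
  · rw [mulVec_mulVec, ← cx_mul, hA, hB, ← mulVec_smul, hx, mulVec_add, cx_mul, cx_mul,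
      mulVec_mulVec, mulVec_mulVec]

lemma SameTransfer.symm {A : Matrix ι ι ℝ} {B : Matrix ι μ ℝ}
    {C : Matrix μ ι ℝ} {D : Matrix μ μ ℝ} {A' : Matrix κ κ ℝ} {B' : Matrix κ μ ℝ}
    {C' : Matrix μ κ ℝ} {D' : Matrix μ μ ℝ} (h : SameTransfer A B C D A' B' C' D') :
    SameTransfer A' B' C' D' A B C D :=
  fun s hs hs' => (h s hs' hs).symm

lemma eq_toMatrix_mulVecLin (M : Matrix ν ι ℝ) [Fintype ν] :
    M = LinearMap.toMatrix (Pi.basisFun ℝ ι) (Pi.basisFun ℝ ν) M.mulVecLin := by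
  ext i j; simp [LinearMap.toMatrix_apply]

variable [Fintype μ] {A : Matrix ι ι ℝ} {B : Matrix ι μ ℝ} {C : Matrix μ ι ℝ} {D : Matrix μ μ ℝ}

/-- Restricting the state space to `U` realizes the same transfer function in dimension dim `U`. -/
lemma IsMinimal.controllable [DecidableEq μ] (h : IsMinimal A B C D) : Controllable A B := by
  intro U hA hB
  let b := Module.finBasis ℝ U
  let X : Matrix ι (Fin (Module.finrank ℝ U)) ℝ :=
    LinearMap.toMatrix b (Pi.basisFun ℝ ι) U.subtype
  let TA : U →ₗ[ℝ] U := (A.mulVecLin.domRestrict U).codRestrict U (fun x => hA x x.2)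
  let TB : (μ → ℝ) →ₗ[ℝ] U := B.mulVecLin.codRestrict U hB
  have hAX : A * X = X * LinearMap.toMatrix b b TA := by
    have h1 : A = LinearMap.toMatrix (Pi.basisFun ℝ ι) (Pi.basisFun ℝ ι) A.mulVecLin :=
      eq_toMatrix_mulVecLin _
    conv_lhs => rw [h1]
    rw [← LinearMap.toMatrix_comp, ← LinearMap.toMatrix_comp]
    congr 1
  have hBX : B = X * LinearMap.toMatrix (Pi.basisFun ℝ μ) b TB := by
    have h1 : B = LinearMap.toMatrix (Pi.basisFun ℝ μ) (Pi.basisFun ℝ ι) B.mulVecLin :=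
      eq_toMatrix_mulVecLin _
    conv_lhs => rw [h1]
    rw [← LinearMap.toMatrix_comp]
    congr 1
  have := h _ _ _ _ D (sameTransfer_of_intertwining (C := C) X hAX hBX rfl)
  refine Submodule.eq_top_of_finrank_eq (le_antisymm (Submodule.finrank_le U) ?_)
  simpa using this

/-- Dividing the state space by `U` realizes the same transfer function in dimension dim(ι → ℝ) −
dim `U`. -/
lemma IsMinimal.observable [DecidableEq μ] (h : IsMinimal A B C D) : Observable A C := by
  intro U hA hC
  let b := Module.finBasis ℝ ((ι → ℝ) ⧸ U)
  let X : Matrix (Fin (Module.finrank ℝ ((ι → ℝ) ⧸ U))) ι ℝ :=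
    LinearMap.toMatrix (Pi.basisFun ℝ ι) b U.mkQ
  let TA : ((ι → ℝ) ⧸ U) →ₗ[ℝ] ((ι → ℝ) ⧸ U) := U.mapQ U A.mulVecLin (fun x hx => hA x hx)
  let TC : ((ι → ℝ) ⧸ U) →ₗ[ℝ] (μ → ℝ) := U.liftQ C.mulVecLin (fun x hx => hC x hx)
  have hAX : LinearMap.toMatrix b b TA * X = X * A := by
    have h1 : A = LinearMap.toMatrix (Pi.basisFun ℝ ι) (Pi.basisFun ℝ ι) A.mulVecLin :=
      eq_toMatrix_mulVecLin _
    conv_rhs => rw [h1]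
    rw [← LinearMap.toMatrix_comp, ← LinearMap.toMatrix_comp]
    congr 1
  have hCX : C = LinearMap.toMatrix b (Pi.basisFun ℝ μ) TC * X := by
    have h1 : C = LinearMap.toMatrix (Pi.basisFun ℝ ι) (Pi.basisFun ℝ μ) C.mulVecLin :=
      eq_toMatrix_mulVecLin _
    conv_lhs => rw [h1]
    rw [← LinearMap.toMatrix_comp]
    congr 1
  have := h _ _ _ _ D (sameTransfer_of_intertwining (D := D) X hAX (B' := B) rfl hCX).symm
  have h2 := Submodule.finrank_quotient_add_finrank U
  rw [Module.finrank_fintype_fun_eq_card] at h2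
  exact Submodule.finrank_eq_zero.mp (by omega)

end Minimal

/-! ### Eigenvector test, duality and a Bézout identity -/

section Duality

variable [Fintype ι] {A : Matrix ι ι ℝ} {B : Matrix ι μ ℝ} {C : Matrix μ ι ℝ}

/-- The complex eigenvector test for observability. -/
lemma Observable.eq_zero_of_eigenvector (h : Observable A C) {x : ι → ℂ} {s : ℂ}
    (hA : cx A *ᵥ x = s • x) (hC : cx C *ᵥ x = 0) : x = 0 := by
  let a : ι → ℝ := fun i => (x i).re
  let b : ι → ℝ := fun i => (x i).im
  have hAa : A *ᵥ a = s.re • a - s.im • b := by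
    ext i
    rw [← cx_mulVec_re, hA]; simp [a, b]
  have hAb : A *ᵥ b = s.re • b + s.im • a := by
    ext i
    rw [← cx_mulVec_im, hA]; simp [a, b]
  have hCa : C *ᵥ a = 0 := by
    ext i
    rw [← cx_mulVec_re, hC]; simp
  have hCb : C *ᵥ b = 0 := by
    ext i
    rw [← cx_mulVec_im, hC]; simp
  have hU := h (Submodule.span ℝ {a, b}) (fun y hy => ?_) (fun y hy => ?_)
  · rw [Submodule.span_eq_bot] at hU
    have ha : a = 0 := hU a (by simp)
    have hb : b = 0 := hU b (by simp)
    ext i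
    exact Complex.ext (congrFun ha i) (congrFun hb i)
  · obtain ⟨c, d, rfl⟩ := Submodule.mem_span_pair.mp hy
    rw [Submodule.mem_span_pair]
    refine ⟨c * s.re + d * s.im, d * s.re - c * s.im, ?_⟩
    rw [mulVec_add, mulVec_smul, mulVec_smul, hAa, hAb]
    module
  · obtain ⟨c, d, rfl⟩ := Submodule.mem_span_pair.mp hy
    rw [mulVec_add, mulVec_smul, mulVec_smul, hCa, hCb]
    simp

variable [Fintype μ]

/-- The annihilator of `U` is `A`-invariant and contains the range of `B`, hence is everything. -/
lemma Controllable.transpose (h : Controllable A B) : Observable Aᵀ Bᵀ := by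
  intro U hA hB
  let W : Submodule ℝ (ι → ℝ) :=
    { carrier := {x | ∀ p ∈ U, p ⬝ᵥ x = 0}
      add_mem' := fun {x y} hx hy p hp => by rw [dotProduct_add, hx p hp, hy p hp, add_zero]
      zero_mem' := fun p _ => dotProduct_zero p
      smul_mem' := fun c x hx p hp => by rw [dotProduct_smul, hx p hp, smul_zero] }
  have hW : W = ⊤ := by
    refine h W (fun x hx p hp => ?_) (fun v p hp => ?_)
    · rw [dotProduct_mulVec, ← mulVec_transpose]; exact hx _ (hA p hp)
    · rw [dotProduct_mulVec, ← mulVec_transpose, hB p hp, zero_dotProduct]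
  rw [Submodule.eq_bot_iff]
  intro p hp
  have : p ∈ W := hW ▸ Submodule.mem_top
  exact dotProduct_self_eq_zero.mp (this p hp)

lemma Controllable.eq_zero (h : Controllable A B) {p : ι → ℝ} (hA : Aᵀ *ᵥ p = 0)
    (hB : Bᵀ *ᵥ p = 0) : p = 0 := by
  have := h.transpose (Submodule.span ℝ {p}) (fun x hx => ?_) (fun x hx => ?_)
  · simpa using this
  · obtain ⟨c, rfl⟩ := Submodule.mem_span_singleton.mp hx
    simp [mulVec_smul, hA]
  · obtain ⟨c, rfl⟩ := Submodule.mem_span_singleton.mp hx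
    simp [mulVec_smul, hB]

/-- A controllable pair satisfies a Bézout identity: every state `x` can be written as
`B v(s) + (s - A) w(s)` with `v`, `w` depending continuously on `s`. -/
lemma Controllable.bezout (h : Controllable A B) (x : ι → ℂ) :
    ∃ (v : ℂ → μ → ℂ) (w : ℂ → ι → ℂ), Continuous v ∧ Continuous w ∧
      ∀ s, x = cx B *ᵥ v s + (s • w s - cx A *ᵥ w s) := by
  classical
  let W : Submodule ℂ (ι → ℂ) :=
    { carrier := {x | ∃ (v : ℂ → μ → ℂ) (w : ℂ → ι → ℂ), Continuous v ∧ Continuous w ∧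
        ∀ s, x = cx B *ᵥ v s + (s • w s - cx A *ᵥ w s)}
      add_mem' := by
        rintro x y ⟨v, w, hv, hw, h1⟩ ⟨v', w', hv', hw', h2⟩
        refine ⟨v + v', w + w', hv.add hv', hw.add hw', fun s => ?_⟩
        rw [Pi.add_apply, Pi.add_apply, mulVec_add, mulVec_add]
        conv_lhs => rw [h1 s, h2 s]
        module
      zero_mem' := ⟨0, 0, continuous_const, continuous_const, fun s => by simp⟩
      smul_mem' := by
        rintro c x ⟨v, w, hv, hw, h1⟩
        refine ⟨c • v, c • w, hv.const_smul c, hw.const_smul c, fun s => ?_⟩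
        rw [Pi.smul_apply, Pi.smul_apply, mulVec_smul, mulVec_smul]
        conv_lhs => rw [h1 s]
        module }
  let U : Submodule ℝ (ι → ℝ) :=
    { carrier := {x | (fun i => (x i : ℂ)) ∈ W}
      add_mem' := fun {x y} hx hy => by
        have e : (fun i => ((x + y) i : ℂ)) = (fun i => (x i : ℂ)) + fun i => (y i : ℂ) := by
          ext i; simp
        rw [Set.mem_ofPred_eq, e]
        exact W.add_mem hx hy
      zero_mem' := by
        have e : (fun i => ((0 : ι → ℝ) i : ℂ)) = 0 := by ext i; simp
        rw [Set.mem_ofPred_eq, e]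
        exact W.zero_mem
      smul_mem' := fun c x hx => by
        have e : (fun i => ((c • x) i : ℂ)) = (c : ℂ) • fun i => (x i : ℂ) := by ext i; simp
        rw [Set.mem_ofPred_eq, e]
        exact W.smul_mem (c : ℂ) hx }
  have hU : U = ⊤ := by
    refine h U ?_ ?_
    · rintro x ⟨v, w, hv, hw, h1⟩
      -- From x = Bv + (s − A)w follows Ax = sx − (s − A)x = B(sv) + (s − A)(sw − x).
      refine ⟨fun s => s • v s, fun s => s • w s - fun i => (x i : ℂ), by fun_prop, by fun_prop,
        fun s => ?_⟩
      have h2 := congrArg (s • ·) (h1 s)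
      simp only [mulVec_smul, mulVec_sub, smul_sub, smul_add] at h2 ⊢
      rw [← cx_mulVec_ofReal]
      linear_combination (norm := module) h2
    · intro v
      exact ⟨fun _ i => (v i : ℂ), 0, continuous_const, continuous_const, fun s => by
        rw [← cx_mulVec_ofReal]; simp⟩
  have hx : x = (fun i => ((x i).re : ℂ)) + Complex.I • (fun i => ((x i).im : ℂ)) := by
    ext i
    simp [mul_comm Complex.I, Complex.re_add_im]
  have key : ∀ y : ι → ℝ, (fun i => (y i : ℂ)) ∈ W := fun y =>
    show y ∈ U from hU ▸ Submodule.mem_top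
  have : x ∈ W := by
    rw [hx]
    exact W.add_mem (key _) (W.smul_mem _ (key _))
  exact this

end Duality

lemma star_cx_mulVec [Fintype κ] (M : Matrix ι κ ℝ) (y : κ → ℂ) :
    star (cx M *ᵥ y) = cx M *ᵥ star y := by
  ext i; simp [mulVec, dotProduct]

lemma tendsto_mulVec [Fintype κ] {α : Type*} {l : Filter α} {F : α → Matrix ι κ ℂ}
    {v : α → κ → ℂ} {K : Matrix ι κ ℂ} {w : κ → ℂ} (hF : Tendsto F l (𝓝 K))
    (hv : Tendsto v l (𝓝 w)) : Tendsto (fun a => F a *ᵥ v a) l (𝓝 (K *ᵥ w)) := by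
  refine tendsto_pi_nhds.mpr fun i => tendsto_finsetSum _ fun j _ => ?_
  exact (tendsto_pi_nhds.mp (tendsto_pi_nhds.mp hF i) j).mul (tendsto_pi_nhds.mp hv j)

/-! ### Poles of the transfer function versus eigenvalues of `A` -/

section Poles

variable [Fintype ι] [DecidableEq ι]

lemma differentiable_det {M : ℂ → Matrix ι ι ℂ} (h : ∀ i j, Differentiable ℂ fun s => M s i j) :
    Differentiable ℂ fun s => (M s).det := by
  simp only [Matrix.det_apply']
  refine Differentiable.fun_sum fun σ _ => Differentiable.const_mul ?_ _
  exact Differentiable.fun_finsetProd fun i _ => h _ _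

lemma differentiable_adjugate {M : ℂ → Matrix ι ι ℂ}
    (h : ∀ i j, Differentiable ℂ fun s => M s i j) (i j : ι) :
    Differentiable ℂ fun s => (M s).adjugate i j := by
  simp only [Matrix.adjugate_apply]
  refine differentiable_det fun k l => ?_
  by_cases hk : k = j
  · subst hk; simp
  · simpa [Matrix.updateRow_ne hk] using h k l

omit [Fintype ι] in
lemma differentiable_resolventSet (M : Matrix ι ι ℂ) (i j : ι) :
    Differentiable ℂ fun s : ℂ => (s • (1 : Matrix ι ι ℂ) - M) i j := by
  simp only [Matrix.sub_apply, Matrix.smul_apply, smul_eq_mul]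
  fun_prop

/-- Cramer's rule exhibits the entries as rational functions of s; meromorphy everywhere and
analyticity off the spectrum are read off from it. -/
lemma transfer_apply_eq (A : Matrix ι ι ℝ) (B : Matrix ι μ ℝ) (C : Matrix μ ι ℝ)
    (D : Matrix μ μ ℝ) (s : ℂ) (i j : μ) :
    transfer A B C D s i j =
      (∑ l, (∑ k, (C i k : ℂ) * ((s • (1 : Matrix ι ι ℂ) - cx A).det⁻¹ *
        (s • (1 : Matrix ι ι ℂ) - cx A).adjugate k l)) * (B l j : ℂ)) + (D i j : ℂ) := by
  simp only [transfer, Matrix.mul_apply, Matrix.inv_def, Ring.inverse_eq_inv', Matrix.add_apply,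
    Matrix.smul_apply, Matrix.map_apply, smul_eq_mul, Complex.coe_algebraMap]
  rfl

lemma meromorphicAt_transfer (A : Matrix ι ι ℝ) (B : Matrix ι μ ℝ) (C : Matrix μ ι ℝ)
    (D : Matrix μ μ ℝ) (s₀ : ℂ) (i j : μ) :
    MeromorphicAt (fun s => transfer A B C D s i j) s₀ := by
  simp only [transfer_apply_eq]
  have h1 : MeromorphicAt (fun s : ℂ => (s • (1 : Matrix ι ι ℂ) - cx A).det) s₀ :=
    ((differentiable_det (differentiable_resolventSet (cx A))).analyticAt s₀).meromorphicAt
  have h2 : ∀ k l, MeromorphicAt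
      (fun s : ℂ => (s • (1 : Matrix ι ι ℂ) - cx A).adjugate k l) s₀ := fun k l =>
    ((differentiable_adjugate (differentiable_resolventSet (cx A)) k l).analyticAt s₀).meromorphicAt
  refine MeromorphicAt.fun_add (MeromorphicAt.fun_sum fun l _ => ?_)
    (MeromorphicAt.const (D i j : ℂ) s₀)
  refine MeromorphicAt.fun_mul (MeromorphicAt.fun_sum fun k _ => ?_)
    (MeromorphicAt.const (B l j : ℂ) s₀)
  exact (MeromorphicAt.const (C i k : ℂ) s₀).fun_mul (h1.fun_inv.fun_mul (h2 k l))

lemma not_isPole_transfer {A : Matrix ι ι ℝ} {s₀ : ℂ} (hs : s₀ ∉ spectrum ℂ (cx A))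
    (B : Matrix ι μ ℝ) (C : Matrix μ ι ℝ) (D : Matrix μ μ ℝ) :
    ¬ IsPole (fun s : ℂ => transfer A B C D s) s₀ := by
  rintro ⟨i, j, h⟩
  refine absurd h (not_lt.mpr (AnalyticAt.meromorphicOrderAt_nonneg ?_))
  simp only [transfer_apply_eq]
  have h0 : (s₀ • (1 : Matrix ι ι ℂ) - cx A).det ≠ 0 :=
    isUnit_iff_ne_zero.mp ((Matrix.isUnit_iff_isUnit_det _).mp (isUnit_of_notMem_spectrum hs))
  have h1 := (differentiable_det (differentiable_resolventSet (cx A))).analyticAt s₀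
  have h2 : ∀ k l, AnalyticAt ℂ
      (fun s : ℂ => (s • (1 : Matrix ι ι ℂ) - cx A).adjugate k l) s₀ := fun k l =>
    (differentiable_adjugate (differentiable_resolventSet (cx A)) k l).analyticAt s₀
  refine AnalyticAt.fun_add (Finset.analyticAt_fun_sum _ fun l _ => ?_) analyticAt_const
  refine AnalyticAt.fun_mul (Finset.analyticAt_fun_sum _ fun k _ => ?_) analyticAt_const
  exact analyticAt_const.fun_mul ((h1.fun_inv h0).fun_mul (h2 k l))

lemma exists_tendsto_of_not_isPole {A : Matrix ι ι ℝ} {B : Matrix ι μ ℝ} {C : Matrix μ ι ℝ}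
    {D : Matrix μ μ ℝ} {s₀ : ℂ} (h : ¬ IsPole (fun s : ℂ => transfer A B C D s) s₀) :
    ∃ K : Matrix μ μ ℂ, Tendsto (fun s : ℂ => transfer A B C D s) (𝓝[≠] s₀) (𝓝 K) := by
  simp only [IsPole, not_exists, not_lt] at h
  choose K hK using fun i j => tendsto_nhds_of_meromorphicOrderAt_nonneg
    (meromorphicAt_transfer A B C D s₀ i j) (h i j)
  exact ⟨K, tendsto_pi_nhds.mpr fun i => tendsto_pi_nhds.mpr fun j => hK i j⟩

variable [Fintype μ] {A : Matrix ι ι ℝ} {B : Matrix ι μ ℝ} {C : Matrix μ ι ℝ} {D : Matrix μ μ ℝ}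

/-- For a controllable pair, the limit of `f(s) G(s)` at `s₀` determines the limits of
`f(s) C (s - A)⁻¹ x` for all states `x`, through an input direction `v` that has the same pairing
with the left eigenvectors of `A` as `x`. -/
lemma Controllable.exists_residue (hc : Controllable A B) (x : ι → ℂ) (s₀ : ℂ) :
    ∃ v : μ → ℂ, (∀ p : ι → ℂ, p ᵥ* cx A = s₀ • p → p ⬝ᵥ x = p ⬝ᵥ cx B *ᵥ v) ∧
      ∀ (f : ℂ → ℂ) (y : ℂ → ι → ℂ) (K : Matrix μ μ ℂ), Continuous f → Continuous y → f s₀ = 0 →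
        (∀ s, s • y s = cx A *ᵥ y s + f s • x) →
        Tendsto (fun s => f s • transfer A B C D s) (𝓝[≠] s₀) (𝓝 K) →
        cx C *ᵥ y s₀ = K *ᵥ v := by
  obtain ⟨v, w, hv, hw, h⟩ := hc.bezout x
  refine ⟨v s₀, fun p hp => ?_, fun f y K hf hy hf0 hy' hK => ?_⟩
  · conv_lhs => rw [h s₀]
    rw [dotProduct_add, dotProduct_sub, dotProduct_mulVec p (cx A), hp, dotProduct_smul,
      smul_dotProduct, sub_self, add_zero]
  -- By the Bézout identity, y − fw is the response at s to the input fv. Its output is continuous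
  -- in s, so the limit of fG can be compared with the value at s₀.
  · have h1 : ∀ᶠ s in 𝓝[≠] s₀, cx C *ᵥ (y s - f s • w s) + f s • cx D *ᵥ v s =
        (f s • transfer A B C D s) *ᵥ v s := by
      filter_upwards [eventually_notMem_spectrum (cx A) s₀] with s hs
      rw [smul_mulVec, ← mulVec_smul (transfer A B C D s), transfer_mulVec hs
        (x := y s - f s • w s) (u := f s • v s), mulVec_smul (cx D)]
      have h2 := congrArg (f s • ·) (h s)
      have h3 := hy' s
      simp only [mulVec_smul, mulVec_sub] at h2 ⊢
      linear_combination (norm := module) h2 + h3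
    have h2 : Tendsto (fun s => cx C *ᵥ (y s - f s • w s) + f s • cx D *ᵥ v s) (𝓝[≠] s₀)
        (𝓝 (cx C *ᵥ (y s₀ - f s₀ • w s₀) + f s₀ • cx D *ᵥ v s₀)) := by
      have : Continuous fun s => cx C *ᵥ (y s - f s • w s) + f s • cx D *ᵥ v s := by fun_prop
      exact (this.tendsto s₀).mono_left nhdsWithin_le_nhds
    have h3 : Tendsto (fun s => (f s • transfer A B C D s) *ᵥ v s) (𝓝[≠] s₀) (𝓝 (K *ᵥ v s₀)) :=
      tendsto_mulVec hK ((hv.tendsto s₀).mono_left nhdsWithin_le_nhds)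
    have h4 := tendsto_nhds_unique (h3.congr' (h1.mono fun _ => Eq.symm)) h2
    rw [h4, hf0]; simp

/-- Were x an eigenvector for s₀, the residue lemma with f = s − s₀ and constant response x would
give Cx = lim (s − s₀)G(s) v = 0, against observability. -/
lemma notMem_spectrum_of_not_isPole (hc : Controllable A B) (ho : Observable A C) {s₀ : ℂ}
    (h : ¬ IsPole (fun s : ℂ => transfer A B C D s) s₀) : s₀ ∉ spectrum ℂ (cx A) := by
  intro hs
  obtain ⟨x, hx0, hx⟩ := mem_spectrum_iff_exists_mulVec.mp hs
  obtain ⟨K, hK⟩ := exists_tendsto_of_not_isPole h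
  obtain ⟨v, -, hv⟩ := hc.exists_residue (C := C) (D := D) x s₀
  have h1 : Tendsto (fun s : ℂ => s - s₀) (𝓝[≠] s₀) (𝓝 (s₀ - s₀)) :=
    ((by fun_prop : Continuous fun s : ℂ => s - s₀).tendsto s₀).mono_left nhdsWithin_le_nhds
  have := hv (fun s => s - s₀) (fun _ => x) _ (by fun_prop) continuous_const (sub_self _)
    (fun s => by rw [hx]; module) (h1.smul hK)
  refine hx0 (ho.eq_zero_of_eigenvector hx ?_)
  rw [this]; simp

end Poles

/-! ### The frequency-domain inequality along sinusoidal trajectories -/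

section Frequency

variable [Fintype ι] [DecidableEq ι] [Fintype μ]
  {A : Matrix ι ι ℝ} {B : Matrix ι μ ℝ} {C : Matrix μ ι ℝ} {D : Matrix μ μ ℝ}

open scoped Matrix.Norms.Operator in
lemma tendsto_resolvent_imaginary (M : Matrix ι ι ℂ) :
    Tendsto (fun ω : ℝ => ((Complex.I * ω) • (1 : Matrix ι ι ℂ) - M)⁻¹) atTop (𝓝 0) := by
  have h1 := spectrum.resolvent_tendsto_cobounded (𝕜 := ℂ) M
  have h2 : Tendsto (fun ω : ℝ => Complex.I * (ω : ℂ)) atTop (Bornology.cobounded ℂ) := by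
    rw [← tendsto_norm_atTop_iff_cobounded]
    simpa using tendsto_abs_atTop_atTop
  refine (h1.comp h2).congr fun ω => ?_
  simp only [Function.comp, resolvent, Algebra.algebraMap_eq_smul_one,
    Matrix.nonsing_inv_eq_ringInverse]

omit [Fintype μ] in
lemma tendsto_transfer_imaginary (A : Matrix ι ι ℝ) (B : Matrix ι μ ℝ) (C : Matrix μ ι ℝ)
    (D : Matrix μ μ ℝ) :
    Tendsto (fun ω : ℝ => transfer A B C D (Complex.I * ω)) atTop (𝓝 (cx D)) := by
  have h1 := tendsto_resolvent_imaginary (cx A)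
  have h2 : Continuous fun R : Matrix ι ι ℂ => cx C * R * cx B + cx D := by fun_prop
  have h3 := (h2.tendsto 0).comp h1
  simp only [Matrix.mul_zero, Matrix.zero_mul, zero_add] at h3
  exact h3

lemma eventually_imaginary_notMem_spectrum (M : Matrix ι ι ℂ) :
    ∀ᶠ ω : ℝ in atTop, (Complex.I * ω) ∉ spectrum ℂ M := by
  have hfin : ((fun ω : ℝ => Complex.I * (ω : ℂ)) ⁻¹' spectrum ℂ M).Finite :=
    (Matrix.finite_spectrum M).preimage fun a _ b _ h => by simpa using h
  obtain ⟨c, hc⟩ := hfin.bddAbove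
  filter_upwards [eventually_gt_atTop c] with ω hω h
  exact absurd (hc h) (not_le.mpr hω)

open scoped ComplexOrder in
-- Semidefiniteness of j(G − G*) thus becomes Im u*Gu ≤ 0 for all u.
lemma star_dotProduct_skew {G : Matrix μ μ ℂ} (u : μ → ℂ) :
    star u ⬝ᵥ (Complex.I • (G - Gᴴ)) *ᵥ u = ((-2 * (star u ⬝ᵥ G *ᵥ u).im : ℝ) : ℂ) := by
  have h1 : star u ⬝ᵥ Gᴴ *ᵥ u = star (star u ⬝ᵥ G *ᵥ u) := by
    rw [star_dotProduct, star_mulVec, conjTranspose_conjTranspose, dotProduct_mulVec]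
  rw [smul_mulVec, sub_mulVec, dotProduct_smul, dotProduct_sub, h1]
  apply Complex.ext <;> simp; ring

lemma star_dotProduct_cx_im {D : Matrix μ μ ℝ} (hD : Dᵀ = D) (u : μ → ℂ) :
    (star u ⬝ᵥ cx D *ᵥ u).im = 0 := by
  have h1 : star (star u ⬝ᵥ cx D *ᵥ u) = star u ⬝ᵥ cx D *ᵥ u := by
    have : (cx D)ᴴ = cx D := by
      ext i j
      simp only [conjTranspose_apply, cx, map_apply]
      conv_rhs => rw [← hD]
      simp
    rw [← star_dotProduct, star_mulVec, this, dotProduct_mulVec]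
  exact Complex.conj_eq_iff_im.mp h1

open scoped ComplexOrder in
/-- If `j (G(jω) - G(jω)*) ≥ 0` for all large `ω`, then the feedthrough matrix is symmetric. -/
lemma feedthrough_symm
    (h : ∀ᶠ ω : ℝ in atTop, (Complex.I • (transfer A B C D (Complex.I * ω) -
      (transfer A B C D (Complex.I * ω))ᴴ)).PosSemidef) : Dᵀ = D := by
  have h1 : ∀ u : μ → ℂ, (star u ⬝ᵥ cx D *ᵥ u).im ≤ 0 := fun u => by
    have hc : Continuous fun R : Matrix μ μ ℂ => (star u ⬝ᵥ R *ᵥ u).im := by fun_prop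
    refine le_of_tendsto ((hc.tendsto _).comp (tendsto_transfer_imaginary A B C D)) ?_
    filter_upwards [h] with ω hω
    have := hω.dotProduct_mulVec_nonneg u
    rw [star_dotProduct_skew] at this
    rw [Complex.zero_le_real] at this
    simp only [Function.comp]
    linarith
  have h2 : ∀ u : μ → ℂ, (star u ⬝ᵥ cx D *ᵥ u).im =
      (fun i => (u i).re) ⬝ᵥ D *ᵥ (fun i => (u i).im) -
      (fun i => (u i).im) ⬝ᵥ D *ᵥ (fun i => (u i).re) := fun u => by
    simp only [dotProduct, Complex.im_sum, Pi.star_apply, Complex.star_def, Complex.mul_im,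
      Complex.conj_re, Complex.conj_im, cx_mulVec_re, cx_mulVec_im, ← Finset.sum_sub_distrib]
    exact Finset.sum_congr rfl fun i _ => by simp only [mulVec, dotProduct]; ring
  -- Take u = a + jb in the limiting inequality; exchanging a and b then yields equality.
  have h3 : ∀ a b : μ → ℝ, a ⬝ᵥ D *ᵥ b ≤ b ⬝ᵥ D *ᵥ a := fun a b => by
    have := h1 (fun i => ⟨a i, b i⟩)
    rw [h2] at this
    simpa using this
  classical
  ext i j
  have h4 := le_antisymm (h3 (Pi.single i 1) (Pi.single j 1)) (h3 (Pi.single j 1) (Pi.single i 1))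
  simpa using h4.symm

open scoped ComplexOrder in
/-- The frequency-domain inequality of a negative imaginary system in terms of the sinusoidal
trajectories of its realization. -/
lemma frequency_inequality (hc : Controllable A B) (hD : Dᵀ = D)
    (h : ∀ ω : ℝ, 0 < ω → (Complex.I * ω) ∉ spectrum ℂ (cx A) →
      (Complex.I • (transfer A B C D (Complex.I * ω) -
        (transfer A B C D (Complex.I * ω))ᴴ)).PosSemidef)
    (ω : ℝ) (x : ι → ℂ) (u : μ → ℂ) (hx : (Complex.I * ω) • x = cx A *ᵥ x + cx B *ᵥ u) :
    0 ≤ (Complex.I * ω * (star u ⬝ᵥ cx C *ᵥ x)).re := by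
  have regular : ∀ (ω : ℝ), 0 < ω → (Complex.I * ω) ∉ spectrum ℂ (cx A) →
      ∀ (x : ι → ℂ) (u : μ → ℂ), (Complex.I * ω) • x = cx A *ᵥ x + cx B *ᵥ u →
      (star u ⬝ᵥ cx C *ᵥ x).im ≤ 0 := by
    intro ω hω hs x u hx
    have h1 := (h ω hω hs).dotProduct_mulVec_nonneg u
    rw [star_dotProduct_skew, transfer_mulVec hs hx, dotProduct_add, Complex.add_im,
      star_dotProduct_cx_im hD] at h1
    rw [Complex.zero_le_real] at h1
    linarith
  have pos : ∀ (ω : ℝ), 0 < ω → ∀ (x : ι → ℂ) (u : μ → ℂ),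
      (Complex.I * ω) • x = cx A *ᵥ x + cx B *ᵥ u → (star u ⬝ᵥ cx C *ᵥ x).im ≤ 0 := by
    intro ω hω x u hx
    -- If jω is an eigenvalue, `G` cannot be evaluated there. The Bézout identity moves the
    -- trajectory continuously to nearby frequencies r, where jr is not an eigenvalue.
    obtain ⟨v, w, hv, hw, hb⟩ := hc.bezout x
    have hcont : Continuous fun r : ℝ => (star (u + (Complex.I * r - Complex.I * ω) • v (Complex.I * r)) ⬝ᵥ
        cx C *ᵥ (x - (Complex.I * r - Complex.I * ω) • w (Complex.I * r))).im := by fun_prop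
    have hlim := (hcont.tendsto ω).mono_left (nhdsWithin_le_nhds (s := {ω}ᶜ))
    simp only [sub_self, zero_smul, add_zero, sub_zero] at hlim
    refine le_of_tendsto hlim ?_
    have hne : Tendsto (fun r : ℝ => Complex.I * (r : ℂ)) (𝓝[≠] ω) (𝓝[≠] (Complex.I * ω)) := by
      refine tendsto_nhdsWithin_of_tendsto_nhds_of_eventually_within _ ?_ ?_
      · exact ((by fun_prop : Continuous fun r : ℝ => Complex.I * (r : ℂ)).tendsto ω).mono_left
          nhdsWithin_le_nhds
      · filter_upwards [self_mem_nhdsWithin] with r hr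
        simpa using hr
    filter_upwards [hne.eventually (eventually_notMem_spectrum (cx A) _),
      nhdsWithin_le_nhds (lt_mem_nhds hω)] with r hr hr0
    refine regular r hr0 hr _ _ ?_
    have h2 := congrArg ((Complex.I * r - Complex.I * ω) • ·) (hb (Complex.I * r))
    simp only [mulVec_smul, mulVec_sub, mulVec_add] at h2 ⊢
    linear_combination (norm := module) h2 + hx
  have hre : ∀ (ω : ℝ) (z : ℂ), (Complex.I * ω * z).re = -(ω * z.im) := fun ω z => by simp
  rw [hre]
  rcases lt_trichotomy ω 0 with hω | rfl | hω
  -- The data are real, so conjugation reverses the sign of the frequency.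
  · have h1 := pos (-ω) (by linarith) (star x) (star u) (by
      have := congrArg star hx
      rw [star_add, star_smul] at this
      rw [star_cx_mulVec, star_cx_mulVec] at this
      rw [← this]
      simp)
    have hs : star (star u) ⬝ᵥ cx C *ᵥ star x = star (star u ⬝ᵥ cx C *ᵥ x) := by
      rw [← star_cx_mulVec, star_dotProduct_star, dotProduct_comm]
    rw [hs] at h1
    simp only [Complex.star_def, Complex.conj_im] at h1
    nlinarith
  · simp
  · have := pos ω hω x u hx
    nlinarith

end Frequency

lemma eq_of_forall_dotProduct_eq [Fintype ι] {v w : ι → ℝ} (h : ∀ y, y ⬝ᵥ v = y ⬝ᵥ w) : v = w := by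
  refine sub_eq_zero.mp (dotProduct_self_eq_zero.mp ?_)
  rw [dotProduct_sub, h, sub_self]

lemma eq_zero_of_forall_linear_add_sq_nonpos {a b : ℝ} (h : ∀ t : ℝ, t * a + t ^ 2 * b ≤ 0) :
    a = 0 := by
  by_contra ha
  -- This t makes the expression equal to t²(|b| + 1 + b), which is positive unless a = 0.
  have h1 := h (a / (|b| + 1))
  have hb : 0 < |b| + 1 := by positivity
  have h2 : a / (|b| + 1) * a + (a / (|b| + 1)) ^ 2 * b =
      (a ^ 2 / (|b| + 1) ^ 2) * (|b| + 1 + b) := by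
    field_simp
  have h3 : 0 < a ^ 2 / (|b| + 1) ^ 2 := by positivity
  have h4 : 0 < |b| + 1 + b := by linarith [neg_abs_le b]
  nlinarith

lemma cx_add (A B : Matrix ι κ ℝ) : cx (A + B) = cx A + cx B :=
  Matrix.map_add _ (map_add _) A B

/-! ### The dissipation inequality and its gradient -/

section Dissipation

variable [Fintype ι] [Fintype μ] {A : Matrix ι ι ℝ} {B : Matrix ι μ ℝ} {C : Matrix μ ι ℝ}
  {P : Matrix ι ι ℝ}

/-- The dissipation inequality of a negative imaginary system: along the trajectories of
`ẋ = A x + B u`, `y = C x`, the storage `xᵀ P x / 2` grows at a rate of at most `uᵀ ẏ`. -/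
def Dissipative (A : Matrix ι ι ℝ) (B : Matrix ι μ ℝ) (C : Matrix μ ι ℝ) (P : Matrix ι ι ℝ) :
    Prop :=
  ∀ x u, x ⬝ᵥ P *ᵥ (A *ᵥ x + B *ᵥ u) ≤ u ⬝ᵥ C *ᵥ (A *ᵥ x + B *ᵥ u)

/-- Where the dissipation inequality is tight, its gradient vanishes. -/
lemma Dissipative.gradient (h : Dissipative A B C P) (hP : Pᵀ = P) {x : ι → ℝ} {u : μ → ℝ}
    (he : x ⬝ᵥ P *ᵥ (A *ᵥ x + B *ᵥ u) = u ⬝ᵥ C *ᵥ (A *ᵥ x + B *ᵥ u)) :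
    P *ᵥ (A *ᵥ x + B *ᵥ u) + Aᵀ *ᵥ (P *ᵥ x) = Aᵀ *ᵥ (Cᵀ *ᵥ u) ∧
      Bᵀ *ᵥ (P *ᵥ x) = C *ᵥ (A *ᵥ x + B *ᵥ u) + Bᵀ *ᵥ (Cᵀ *ᵥ u) := by
  -- The defect of the inequality is a nonpositive quadratic function that vanishes at (x, u), so
  -- its derivative in every direction (y, v) is zero.
  have key : ∀ y v, y ⬝ᵥ P *ᵥ (A *ᵥ x + B *ᵥ u) + x ⬝ᵥ P *ᵥ (A *ᵥ y + B *ᵥ v) =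
      v ⬝ᵥ C *ᵥ (A *ᵥ x + B *ᵥ u) + u ⬝ᵥ C *ᵥ (A *ᵥ y + B *ᵥ v) := fun y v => by
    refine sub_eq_zero.mp (eq_zero_of_forall_linear_add_sq_nonpos
      (b := y ⬝ᵥ P *ᵥ (A *ᵥ y + B *ᵥ v) - v ⬝ᵥ C *ᵥ (A *ᵥ y + B *ᵥ v)) fun t => ?_)
    have h1 := h (x + t • y) (u + t • v)
    have h2 : A *ᵥ (x + t • y) + B *ᵥ (u + t • v) =
        (A *ᵥ x + B *ᵥ u) + t • (A *ᵥ y + B *ᵥ v) := by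
      simp only [mulVec_add, mulVec_smul]; module
    rw [h2] at h1
    generalize A *ᵥ x + B *ᵥ u = dx at *
    generalize A *ᵥ y + B *ᵥ v = dy at *
    simp only [mulVec_add, mulVec_smul, dotProduct_add, add_dotProduct, dotProduct_smul,
      smul_dotProduct, smul_eq_mul] at h1
    linarith
  have hx : ∀ z, x ⬝ᵥ P *ᵥ z = z ⬝ᵥ P *ᵥ x := fun z => by
    rw [dotProduct_mulVec, ← mulVec_transpose, hP, dotProduct_comm]
  have hu : ∀ z, u ⬝ᵥ C *ᵥ z = z ⬝ᵥ Cᵀ *ᵥ u := fun z => by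
    rw [dotProduct_mulVec, ← mulVec_transpose, dotProduct_comm]
  constructor
  · refine eq_of_forall_dotProduct_eq fun y => ?_
    have := key y 0
    rw [mulVec_zero, add_zero, zero_dotProduct, zero_add, hx, hu] at this
    rw [dotProduct_add, dotProduct_mulVec y Aᵀ, dotProduct_mulVec y Aᵀ, vecMul_transpose, this]
  · refine eq_of_forall_dotProduct_eq fun v => ?_
    have := key 0 v
    rw [mulVec_zero, zero_add, zero_dotProduct, zero_add, hx, hu] at this
    rw [dotProduct_add, dotProduct_mulVec v Bᵀ, dotProduct_mulVec v Bᵀ, vecMul_transpose, this]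

/-- With zero output the inequality is tight at x = 0 for every input and at every x in ker P with
zero input; the gradients show that ker P contains the range of `B` and is `A`-invariant. This
supplies the compactness in the proof of `exists_storage`. -/
lemma Controllable.eq_zero_of_dissipative_zero (hc : Controllable A B) (hP : Pᵀ = P)
    (h : Dissipative A B (0 : Matrix μ ι ℝ) P) : P = 0 := by
  let U : Submodule ℝ (ι → ℝ) := LinearMap.ker P.mulVecLin
  have hPB : ∀ v, P *ᵥ (B *ᵥ v) = 0 := fun v => by
    have := (h.gradient (x := 0) (u := v) hP (by simp)).1
    simpa using this
  have hU : U = ⊤ := by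
    refine hc U (fun x hx => ?_) fun v => hPB v
    have hx' : P *ᵥ x = 0 := hx
    have := (h.gradient (x := x) (u := 0) hP (by
      rw [dotProduct_mulVec, ← mulVec_transpose, hP, hx']; simp)).1
    change P *ᵥ (A *ᵥ x) = 0
    simpa [hx'] using this
  have h0 : ∀ x, P *ᵥ x = 0 := fun x => by
    have : x ∈ U := hU ▸ Submodule.mem_top
    exact this
  classical
  exact Matrix.toLin'.injective (LinearMap.ext fun x => by simpa using h0 x)

end Dissipation

/-! ### Steady collections of states and inputs -/

section Steady

variable [Fintype ι] [Fintype μ] {A : Matrix ι ι ℝ} {B : Matrix ι μ ℝ} {C : Matrix μ ι ℝ}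

/-- The columns of `X` and `U` are states and inputs with vanishing mean growth of `x xᵀ`. -/
def Steady [Fintype κ] (A : Matrix ι ι ℝ) (B : Matrix ι μ ℝ) (X : Matrix ι κ ℝ)
    (U : Matrix μ κ ℝ) : Prop :=
  (A * X + B * U) * Xᵀ + X * (A * X + B * U)ᵀ = 0

lemma Steady.fromCols [Fintype κ] [Fintype ν] {X : Matrix ι κ ℝ} {U : Matrix μ κ ℝ}
    {X' : Matrix ι ν ℝ} {U' : Matrix μ ν ℝ} (h : Steady A B X U) (h' : Steady A B X' U') :
    Steady A B (fromCols X X') (fromCols U U') := by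
  have e : A * Matrix.fromCols X X' + B * Matrix.fromCols U U' =
      Matrix.fromCols (A * X + B * U) (A * X' + B * U') := by
    rw [mul_fromCols, mul_fromCols]
    ext i (j | j) <;> rfl
  rw [Steady, e, transpose_fromCols, transpose_fromCols, fromCols_mul_fromRows,
    fromCols_mul_fromRows]
  rw [Steady] at h h'
  linear_combination (norm := module) h + h'

lemma Steady.smul [Fintype κ] {X : Matrix ι κ ℝ} {U : Matrix μ κ ℝ} (h : Steady A B X U) (c : ℝ) :
    Steady A B (c • X) (c • U) := by
  rw [Steady] at h ⊢
  simp only [Matrix.mul_smul, Matrix.smul_mul, transpose_smul, ← smul_add, h, smul_zero]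

/-- Applied with G = X and F = AX + BU, this lets the columns of a steady collection move by a skew
matrix: AX + BU = XS. -/
lemma exists_skew_of_mul_transpose_skew [DecidableEq ι] [Fintype κ] {F G : Matrix ι κ ℝ}
    (h : F * Gᵀ + G * Fᵀ = 0) (hG : IsUnit (G * Gᵀ)) : ∃ S : Matrix κ κ ℝ, Sᵀ = -S ∧ G * S = F := by
  obtain ⟨T, hT⟩ : ∃ T, T = (G * Gᵀ)⁻¹ := ⟨_, rfl⟩
  have hTT : Tᵀ = T := by rw [hT, transpose_nonsing_inv, transpose_mul, transpose_transpose]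
  have hGT : G * (Gᵀ * T) = 1 := by
    rw [← Matrix.mul_assoc, hT, Matrix.mul_nonsing_inv _ ((Matrix.isUnit_iff_isUnit_det _).mp hG)]
  have hFG : G * Fᵀ = -(F * Gᵀ) := eq_neg_of_add_eq_zero_right h
  -- GᵀT is a right inverse of G, so GᵀTF already solves GS = F. Subtracting its transpose makes it
  -- skew; the last term, skew because FGᵀ is, removes the error that this causes.
  refine ⟨Gᵀ * T * F - Fᵀ * T * G - Gᵀ * T * (F * Gᵀ) * T * G, ?_, ?_⟩
  · simp only [transpose_sub, transpose_mul, transpose_transpose, hTT, hFG]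
    simp only [Matrix.mul_assoc, Matrix.neg_mul, Matrix.mul_neg]
    abel
  · rw [Matrix.mul_sub, Matrix.mul_sub]
    have e1 : G * (Gᵀ * T * F) = F := by rw [← Matrix.mul_assoc, hGT, Matrix.one_mul]
    have e2 : G * (Fᵀ * T * G) = -(F * Gᵀ * T * G) := by
      rw [Matrix.mul_assoc Fᵀ, ← Matrix.mul_assoc G, hFG]
      simp only [Matrix.neg_mul, Matrix.mul_assoc]
    have e3 : G * (Gᵀ * T * (F * Gᵀ) * T * G) = F * Gᵀ * T * G := by
      rw [show Gᵀ * T * (F * Gᵀ) * T * G = (Gᵀ * T) * (F * Gᵀ * T * G) by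
        simp only [Matrix.mul_assoc], ← Matrix.mul_assoc, hGT, Matrix.one_mul]
    rw [e1, e2, e3]
    abel

/-- A realization satisfies the frequency-domain inequality if no sinusoidal trajectory extracts
energy. -/
def FrequencyInequality (A : Matrix ι ι ℝ) (B : Matrix ι μ ℝ) (C : Matrix μ ι ℝ) : Prop :=
  ∀ (ω : ℝ) (x : ι → ℂ) (u : μ → ℂ), (Complex.I * ω) • x = cx A *ᵥ x + cx B *ᵥ u →
    0 ≤ (Complex.I * ω * (star u ⬝ᵥ cx C *ᵥ x)).re

/-- The Hermitian matrix jS has a unitary eigenbasis. Each eigenvector v of S gives a sinusoidal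
trajectory (Xv, Uv), and in this basis the trace is the sum of the supplies of these trajectories.
-/
lemma FrequencyInequality.trace_nonneg_of_skew [Fintype κ] (hf : FrequencyInequality A B C)
    {X : Matrix ι κ ℝ} {U : Matrix μ κ ℝ} {S : Matrix κ κ ℝ} (hS : Sᵀ = -S)
    (h : X * S = A * X + B * U) : 0 ≤ (Uᵀ * C * (A * X + B * U)).trace := by
  classical
  have hH : (Complex.I • cx S).IsHermitian := by
    ext i j
    have : S j i = - S i j := by
      have := congrFun (congrFun hS i) j
      simpa using this
    simp [this]
  let V : Matrix κ κ ℂ := hH.eigenvectorUnitary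
  have hV : V * star V = 1 := Unitary.coe_mul_star_self _
  have htr : (((Uᵀ * C * (A * X + B * U)).trace : ℝ) : ℂ) =
      (star V * (cx (Uᵀ * C * (A * X + B * U)) * V)).trace := by
    rw [Matrix.trace_mul_comm (star V), Matrix.mul_assoc _ V, hV, Matrix.mul_one]
    simp only [Matrix.trace, Complex.ofReal_sum]
    rfl
  have key : ∀ k, 0 ≤ ((star V * (cx (Uᵀ * C * (A * X + B * U)) * V)) k k).re := fun k => by
    have hk : (star V * (cx (Uᵀ * C * (A * X + B * U)) * V)) k k =
        star (V.col k) ⬝ᵥ cx (Uᵀ * C * (A * X + B * U)) *ᵥ V.col k := by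
      simp [Matrix.mul_apply, dotProduct, mulVec, Matrix.star_apply, Matrix.col]
    obtain ⟨v, hv⟩ : ∃ v, v = V.col k := ⟨_, rfl⟩
    have hev : cx S *ᵥ v = (Complex.I * ((-hH.eigenvalues k : ℝ) : ℂ)) • v := by
      have h1 : (Complex.I • cx S) *ᵥ v = ((hH.eigenvalues k : ℝ) : ℂ) • v := by
        rw [hv, hH.eigenvectorUnitary_col_eq k, hH.mulVec_eigenvectorBasis k]
        ext i; simp
      have h2 := congrArg ((-Complex.I) • ·) h1
      simp only [smul_mulVec, smul_smul] at h2
      rw [show -Complex.I * Complex.I = 1 by simp, one_smul] at h2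
      rw [h2]; push_cast; congr 1; ring
    have h1 : (Complex.I * ((-hH.eigenvalues k : ℝ) : ℂ)) • (cx X *ᵥ v) =
        cx A *ᵥ (cx X *ᵥ v) + cx B *ᵥ (cx U *ᵥ v) := by
      rw [← mulVec_smul, ← hev, mulVec_mulVec, ← cx_mul, h, mulVec_mulVec, mulVec_mulVec, ← cx_mul,
        ← cx_mul, ← add_mulVec, ← cx_add]
    have h2 := hf _ _ _ h1
    rw [hk, ← hv]
    convert h2 using 2
    rw [← h, Matrix.mul_assoc, cx_mul, cx_mul, cx_mul, ← mulVec_mulVec, ← mulVec_mulVec,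
      ← mulVec_mulVec, hev, mulVec_smul, mulVec_smul, mulVec_smul, dotProduct_smul, smul_eq_mul,
      dotProduct_mulVec, star_cx_mulVec]
    congr 2
    ext i; simp [vecMul, mulVec, dotProduct, mul_comm]
  have h3 := congrArg Complex.re htr
  rw [Complex.ofReal_re] at h3
  rw [h3, Matrix.trace, Complex.re_sum]
  exact Finset.sum_nonneg fun k _ => key k

lemma trace_transpose_fromCols_mul [Fintype κ] [Fintype ν] (U : Matrix μ κ ℝ) (U' : Matrix μ ν ℝ)
    (Y : Matrix μ κ ℝ) (Y' : Matrix μ ν ℝ) :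
    ((fromCols U U')ᵀ * fromCols Y Y').trace = (Uᵀ * Y).trace + (U'ᵀ * Y').trace := by
  simp [Matrix.trace, Matrix.mul_apply]

/-- On steady collections of states and inputs the frequency-domain inequality gives a nonnegative
total supply, as soon as there is one steady collection whose states span. -/
lemma FrequencyInequality.trace_nonneg [DecidableEq ι] [Fintype κ] [Fintype ν]
    (hf : FrequencyInequality A B C) {X₀ : Matrix ι ν ℝ} {U₀ : Matrix μ ν ℝ}
    (h₀ : Steady A B X₀ U₀) (hX₀ : (X₀ * X₀ᵀ).PosDef)
    {X : Matrix ι κ ℝ} {U : Matrix μ κ ℝ} (h : Steady A B X U) :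
    0 ≤ (Uᵀ * C * (A * X + B * U)).trace := by
  -- Adjoining t(X₀, U₀) keeps the collection steady and makes its Gram matrix invertible, as the
  -- skew factorization requires; then t → 0.
  have key : ∀ t : ℝ, 0 < t → 0 ≤ (Uᵀ * C * (A * X + B * U)).trace +
      t ^ 2 * (U₀ᵀ * C * (A * X₀ + B * U₀)).trace := fun t ht => by
    have hs := h.fromCols (h₀.smul t)
    have hu : IsUnit (fromCols X (t • X₀) * (fromCols X (t • X₀))ᵀ) := by
      rw [transpose_fromCols, fromCols_mul_fromRows, transpose_smul, Matrix.smul_mul,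
        Matrix.mul_smul, smul_smul]
      refine (Matrix.PosDef.posSemidef_add ?_ (hX₀.smul (mul_pos ht ht))).isUnit
      simpa using Matrix.posSemidef_self_mul_conjTranspose X
    obtain ⟨S, hS, hGS⟩ := exists_skew_of_mul_transpose_skew hs hu
    have := hf.trace_nonneg_of_skew hS hGS
    rw [mul_fromCols, mul_fromCols, Matrix.mul_assoc] at this
    have e : fromCols (A * X) (A * t • X₀) + fromCols (B * U) (B * t • U₀) =
        fromCols (A * X + B * U) (t • (A * X₀ + B * U₀)) := by
      ext i (j | j) <;> simp [Matrix.mul_smul]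
    rw [e, mul_fromCols, trace_transpose_fromCols_mul] at this
    simp only [transpose_smul, Matrix.smul_mul, Matrix.mul_smul, trace_smul, smul_eq_mul] at this
    rw [Matrix.mul_assoc, Matrix.mul_assoc]
    linarith
  have hcont : Continuous fun t : ℝ => (Uᵀ * C * (A * X + B * U)).trace +
      t ^ 2 * (U₀ᵀ * C * (A * X₀ + B * U₀)).trace := by fun_prop
  have hlim := (hcont.tendsto 0).mono_left (nhdsWithin_le_nhds (s := Set.Ioi 0))
  have h2 := ge_of_tendsto hlim (by filter_upwards [self_mem_nhdsWithin] with t ht using key t ht)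
  simpa using h2

end Steady

/-! ### Steady collections whose states span -/

section SpanningSteady

variable [Fintype ι] [Fintype μ] {A : Matrix ι ι ℝ} {B : Matrix ι μ ℝ}

/-- The states occurring in steady collections. -/
def steadySpace (A : Matrix ι ι ℝ) (B : Matrix ι μ ℝ) : Submodule ℝ (ι → ℝ) where
  carrier := {v | ∃ (κ : Type) (_ : Fintype κ) (X : Matrix ι κ ℝ) (U : Matrix μ κ ℝ) (c : κ → ℝ),
    Steady A B X U ∧ X *ᵥ c = v}
  add_mem' := by
    rintro v w ⟨κ, _, X, U, c, h, rfl⟩ ⟨κ', _, X', U', c', h', rfl⟩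
    exact ⟨κ ⊕ κ', inferInstance, _, _, Sum.elim c c', h.fromCols h',
      fromCols_mulVec_sumElim X X' c c'⟩
  zero_mem' := ⟨Empty, inferInstance, 0, 0, 0, by simp [Steady], by simp⟩
  smul_mem' := by
    rintro a v ⟨n, _, X, U, c, h, rfl⟩
    exact ⟨n, _, X, U, a • c, h, by rw [mulVec_smul]⟩

/-- The real and imaginary parts of a sinusoidal trajectory form a steady collection. -/
lemma steady_of_sinusoid {ω : ℝ} {x : ι → ℂ} {u : μ → ℂ}
    (h : (Complex.I * ω) • x = cx A *ᵥ x + cx B *ᵥ u) :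
    Steady A B (Matrix.of fun i (b : Bool) => cond b (x i).re (x i).im)
      (Matrix.of fun i (b : Bool) => cond b (u i).re (u i).im) := by
  have hre : ∀ i, (A *ᵥ fun j => (x j).re) i + (B *ᵥ fun j => (u j).re) i = -(ω * (x i).im) :=
    fun i => by
      rw [← cx_mulVec_re, ← cx_mulVec_re, ← Complex.add_re, ← Pi.add_apply, ← h]; simp
  have him : ∀ i, (A *ᵥ fun j => (x j).im) i + (B *ᵥ fun j => (u j).im) i = ω * (x i).re :=
    fun i => by
      rw [← cx_mulVec_im, ← cx_mulVec_im, ← Complex.add_im, ← Pi.add_apply, ← h]; simp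
  have e : A * (Matrix.of fun i (b : Bool) => cond b (x i).re (x i).im) +
      B * (Matrix.of fun i (b : Bool) => cond b (u i).re (u i).im) =
      Matrix.of fun i (b : Bool) => cond b (-(ω * (x i).im)) (ω * (x i).re) := by
    ext i (b | b)
    · exact him i
    · exact hre i
  rw [Steady, e]
  ext i j
  simp [Matrix.mul_apply]
  ring

lemma mem_steadySpace_of_sinusoid {ω : ℝ} {x : ι → ℂ} {u : μ → ℂ}
    (h : (Complex.I * ω) • x = cx A *ᵥ x + cx B *ᵥ u) :
    (fun i => (x i).re) ∈ steadySpace A B ∧ (fun i => (x i).im) ∈ steadySpace A B := by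
  constructor
  · exact ⟨Bool, inferInstance, _, _, Pi.single true 1, steady_of_sinusoid h, by
      ext i; simp⟩
  · exact ⟨Bool, inferInstance, _, _, Pi.single false 1, steady_of_sinusoid h, by
      ext i; simp⟩

/-- A covector that annihilates all high-frequency responses vanishes. -/
lemma Controllable.eq_zero_of_annihilates [DecidableEq ι] (hc : Controllable A B) {p : ι → ℝ}
    (hp : ∀ᶠ ω : ℝ in atTop, ∀ u : μ → ℂ,
      (fun i => (p i : ℂ)) ⬝ᵥ ((Complex.I * ω) • (1 : Matrix ι ι ℂ) - cx A)⁻¹ *ᵥ (cx B *ᵥ u) = 0) :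
    p = 0 := by
  let W : Submodule ℝ (ι → ℝ) :=
    { carrier := {p | ∀ᶠ ω : ℝ in atTop, ∀ u : μ → ℂ, (fun i => (p i : ℂ)) ⬝ᵥ
        ((Complex.I * ω) • (1 : Matrix ι ι ℂ) - cx A)⁻¹ *ᵥ (cx B *ᵥ u) = 0}
      add_mem' := fun {p q} hp hq => by
        filter_upwards [hp, hq] with ω h1 h2 u
        have e : (fun i => ((p + q) i : ℂ)) = (fun i => (p i : ℂ)) + fun i => (q i : ℂ) := by
          ext i; simp
        rw [e, add_dotProduct, h1, h2, add_zero]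
      zero_mem' := Eventually.of_forall fun ω u => by simp [dotProduct]
      smul_mem' := fun c p hp => by
        filter_upwards [hp] with ω h1 u
        have e : (fun i => ((c • p) i : ℂ)) = (c : ℂ) • (fun i => (p i : ℂ)) := by
          ext i; simp
        rw [e, smul_dotProduct, h1, smul_zero] }
  -- If p annihilates the responses R(jω)Bu, then jωR = I + AR shows that Aᵀp pairs with them to the
  -- constant −pᵀBu. Since R(jω) → 0, this constant is zero, so Aᵀp annihilates them as well.
  have step : ∀ p ∈ W, (∀ u : μ → ℂ, (fun i => (p i : ℂ)) ⬝ᵥ cx B *ᵥ u = 0) ∧ Aᵀ *ᵥ p ∈ W := by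
    intro p hp
    have hAp : (fun i => ((Aᵀ *ᵥ p) i : ℂ)) = (fun i => (p i : ℂ)) ᵥ* cx A := by
      rw [← cx_mulVec_ofReal]; ext i; simp [vecMul, mulVec, dotProduct, mul_comm]
    have hev : ∀ᶠ ω : ℝ in atTop, ∀ u : μ → ℂ, (fun i => ((Aᵀ *ᵥ p) i : ℂ)) ⬝ᵥ
        ((Complex.I * ω) • (1 : Matrix ι ι ℂ) - cx A)⁻¹ *ᵥ (cx B *ᵥ u) =
        -((fun i => (p i : ℂ)) ⬝ᵥ cx B *ᵥ u) := by
      filter_upwards [hp, eventually_imaginary_notMem_spectrum (cx A)] with ω h1 h2 u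
      obtain ⟨x, hx⟩ := exists_resolvent_mulVec h2 (cx B *ᵥ u)
      have h3 := h1 u
      rw [resolvent_mulVec_eq h2 hx] at h3 ⊢
      have h4 := congrArg ((fun i => (p i : ℂ)) ⬝ᵥ ·) hx
      simp only [dotProduct_smul, dotProduct_add, h3, smul_zero] at h4
      rw [hAp, ← dotProduct_mulVec]
      linear_combination -h4
    have hB : ∀ u : μ → ℂ, (fun i => (p i : ℂ)) ⬝ᵥ cx B *ᵥ u = 0 := fun u => by
      have hc : Continuous fun R : Matrix ι ι ℂ => (fun i => ((Aᵀ *ᵥ p) i : ℂ)) ⬝ᵥ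
        R *ᵥ (cx B *ᵥ u) := by fun_prop
      have h1 := (hc.tendsto 0).comp (tendsto_resolvent_imaginary (cx A))
      have h2 := tendsto_nhds_unique (h1.congr' (hev.mono fun ω h => h u)) tendsto_const_nhds
      rw [zero_mulVec, dotProduct_zero] at h2
      exact neg_eq_zero.mp h2.symm
    refine ⟨hB, ?_⟩
    filter_upwards [hev] with ω h1 u
    rw [h1, hB, neg_zero]
  have hW : W = ⊥ := by
    refine hc.transpose W (fun p hp => (step p hp).2) fun p hp => ?_
    refine eq_of_forall_dotProduct_eq fun u => ?_
    have h1 := (step p hp).1 fun i => (u i : ℂ)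
    rw [cx_mulVec_ofReal] at h1
    rw [dotProduct_mulVec, vecMul_transpose, dotProduct_comm, dotProduct_zero]
    simp only [dotProduct] at h1 ⊢
    exact_mod_cast h1
  have : p ∈ W := hp
  rw [hW] at this
  simpa using this

/-- A functional that vanishes on this space annihilates every sinusoidal response, since real and
imaginary parts of these are steady states. -/
lemma Controllable.steadySpace_eq_top [DecidableEq ι] (hc : Controllable A B) :
    steadySpace A B = ⊤ := by
  by_contra hne
  obtain ⟨f, hf0, hf⟩ := Submodule.exists_le_ker_of_lt_top _ (lt_top_iff_ne_top.mpr hne)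
  refine hf0 ?_
  let p : ι → ℝ := fun i => f (Pi.single i 1)
  have hfp : ∀ x, f x = p ⬝ᵥ x := fun x => by
    conv_lhs => rw [← Finset.univ_sum_single x]
    rw [map_sum]
    refine Finset.sum_congr rfl fun i _ => ?_
    rw [show Pi.single i (x i) = x i • Pi.single i (1 : ℝ) by
      rw [← Pi.single_smul]; simp, map_smul, smul_eq_mul, mul_comm]
  have hp : p = 0 := by
    refine hc.eq_zero_of_annihilates ?_
    filter_upwards [eventually_imaginary_notMem_spectrum (cx A)] with ω hω u
    obtain ⟨x, hx⟩ := exists_resolvent_mulVec hω (cx B *ᵥ u)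
    rw [resolvent_mulVec_eq hω hx]
    obtain ⟨h1, h2⟩ := mem_steadySpace_of_sinusoid hx
    have h1 : p ⬝ᵥ (fun i => (x i).re) = 0 := by rw [← hfp]; exact hf h1
    have h2 : p ⬝ᵥ (fun i => (x i).im) = 0 := by rw [← hfp]; exact hf h2
    apply Complex.ext
    · simpa [dotProduct] using h1
    · simpa [dotProduct] using h2
  ext x
  simp [hfp, hp]

/-- Juxtapose steady collections that reach each basis vector. -/
lemma Controllable.exists_steady_posDef [DecidableEq ι] (hc : Controllable A B) :
    ∃ (κ : Type) (_ : Fintype κ) (X : Matrix ι κ ℝ) (U : Matrix μ κ ℝ),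
      Steady A B X U ∧ (X * Xᵀ).PosDef := by
  have key : ∀ s : Finset ι, ∃ (κ : Type) (_ : Fintype κ) (X : Matrix ι κ ℝ) (U : Matrix μ κ ℝ),
      Steady A B X U ∧ ∀ i ∈ s, ∃ c, X *ᵥ c = Pi.single i 1 := by
    intro s
    induction s using Finset.induction_on with
    | empty => exact ⟨Empty, inferInstance, 0, 0, by simp [Steady], by simp⟩
    | insert a s _ ih =>
      obtain ⟨κ, _, X, U, h, hs⟩ := ih
      have ha : (Pi.single a 1 : ι → ℝ) ∈ steadySpace A B :=
        hc.steadySpace_eq_top ▸ Submodule.mem_top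
      obtain ⟨κ', _, X', U', c', h', hc'⟩ := ha
      refine ⟨κ ⊕ κ', inferInstance, _, _, h.fromCols h', fun i hi => ?_⟩
      rcases Finset.mem_insert.mp hi with rfl | hi
      · exact ⟨Sum.elim 0 c', by rw [fromCols_mulVec_sumElim, hc']; simp⟩
      · obtain ⟨c, hc⟩ := hs i hi
        exact ⟨Sum.elim c 0, by rw [fromCols_mulVec_sumElim, hc]; simp⟩
  obtain ⟨κ, _, X, U, h, hs⟩ := key Finset.univ
  refine ⟨κ, _, X, U, h, ?_⟩
  have hinj : Function.Injective fun v => v ᵥ* X := by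
    intro v w hvw
    ext i
    obtain ⟨c, hc⟩ := hs i (Finset.mem_univ i)
    have := congrArg (· ⬝ᵥ c) hvw
    simpa [← dotProduct_mulVec, hc] using this
  simpa using Matrix.PosDef.mul_conjTranspose_self X hinj

end SpanningSteady

/-! ### Positive semidefinite matrices of trace one -/

section Density

variable [Fintype κ]

lemma exists_mul_transpose_of_posSemidef [DecidableEq κ] {Z : Matrix κ κ ℝ} (hZ : Z.PosSemidef) :
    ∃ W : Matrix κ κ ℝ, W * Wᵀ = Z := by
  have h1 : (CFC.sqrt Z).PosSemidef := Matrix.nonneg_iff_posSemidef.mp (CFC.sqrt_nonneg Z)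
  refine ⟨CFC.sqrt Z, ?_⟩
  have h2 : (CFC.sqrt Z)ᵀ = CFC.sqrt Z := by simpa using h1.isHermitian.eq
  rw [h2]
  exact CFC.sqrt_mul_sqrt_self Z (Matrix.nonneg_iff_posSemidef.mpr hZ)

/-- The set is the image of the Frobenius unit sphere under W ↦ WWᵀ. -/
lemma isCompact_density : IsCompact {Z : Matrix κ κ ℝ | Z.PosSemidef ∧ Z.trace = 1} := by
  classical
  have hK : IsCompact {W : κ → κ → ℝ | ∑ i, ∑ j, W i j ^ 2 = 1} := by
    refine Metric.isCompact_of_isClosed_isBounded (isClosed_eq (by fun_prop) continuous_const) ?_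
    refine (Metric.isBounded_closedBall (x := (0 : κ → κ → ℝ)) (r := 1)).subset fun W hW => ?_
    rw [mem_closedBall_zero_iff, pi_norm_le_iff_of_nonneg zero_le_one]
    intro i
    rw [pi_norm_le_iff_of_nonneg zero_le_one]
    intro j
    have h1 : W i j ^ 2 ≤ ∑ j, W i j ^ 2 :=
      Finset.single_le_sum (f := fun j => W i j ^ 2) (fun _ _ => sq_nonneg _) (Finset.mem_univ j)
    have h2 : ∑ j, W i j ^ 2 ≤ ∑ i, ∑ j, W i j ^ 2 :=
      Finset.single_le_sum (f := fun i => ∑ j, W i j ^ 2)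
        (fun _ _ => Finset.sum_nonneg fun _ _ => sq_nonneg _) (Finset.mem_univ i)
    have h3 : W i j ^ 2 ≤ 1 := by rw [← show _ = (1 : ℝ) from hW]; exact h1.trans h2
    rw [Real.norm_eq_abs]
    exact abs_le_one_iff_mul_self_le_one.mpr (by nlinarith)
  have htr : ∀ W : Matrix κ κ ℝ, (W * Wᵀ).trace = ∑ i, ∑ j, W i j ^ 2 := fun W => by
    simp [Matrix.trace, Matrix.mul_apply, sq]
  have hc : Continuous fun W : Matrix κ κ ℝ => W * Wᵀ := by fun_prop
  have him : {Z : Matrix κ κ ℝ | Z.PosSemidef ∧ Z.trace = 1} =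
      (fun W : Matrix κ κ ℝ => W * Wᵀ) '' {W : κ → κ → ℝ | ∑ i, ∑ j, W i j ^ 2 = 1} := by
    ext Z
    constructor
    · rintro ⟨hZ, h1⟩
      obtain ⟨W, rfl⟩ := exists_mul_transpose_of_posSemidef hZ
      exact ⟨W, (htr W).symm.trans h1, rfl⟩
    · rintro ⟨W, hW, rfl⟩
      exact ⟨by simpa using Matrix.posSemidef_self_mul_conjTranspose W, (htr W).trans hW⟩
  rw [him]
  exact hK.image hc

lemma convex_density : Convex ℝ {Z : Matrix κ κ ℝ | Z.PosSemidef ∧ Z.trace = 1} := by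
  rintro Z ⟨hZ, h1⟩ Z' ⟨hZ', h1'⟩ a b ha hb hab
  refine ⟨(hZ.smul ha).add (hZ'.smul hb), ?_⟩
  rw [trace_add, trace_smul, trace_smul, h1, h1']
  simpa using hab

end Density

/-! ### Existence of a storage function by convex separation -/

section KYP

variable [Fintype ι] [Fintype μ] {A : Matrix ι ι ℝ} {B : Matrix ι μ ℝ} {C : Matrix μ ι ℝ}

/-- The growth of `x xᵀ` and the (regularized) supply, as a function of the Gram matrix of states
and inputs. -/
def balance (A : Matrix ι ι ℝ) (B : Matrix ι μ ℝ) (C : Matrix μ ι ℝ) (ε : ℝ)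
    (Z : Matrix (ι ⊕ μ) (ι ⊕ μ) ℝ) : (ι → ι → ℝ) × ℝ :=
  (fun i j => (fromCols A B * Z) i (Sum.inl j) + (fromCols A B * Z) j (Sum.inl i),
    ∑ l, (C * (fromCols A B * Z)) l (Sum.inr l) + ε * Z.trace)

lemma isLinearMap_balance (A : Matrix ι ι ℝ) (B : Matrix ι μ ℝ) (C : Matrix μ ι ℝ) (ε : ℝ) :
    IsLinearMap ℝ (balance A B C ε) := by
  constructor
  · intro Z Z'
    refine Prod.ext ?_ ?_
    · ext i j; simp only [balance, Matrix.mul_add, Matrix.add_apply, Prod.fst_add, Pi.add_apply]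
      ring
    · simp only [balance, Matrix.mul_add, Matrix.add_apply, Prod.snd_add, trace_add,
        Finset.sum_add_distrib]
      ring
  · intro c Z
    refine Prod.ext ?_ ?_
    · ext i j
      simp only [balance, Matrix.mul_smul, Matrix.smul_apply, Prod.smul_fst, Pi.smul_apply,
        smul_eq_mul]
      ring
    · simp only [balance, Matrix.mul_smul, Matrix.smul_apply, Prod.smul_snd, trace_smul,
        smul_eq_mul, ← Finset.mul_sum]
      ring

lemma continuous_balance (A : Matrix ι ι ℝ) (B : Matrix ι μ ℝ) (C : Matrix μ ι ℝ) (ε : ℝ) :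
    Continuous (balance A B C ε) := by
  unfold balance
  have h1 : Continuous fun Z : Matrix (ι ⊕ μ) (ι ⊕ μ) ℝ => fromCols A B * Z := by fun_prop
  have h2 : Continuous fun Z : Matrix (ι ⊕ μ) (ι ⊕ μ) ℝ => C * (fromCols A B * Z) := by fun_prop
  have h3 : Continuous fun Z : Matrix (ι ⊕ μ) (ι ⊕ μ) ℝ => Z.trace := by fun_prop
  refine Continuous.prodMk ?_ ?_
  · exact continuous_pi fun i => continuous_pi fun j =>
      (h1.matrix_elem i (Sum.inl j)).add (h1.matrix_elem j (Sum.inl i))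
  · exact (continuous_finsetSum _ fun l _ => h2.matrix_elem l (Sum.inr l)).add
      (continuous_const.mul h3)

lemma balance_of_steady [Fintype ν] {X : Matrix ι ν ℝ} {U : Matrix μ ν ℝ} (h : Steady A B X U)
    (ε : ℝ) : balance A B C ε (fromRows X U * (fromRows X U)ᵀ) =
      (0, (Uᵀ * C * (A * X + B * U)).trace + ε * (fromRows X U * (fromRows X U)ᵀ).trace) := by
  have e : fromCols A B * (fromRows X U * (fromRows X U)ᵀ) =
      (A * X + B * U) * (fromRows X U)ᵀ := by
    rw [← Matrix.mul_assoc, fromCols_mul_fromRows]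
  rw [balance, e]
  refine Prod.ext ?_ ?_
  · ext i j
    have := congrFun (congrFun h i) j
    simp only [Matrix.add_apply, Matrix.mul_apply (M := A * X + B * U), Matrix.mul_apply (M := X),
      transpose_apply, Matrix.zero_apply] at this
    simp only [Matrix.mul_apply (M := A * X + B * U), transpose_apply, fromRows_apply_inl,
      Matrix.add_apply, Pi.zero_apply]
    rw [← this]
    congr 1
    exact Finset.sum_congr rfl fun _ _ => mul_comm _ _
  · simp only [add_left_inj]
    rw [Matrix.mul_assoc, Matrix.trace_mul_comm, ← Matrix.mul_assoc, Matrix.trace]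
    refine Finset.sum_congr rfl fun l _ => ?_
    simp [Matrix.mul_apply (N := Uᵀ), Matrix.mul_apply (N := (fromRows X U)ᵀ)]

lemma balance_vecMulVec (x : ι → ℝ) (u : μ → ℝ) (ε : ℝ) :
    balance A B C ε (vecMulVec (Sum.elim x u) (Sum.elim x u)) =
      (fun i j => (A *ᵥ x + B *ᵥ u) i * x j + (A *ᵥ x + B *ᵥ u) j * x i,
        u ⬝ᵥ C *ᵥ (A *ᵥ x + B *ᵥ u) + ε * (x ⬝ᵥ x + u ⬝ᵥ u)) := by
  rw [balance, mul_vecMulVec, mul_vecMulVec, fromCols_mulVec_sumElim]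
  refine Prod.ext rfl ?_
  have h1 : (vecMulVec (Sum.elim x u) (Sum.elim x u)).trace = x ⬝ᵥ x + u ⬝ᵥ u := by
    rw [trace_vecMulVec]; simp [dotProduct]
  have h2 : ∑ l, vecMulVec (C *ᵥ (A *ᵥ x + B *ᵥ u)) (Sum.elim x u) l (Sum.inr l) =
      u ⬝ᵥ C *ᵥ (A *ᵥ x + B *ᵥ u) := by
    simp [vecMulVec_apply, dotProduct, mul_comm]
  simp only [h1, h2]

lemma exists_matrix_of_functional [DecidableEq ι] (f : ((ι → ι → ℝ) × ℝ) →ₗ[ℝ] ℝ) :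
    ∃ P : Matrix ι ι ℝ, ∀ Y y, f (Y, y) = ∑ i, ∑ j, P i j * Y i j + f (0, 1) * y := by
  refine ⟨fun i j => f (Pi.single i (Pi.single j 1), 0), fun Y y => ?_⟩
  have h1 : (Y, y) = ∑ i, ∑ j, Y i j • ((Pi.single i (Pi.single j 1), 0) : (ι → ι → ℝ) × ℝ) +
      y • (0, 1) := by
    refine Prod.ext ?_ ?_
    · ext k l
      simp [Prod.fst_sum, Finset.sum_apply, Pi.single_apply, apply_ite]
    · simp [Prod.snd_sum]
  rw [h1, map_add, map_sum, map_smul, smul_eq_mul, mul_comm y]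
  simp only [map_sum, map_smul, smul_eq_mul]
  congr 1
  exact Finset.sum_congr rfl fun i _ => Finset.sum_congr rfl fun j _ => mul_comm _ _

/-- A trace-one Gram matrix of zero growth comes from a steady collection, so its regularized supply
is at least ε > 0. The compact convex image of `balance` therefore misses {0} × (−∞, 0], and a
separating functional, evaluated on rank-one Gram matrices, is the storage inequality. The ε is what
makes the sets disjoint. -/
lemma exists_regularized_storage (hc : Controllable A B) (hf : FrequencyInequality A B C)
    {ε : ℝ} (hε : 0 < ε) : ∃ P : Matrix ι ι ℝ, Pᵀ = P ∧ ∀ x u,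
      x ⬝ᵥ P *ᵥ (A *ᵥ x + B *ᵥ u) ≤
        u ⬝ᵥ C *ᵥ (A *ᵥ x + B *ᵥ u) + ε * (x ⬝ᵥ x + u ⬝ᵥ u) := by
  classical
  rcases isEmpty_or_nonempty ι with hι | hι
  -- Treated apart because positivity of the trace of X₀X₀ᵀ, used below, needs at least one state.
  · refine ⟨0, transpose_zero, fun x u => ?_⟩
    have h1 : A *ᵥ x + B *ᵥ u = 0 := Subsingleton.elim _ _
    have h2 : x ⬝ᵥ x = 0 := by simp [dotProduct]
    have h3 : 0 ≤ u ⬝ᵥ u := by simpa using dotProduct_star_self_nonneg u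
    rw [h1, h2, mulVec_zero, mulVec_zero, dotProduct_zero, dotProduct_zero]
    positivity
  obtain ⟨κ₀, _, X₀, U₀, h₀, hX₀⟩ := hc.exists_steady_posDef
  have hdisj : Disjoint (balance A B C ε '' {Z | Z.PosSemidef ∧ Z.trace = 1})
      (({0} : Set (ι → ι → ℝ)) ×ˢ Set.Iic (0 : ℝ)) := by
    rw [Set.disjoint_left]
    rintro _ ⟨Z, ⟨hZ, h1⟩, rfl⟩ ⟨hz, hy⟩
    obtain ⟨W, hW⟩ := exists_mul_transpose_of_posSemidef hZ
    have hWr : W = fromRows W.toRows₁ W.toRows₂ := (fromRows_toRows W).symm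
    have hst : Steady A B W.toRows₁ W.toRows₂ := by
      have e : fromCols A B * Z = (A * W.toRows₁ + B * W.toRows₂) * Wᵀ := by
        rw [← hW, ← Matrix.mul_assoc]
        conv_lhs => rw [hWr, fromCols_mul_fromRows, ← hWr]
      ext i j
      have h2 := congrFun (congrFun (Set.mem_singleton_iff.mp hz) i) j
      simp only [balance, e] at h2
      simp only [Matrix.mul_apply (N := Wᵀ), transpose_apply, Pi.zero_apply] at h2
      simp only [Matrix.add_apply, Matrix.mul_apply (M := A * W.toRows₁ + B * W.toRows₂),
        Matrix.mul_apply (M := W.toRows₁), transpose_apply, Matrix.zero_apply]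
      rw [← h2]
      congr 1
      exact Finset.sum_congr rfl fun _ _ => mul_comm _ _
    have h3 := balance_of_steady (C := C) hst ε
    rw [← hWr, hW] at h3
    rw [h3] at hy
    have h4 := hf.trace_nonneg h₀ hX₀ hst
    have h5 : _ ≤ (0 : ℝ) := hy
    simp only [h1] at h5
    linarith
  obtain ⟨f, a, b, hfa, hab, hfb⟩ := geometric_hahn_banach_compact_closed
    (convex_density.is_linear_image (isLinearMap_balance A B C ε))
    (isCompact_density.image (continuous_balance A B C ε))
    ((convex_singleton 0).prod (convex_Iic 0)) (isClosed_singleton.prod isClosed_Iic) hdisj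
  obtain ⟨P, hP⟩ := exists_matrix_of_functional f.toLinearMap
  simp only [ContinuousLinearMap.coe_coe] at hP
  obtain ⟨c, hc'⟩ : ∃ c, c = f (0, 1) := ⟨_, rfl⟩
  rw [← hc'] at hP
  have hb0 : b < 0 := by
    have := hfb (0, 0) ⟨rfl, Set.mem_Iic.mpr le_rfl⟩
    rwa [show ((0, 0) : (ι → ι → ℝ) × ℝ) = 0 from rfl, map_zero] at this
  -- The functional exceeds b on the whole half-line, which is unbounded below.
  have hc0 : c ≤ 0 := by
    by_contra hpos
    push Not at hpos
    have := hfb (0, b / c) ⟨rfl, (div_neg_of_neg_of_pos hb0 hpos).le⟩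
    rw [hP] at this
    simp [mul_div_cancel₀ _ hpos.ne'] at this
  -- A Slater condition: the spanning steady collection has zero growth, so c = 0 would make the
  -- functional zero on a density matrix, whereas its values there are below a < b < 0.
  have hcne : c ≠ 0 := by
    rintro rfl
    have htr : 0 < (fromRows X₀ U₀ * (fromRows X₀ U₀)ᵀ).trace := by
      have h1 : (fromRows X₀ U₀ * (fromRows X₀ U₀)ᵀ).trace =
          (X₀ * X₀ᵀ).trace + (U₀ * U₀ᵀ).trace := by
        simp [Matrix.trace, Matrix.mul_apply]
      have h2 : 0 ≤ (U₀ * U₀ᵀ).trace := by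
        simpa using (Matrix.posSemidef_self_mul_conjTranspose U₀).trace_nonneg
      have h3 := hX₀.trace_pos
      linarith
    have h1 := hfa _ ⟨(fromRows X₀ U₀ * (fromRows X₀ U₀)ᵀ).trace⁻¹ •
      (fromRows X₀ U₀ * (fromRows X₀ U₀)ᵀ), ⟨?_, ?_⟩, rfl⟩
    · rw [(isLinearMap_balance A B C ε).map_smul, map_smul, balance_of_steady h₀, hP] at h1
      simp at h1
      linarith
    · refine Matrix.PosSemidef.smul ?_ (inv_nonneg.mpr htr.le)
      simpa using Matrix.posSemidef_self_mul_conjTranspose (fromRows X₀ U₀)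
    · rw [trace_smul, smul_eq_mul, inv_mul_cancel₀ htr.ne']
  have hcneg : c < 0 := lt_of_le_of_ne hc0 hcne
  have hsum : ∀ x u, f (balance A B C ε (vecMulVec (Sum.elim x u) (Sum.elim x u))) =
      x ⬝ᵥ (P + Pᵀ) *ᵥ (A *ᵥ x + B *ᵥ u) +
        c * (u ⬝ᵥ C *ᵥ (A *ᵥ x + B *ᵥ u) + ε * (x ⬝ᵥ x + u ⬝ᵥ u)) := fun x u => by
    rw [balance_vecMulVec, hP]
    congr 1
    generalize A *ᵥ x + B *ᵥ u = y
    simp only [dotProduct, mulVec, Matrix.add_apply, transpose_apply, mul_add, add_mul,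
      Finset.sum_add_distrib, Finset.mul_sum]
    rw [add_comm]
    congr 1
    · exact Finset.sum_congr rfl fun i _ => Finset.sum_congr rfl fun j _ => by ring
    · rw [Finset.sum_comm]
      exact Finset.sum_congr rfl fun i _ => Finset.sum_congr rfl fun j _ => by ring
  have hle : ∀ x u, x ⬝ᵥ (P + Pᵀ) *ᵥ (A *ᵥ x + B *ᵥ u) +
        c * (u ⬝ᵥ C *ᵥ (A *ᵥ x + B *ᵥ u) + ε * (x ⬝ᵥ x + u ⬝ᵥ u)) ≤ 0 := fun x u => by
    rw [← hsum]
    have hpsd : (vecMulVec (Sum.elim x u) (Sum.elim x u)).PosSemidef := by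
      simpa using Matrix.posSemidef_vecMulVec_self_star (Sum.elim x u)
    rcases hpsd.trace_nonneg.eq_or_lt with h0 | h0
    · have : Sum.elim x u = 0 := by
        rw [trace_vecMulVec] at h0
        exact dotProduct_self_eq_zero.mp h0.symm
      rw [this, vecMulVec_zero, (isLinearMap_balance A B C ε).map_zero, map_zero]
    · have h1 := hfa _ ⟨(vecMulVec (Sum.elim x u) (Sum.elim x u)).trace⁻¹ •
        vecMulVec (Sum.elim x u) (Sum.elim x u), ⟨hpsd.smul (inv_nonneg.mpr h0.le), by
          rw [trace_smul, smul_eq_mul, inv_mul_cancel₀ h0.ne']⟩, rfl⟩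
      rw [(isLinearMap_balance A B C ε).map_smul, map_smul, smul_eq_mul] at h1
      have h2 := inv_pos.mpr h0
      by_contra h3
      push Not at h3
      have := mul_pos h2 h3
      linarith
  refine ⟨(-c)⁻¹ • (P + Pᵀ), ?_, fun x u => ?_⟩
  · rw [transpose_smul, transpose_add, transpose_transpose, add_comm]
  · have := hle x u
    rw [smul_mulVec, dotProduct_smul, smul_eq_mul, inv_mul_le_iff₀ (by linarith)]
    linarith

open scoped Matrix.Norms.Elementwise in
/-- The negative imaginary lemma: a controllable realization that satisfies the frequency-domain
inequality has a quadratic storage function. -/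
theorem exists_storage (hc : Controllable A B) (hf : FrequencyInequality A B C) :
    ∃ P : Matrix ι ι ℝ, Pᵀ = P ∧ Dissipative A B C P := by
  have : ProperSpace (Matrix ι ι ℝ) := FiniteDimensional.proper ℝ _
  let S : ℕ → Set (Matrix ι ι ℝ) := fun n => {P | Pᵀ = P ∧ ∀ x u,
    x ⬝ᵥ P *ᵥ (A *ᵥ x + B *ᵥ u) ≤
      u ⬝ᵥ C *ᵥ (A *ᵥ x + B *ᵥ u) + 1 / ((n : ℝ) + 1) * (x ⬝ᵥ x + u ⬝ᵥ u)}
  have hsq : ∀ (x : ι → ℝ) (u : μ → ℝ), 0 ≤ x ⬝ᵥ x + u ⬝ᵥ u := fun x u => by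
    have h1 : 0 ≤ x ⬝ᵥ x := by simpa using dotProduct_star_self_nonneg x
    have h2 : 0 ≤ u ⬝ᵥ u := by simpa using dotProduct_star_self_nonneg u
    exact add_nonneg h1 h2
  have hform : ∀ (x y : ι → ℝ), Continuous fun P : Matrix ι ι ℝ => x ⬝ᵥ P *ᵥ y :=
    fun x y => by fun_prop
  have hclosed : ∀ n, IsClosed (S n) := fun n => by
    refine IsClosed.inter ?_ ?_
    · exact isClosed_eq continuous_id.matrix_transpose continuous_id
    · change IsClosed {P : Matrix ι ι ℝ | ∀ x u, x ⬝ᵥ P *ᵥ (A *ᵥ x + B *ᵥ u) ≤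
        u ⬝ᵥ C *ᵥ (A *ᵥ x + B *ᵥ u) + 1 / ((n : ℝ) + 1) * (x ⬝ᵥ x + u ⬝ᵥ u)}
      rw [show {P : Matrix ι ι ℝ | ∀ x u, x ⬝ᵥ P *ᵥ (A *ᵥ x + B *ᵥ u) ≤
        u ⬝ᵥ C *ᵥ (A *ᵥ x + B *ᵥ u) + 1 / ((n : ℝ) + 1) * (x ⬝ᵥ x + u ⬝ᵥ u)} =
        ⋂ x, ⋂ u, {P : Matrix ι ι ℝ | x ⬝ᵥ P *ᵥ (A *ᵥ x + B *ᵥ u) ≤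
        u ⬝ᵥ C *ᵥ (A *ᵥ x + B *ᵥ u) + 1 / ((n : ℝ) + 1) * (x ⬝ᵥ x + u ⬝ᵥ u)} by
          ext P; simp]
      exact isClosed_iInter fun x => isClosed_iInter fun u => isClosed_le (hform _ _) continuous_const
  -- Normalizing an unbounded sequence in `S 0` makes the supply terms vanish in the limit, leaving
  -- a storage of norm one for the zero output, which controllability forbids.
  have hbdd : Bornology.IsBounded (S 0) := by
    by_contra hub
    have hex : ∀ n : ℕ, ∃ P ∈ S 0, (n : ℝ) + 1 < ‖P‖ := fun n => by
      by_contra hno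
      push Not at hno
      exact hub (isBounded_iff_forall_norm_le.mpr ⟨_, hno⟩)
    choose P hPS hPn using hex
    have hpos : ∀ n, 0 < ‖P n‖ := fun n => by
      have := hPn n
      linarith [n.cast_nonneg (α := ℝ)]
    have hQ : ∀ n, ‖P n‖⁻¹ • P n ∈ Metric.sphere (0 : Matrix ι ι ℝ) 1 := fun n => by
      rw [mem_sphere_zero_iff_norm, norm_smul, norm_inv, norm_norm, inv_mul_cancel₀ (hpos n).ne']
    obtain ⟨Q, hQ1, φ, hφ, hlim⟩ := (isCompact_sphere (0 : Matrix ι ι ℝ) 1).tendsto_subseq hQ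
    have hinv : Tendsto (fun n => ‖P (φ n)‖⁻¹) atTop (𝓝 0) := by
      refine tendsto_inv_atTop_zero.comp (tendsto_atTop_mono (fun n => ?_)
        (tendsto_natCast_atTop_atTop (R := ℝ)))
      have h1 := hPn (φ n)
      have h2 : (n : ℝ) ≤ φ n := by exact_mod_cast hφ.id_le n
      linarith
    have hQ0 : Q = 0 := by
      refine hc.eq_zero_of_dissipative_zero (B := B) ?_ fun x u => ?_
      · refine tendsto_nhds_unique ?_ hlim
        have := (continuous_id.matrix_transpose.tendsto Q).comp hlim
        refine this.congr fun n => ?_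
        simp only [Function.comp, id, transpose_smul]
        rw [(hPS (φ n)).1]
      · rw [zero_mulVec, dotProduct_zero]
        have h1 := ((hform x (A *ᵥ x + B *ᵥ u)).tendsto Q).comp hlim
        have h2 := hinv.mul_const (u ⬝ᵥ C *ᵥ (A *ᵥ x + B *ᵥ u) +
          1 / (((0 : ℕ) : ℝ) + 1) * (x ⬝ᵥ x + u ⬝ᵥ u))
        rw [zero_mul] at h2
        refine le_of_tendsto_of_tendsto' h1 h2 fun n => ?_
        simp only [Function.comp, smul_mulVec, dotProduct_smul, smul_eq_mul]
        exact mul_le_mul_of_nonneg_left ((hPS (φ n)).2 x u) (inv_nonneg.mpr (hpos _).le)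
    rw [hQ0] at hQ1
    simp at hQ1
  have hne : ∀ n, (S n).Nonempty := fun n => by
    obtain ⟨P, h1, h2⟩ := exists_regularized_storage hc hf (ε := 1 / ((n : ℝ) + 1)) (by positivity)
    exact ⟨P, h1, h2⟩
  have hanti : ∀ n, S (n + 1) ⊆ S n := fun n P ⟨h1, h2⟩ => ⟨h1, fun x u => (h2 x u).trans (by
    have : 1 / (((n + 1 : ℕ) : ℝ) + 1) ≤ 1 / ((n : ℝ) + 1) := by
      apply one_div_le_one_div_of_le <;> push_cast <;> linarith [n.cast_nonneg (α := ℝ)]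
    have := mul_le_mul_of_nonneg_right this (hsq x u)
    linarith)⟩
  obtain ⟨P, hP⟩ := IsCompact.nonempty_iInter_of_sequence_nonempty_isCompact_isClosed S hanti hne
    (Metric.isCompact_of_isClosed_isBounded (hclosed 0) hbdd) hclosed
  rw [Set.mem_iInter] at hP
  refine ⟨P, (hP 0).1, fun x u => ?_⟩
  have hlim : Tendsto (fun n : ℕ => u ⬝ᵥ C *ᵥ (A *ᵥ x + B *ᵥ u) +
      1 / ((n : ℝ) + 1) * (x ⬝ᵥ x + u ⬝ᵥ u)) atTop
      (𝓝 (u ⬝ᵥ C *ᵥ (A *ᵥ x + B *ᵥ u) + 0 * (x ⬝ᵥ x + u ⬝ᵥ u))) :=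
    (tendsto_one_div_add_atTop_nhds_zero_nat.mul_const _).const_add _
  rw [zero_mul, add_zero] at hlim
  exact ge_of_tendsto' hlim fun n => (hP n).2 x u

end KYP

/-! ### Lyapunov's theorem for indefinite Hermitian forms -/

section Lyapunov

universe u

section Form

variable {V : Type u} [AddCommGroup V] [Module ℂ V] {h : V →ₗ⋆[ℂ] V →ₗ[ℂ] ℂ} {T : V →ₗ[ℂ] V}

/-- First-order condition at a maximum of Re h(x, Tx); the variations y and jy give the real and
imaginary parts. -/
lemma form_gradient_eq_zero (hsymm : ∀ x y, star (h x y) = h y x)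
    (hdis : ∀ x, (h x (T x)).re ≤ 0) {x : V} (hx : (h x (T x)).re = 0) (y : V) :
    h x (T y) + h (T x) y = 0 := by
  have key : ∀ y, (h x (T y) + h (T x) y).re = 0 := fun y => by
    refine eq_zero_of_forall_linear_add_sq_nonpos (b := (h y (T y)).re) fun t => ?_
    have h1 := hdis (x + (t : ℂ) • y)
    have h2 : (h (T x) y).re = (h y (T x)).re := by rw [← hsymm]; simp
    simp only [map_add, map_smul, map_smulₛₗ, LinearMap.add_apply, LinearMap.smul_apply,
      smul_eq_mul, Complex.add_re, Complex.conj_ofReal, Complex.re_ofReal_mul, hx] at h1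
    rw [Complex.add_re, h2]
    linarith
  apply Complex.ext (key y)
  have := key (Complex.I • y)
  simp only [map_smul, smul_eq_mul, ← mul_add, Complex.I_mul_re, neg_eq_zero] at this
  exact this

lemma form_self_im (hsymm : ∀ x y, star (h x y) = h y x) (x : V) : (h x x).im = 0 :=
  Complex.conj_eq_iff_im.mp (hsymm x x)

lemma form_eigenvector_re (hsymm : ∀ x y, star (h x y) = h y x) {x : V} {l : ℂ}
    (hl : T x = l • x) : (h x (T x)).re = l.re * (h x x).re := by
  rw [hl, map_smul, smul_eq_mul, Complex.mul_re, form_self_im hsymm, mul_zero, sub_zero]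

/-- Dissipation is tight at such an x, so h(x, ·) is a left eigenvector of T; in particular T
preserves the h-orthogonal complement of x. -/
lemma form_eq_of_imaginary (hsymm : ∀ x y, star (h x y) = h y x)
    (hdis : ∀ x, (h x (T x)).re ≤ 0) {x : V} {l : ℂ} (hl : T x = l • x) (hl0 : l.re = 0) (y : V) :
    h x (T y) = l * h x y := by
  have h1 := form_gradient_eq_zero hsymm hdis
    (by rw [form_eigenvector_re hsymm hl, hl0, zero_mul]) y
  rw [hl, map_smulₛₗ, LinearMap.smul_apply, smul_eq_mul] at h1
  have h2 : (starRingEnd ℂ) l = -l := by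
    apply Complex.ext <;> simp [hl0]
  rw [h2] at h1
  linear_combination h1

/-- An eigenvector to an eigenvalue in the open left half plane is positive for a nondegenerate
dissipated form. -/
lemma form_pos_of_eigenvector [FiniteDimensional ℂ V] (hsymm : ∀ x y, star (h x y) = h y x)
    (hnd : ∀ x, (∀ y, h x y = 0) → x = 0) (hdis : ∀ x, (h x (T x)).re ≤ 0)
    (hev : ∀ (x : V) (l : ℂ), x ≠ 0 → T x = l • x → l.re ≤ 0)
    {x : V} {l : ℂ} (hx : x ≠ 0) (hl : T x = l • x) (hl0 : l.re < 0) : 0 < (h x x).re := by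
  have h1 := hdis x
  rw [form_eigenvector_re hsymm hl] at h1
  have h2 : 0 ≤ (h x x).re := by
    by_contra hneg
    push Not at hneg
    have := mul_pos_of_neg_of_neg hl0 hneg
    linarith
  refine lt_of_le_of_ne h2 fun h0 => ?_
  -- If h(x, x) = 0, dissipation is tight at x and h(x, ·) vanishes on the range of T + l̄. By
  -- nondegeneracy this map is not onto, so −l̄ is an eigenvalue of T in the open right half plane.
  have h3 : ∀ y, h x ((T + (starRingEnd ℂ l) • (LinearMap.id : V →ₗ[ℂ] V)) y) = 0 := fun y => by
    have := form_gradient_eq_zero hsymm hdis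
      (by rw [form_eigenvector_re hsymm hl, ← h0, mul_zero]) y
    rw [hl, map_smulₛₗ, LinearMap.smul_apply, smul_eq_mul] at this
    simpa using this
  have hns : ¬ Function.Surjective (T + (starRingEnd ℂ l) • (LinearMap.id : V →ₗ[ℂ] V)) := fun hs =>
    hx (hnd x fun y => by obtain ⟨z, rfl⟩ := hs y; exact h3 z)
  rw [← LinearMap.injective_iff_surjective, injective_iff_map_eq_zero] at hns
  push Not at hns
  obtain ⟨z, hz, hz0⟩ := hns
  have := hev z (-(starRingEnd ℂ l)) hz0 (by
    rw [neg_smul]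
    exact eq_neg_of_add_eq_zero_left (by simpa using hz))
  simp at this
  linarith

end Form

/-- **Lyapunov's theorem** for marginally stable maps: a nondegenerate Hermitian form that does not
increase along the flow of `T` is positive definite, provided that the spectrum of `T` lies in the
closed left half plane and the form is positive on the eigenvectors to imaginary eigenvalues. -/
theorem form_pos_of_dissipated (n : ℕ) : ∀ (V : Type u) [AddCommGroup V] [Module ℂ V]
    [FiniteDimensional ℂ V] (h : V →ₗ⋆[ℂ] V →ₗ[ℂ] ℂ) (T : V →ₗ[ℂ] V), Module.finrank ℂ V = n →
    (∀ x y, star (h x y) = h y x) → (∀ x, (∀ y, h x y = 0) → x = 0) →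
    (∀ x, (h x (T x)).re ≤ 0) →
    (∀ (x : V) (l : ℂ), x ≠ 0 → T x = l • x → l.re < 0 ∨ (l.re = 0 ∧ 0 < (h x x).re)) →
    ∀ x, x ≠ 0 → 0 < (h x x).re := by
  induction n using Nat.strong_induction_on with
  | _ n ih =>
  intro V _ _ _ h T hn hsymm hnd hdis hev y hy
  have : Nontrivial V := ⟨y, 0, hy⟩
  obtain ⟨l, hl⟩ := Module.End.exists_eigenvalue (K := ℂ) T
  obtain ⟨x, hxm, hx0⟩ := hl.exists_hasEigenvector
  have hx : T x = l • x := Module.End.mem_eigenspace_iff.mp hxm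
  have hev' : ∀ (x : V) (l : ℂ), x ≠ 0 → T x = l • x → l.re ≤ 0 := fun x l hx0 hx => by
    rcases hev x l hx0 hx with h1 | h1
    · exact h1.le
    · exact h1.1.le
  have hpos : 0 < (h x x).re := by
    rcases hev x l hx0 hx with h1 | h1
    · exact form_pos_of_eigenvector hsymm hnd hdis hev' hx0 hx h1
    · exact h1.2
  have hxx : h x x ≠ 0 := fun h0 => by rw [h0] at hpos; simp at hpos
  -- Split off the eigenvector x and induct on its h-orthogonal complement, with T compressed to it.
  let W : Submodule ℂ V := LinearMap.ker (h x)
  have hW : ∀ w : W, h x w = 0 := fun w => w.2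
  have hW' : ∀ w : W, h w x = 0 := fun w => by rw [← hsymm, hW, star_zero]
  have hproj : ∀ v, v - (h x v / h x x) • x ∈ W := fun v => by
    rw [LinearMap.mem_ker, map_sub, map_smul, smul_eq_mul, div_mul_cancel₀ _ hxx, sub_self]
  let TW : W →ₗ[ℂ] W :=
    { toFun := fun w => ⟨T w - (h x (T w) / h x x) • x, hproj _⟩
      map_add' := fun w w' => by
        ext; simp [add_div]; module
      map_smul' := fun c w => by
        ext; simp [mul_div_assoc]; module }
  let hh : W →ₗ⋆[ℂ] W →ₗ[ℂ] ℂ :=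
    LinearMap.mk₂'ₛₗ (starRingEnd ℂ) (RingHom.id ℂ) (fun w w' => h (w : V) (w' : V))
      (fun _ _ _ => by simp) (fun _ _ _ => by simp) (fun _ _ _ => by simp) (fun _ _ _ => by simp)
  have hhW : ∀ w w' : W, hh w w' = h (w : V) (w' : V) := fun _ _ => rfl
  have hdim : Module.finrank ℂ W < n := by
    rw [← hn]
    exact Submodule.finrank_lt fun htop => hxx (hW ⟨x, htop ▸ Submodule.mem_top⟩)
  have hdec : ∀ v, ∃ (a : ℂ) (w : W), v = a • x + w := fun v =>
    ⟨h x v / h x x, ⟨_, hproj v⟩, by simp⟩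
  have key := ih _ hdim W hh TW rfl (fun w w' => hsymm _ _) ?_ ?_ ?_
  · obtain ⟨a, w, rfl⟩ := hdec y
    have hexp : (h (a • x + w) (a • x + w)).re = Complex.normSq a * (h x x).re + (h w w).re := by
      simp only [map_add, map_smul, map_smulₛₗ, LinearMap.add_apply, LinearMap.smul_apply,
        smul_eq_mul, hW, hW', mul_zero, add_zero, zero_add, Complex.add_re]
      rw [← mul_assoc, Complex.mul_conj, Complex.re_ofReal_mul]
    rw [hexp]
    by_cases hw : w = 0
    · subst hw
      have ha : a ≠ 0 := by rintro rfl; simp at hy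
      have := Complex.normSq_pos.mpr ha
      simp only [ZeroMemClass.coe_zero, map_zero, Complex.zero_re, add_zero]
      positivity
    · have h1 := key w hw
      rw [hhW] at h1
      have := Complex.normSq_nonneg a
      positivity
  · intro w hw
    refine Subtype.ext (hnd w fun y => ?_)
    obtain ⟨a, w', rfl⟩ := hdec y
    rw [map_add, map_smul, hW', smul_zero, zero_add]
    exact hw w'
  · intro w
    have : hh w (TW w) = h w (T w) := by
      change h (w : V) (T w - (h x (T w) / h x x) • x) = _
      rw [map_sub, map_smul, hW', smul_zero, sub_zero]
    rw [this]
    exact hdis w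
  · intro w μ hw0 hw
    have hwV : (w : V) ≠ 0 := fun h0 => hw0 (Subtype.ext h0)
    obtain ⟨c, hc⟩ : ∃ c, c = h x (T w) / h x x := ⟨_, rfl⟩
    have hTw : T w = μ • (w : V) + c • x := by
      have := congrArg Subtype.val hw
      change T w - (h x (T w) / h x x) • x = μ • (w : V) at this
      rw [hc, ← this]; simp
    -- An eigenvector w of the compression satisfies Tw = μw + cx. If c ≠ 0 and μ ≠ l, then w + dx
    -- with d = c/(μ − l) is an eigenvector of T; for imaginary μ it would be h-orthogonal to x,
    -- contradicting d ≠ 0.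
    by_cases hc0 : c = 0
    · rw [hc0, zero_smul, add_zero] at hTw
      exact hev w μ hwV hTw
    · left
      by_cases hlm : l = μ
      · rcases hev x l hx0 hx with h1 | h1
        · rwa [← hlm]
        · refine absurd ?_ hc0
          rw [hc, form_eq_of_imaginary hsymm hdis hx h1.1, hW, mul_zero, zero_div]
      · have hne : μ - l ≠ 0 := sub_ne_zero.mpr (Ne.symm hlm)
        obtain ⟨d, hd⟩ : ∃ d, d = c / (μ - l) := ⟨_, rfl⟩
        have hdc : c + d * l = μ * d := by rw [hd]; field_simp; ring
        have hd0 : d ≠ 0 := by rw [hd]; exact div_ne_zero hc0 hne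
        have hw'x : h ((w : V) + d • x) x = (starRingEnd ℂ) d * h x x := by
          simp [hW']
        have hw'0 : (w : V) + d • x ≠ 0 := fun h0 => by
          rw [h0] at hw'x
          simp [hd0, hxx] at hw'x
        have hTw' : T ((w : V) + d • x) = μ • ((w : V) + d • x) := by
          rw [map_add, map_smul, hTw, hx, smul_add, add_assoc, smul_smul, smul_smul, ← add_smul,
            hdc]
        rcases hev _ μ hw'0 hTw' with h1 | h1
        · exact h1
        · have h2 := form_eq_of_imaginary hsymm hdis hTw' h1.1 x
          rw [hx, map_smul, smul_eq_mul, hw'x] at h2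
          have h3 : (μ - l) * ((starRingEnd ℂ) d * h x x) = 0 := by linear_combination -h2
          simp [hne, hd0, hxx] at h3

variable {ι : Type u} [Fintype ι] {A P : Matrix ι ι ℝ}

lemma star_dotProduct_cx_mulVec (hP : Pᵀ = P) (x y : ι → ℂ) :
    star x ⬝ᵥ cx P *ᵥ y = star (cx P *ᵥ x) ⬝ᵥ y := by
  rw [dotProduct_mulVec, star_cx_mulVec, ← vecMul_transpose]
  congr 2
  conv_lhs => rw [← hP]
  rfl

open scoped ComplexOrder in
theorem posDef_of_lyapunov (hP : Pᵀ = P) (hnd : ∀ x, P *ᵥ x = 0 → x = 0)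
    (hdis : ∀ x, x ⬝ᵥ P *ᵥ (A *ᵥ x) ≤ 0)
    (hev : ∀ (x : ι → ℂ) (l : ℂ), x ≠ 0 → cx A *ᵥ x = l • x →
      l.re < 0 ∨ (l.re = 0 ∧ 0 < (star x ⬝ᵥ cx P *ᵥ x).re)) : P.PosDef := by
  let h : (ι → ℂ) →ₗ⋆[ℂ] (ι → ℂ) →ₗ[ℂ] ℂ :=
    LinearMap.mk₂'ₛₗ (starRingEnd ℂ) (RingHom.id ℂ) (fun x y => star x ⬝ᵥ cx P *ᵥ y)
      (fun _ _ _ => by simp [add_dotProduct]) (fun _ _ _ => by simp)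
      (fun _ _ _ => by simp [mulVec_add]) (fun _ _ _ => by simp [mulVec_smul])
  have hh : ∀ x y, h x y = star x ⬝ᵥ cx P *ᵥ y := fun _ _ => rfl
  have key := form_pos_of_dissipated _ (ι → ℂ) h (cx A).mulVecLin rfl ?_ ?_ ?_ ?_
  · refine Matrix.PosDef.of_dotProduct_mulVec_pos (by simpa [IsHermitian] using hP) fun x hx => ?_
    have h1 := key (fun i => (x i : ℂ)) fun h0 => hx (by
      ext i; have := congrFun h0 i; simpa using this)
    rw [hh, cx_mulVec_ofReal, star_dotProduct_re] at h1
    simpa [dotProduct] using h1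
  · intro x y
    rw [hh, hh, ← star_dotProduct, star_dotProduct_cx_mulVec hP]
  · intro x hx
    have h1 : cx P *ᵥ x = 0 := by
      have h2 := hx (cx P *ᵥ x)
      rw [hh, star_dotProduct_cx_mulVec hP] at h2
      exact dotProduct_star_self_eq_zero.mp h2
    have hre := hnd (fun i => (x i).re) (by ext i; rw [← cx_mulVec_re, h1]; simp)
    have him := hnd (fun i => (x i).im) (by ext i; rw [← cx_mulVec_im, h1]; simp)
    ext i
    exact Complex.ext (congrFun hre i) (congrFun him i)
  · intro x
    rw [hh, star_dotProduct_re]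
    have h1 := hdis (fun i => (x i).re)
    have h2 := hdis (fun i => (x i).im)
    simp only [mulVecLin_apply, cx_mulVec_re, cx_mulVec_im]
    linarith
  · intro x l hx0 hx
    exact hev x l hx0 hx

end Lyapunov

/-! ### Schur complements for definiteness -/

section Schur

variable [Fintype ι] [DecidableEq ι] [Fintype κ] [DecidableEq κ]

/-- Combines the semidefinite Schur criterion with the determinant formula: definite means
semidefinite with nonzero determinant. -/
lemma posDef_fromBlocks_iff₂₂ (A : Matrix ι ι ℝ) (B : Matrix ι κ ℝ) {D : Matrix κ κ ℝ}
    (hD : D.PosDef) : (fromBlocks A B Bᵀ D).PosDef ↔ (A - B * D⁻¹ * Bᵀ).PosDef := by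
  let := hD.isUnit.invertible
  have hpsd : (fromBlocks A B Bᵀ D).PosSemidef ↔ (A - B * D⁻¹ * Bᵀ).PosSemidef := by
    simpa using Matrix.PosDef.fromBlocks₂₂ A B hD
  have hdet : (fromBlocks A B Bᵀ D).det ≠ 0 ↔ (A - B * D⁻¹ * Bᵀ).det ≠ 0 := by
    rw [det_fromBlocks₂₂, invOf_eq_nonsing_inv, mul_ne_zero_iff]
    exact and_iff_right (isUnit_iff_ne_zero.mp ((Matrix.isUnit_iff_isUnit_det _).mp hD.isUnit))
  constructor
  · intro h
    have h1 := hpsd.mp h.posSemidef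
    exact h1.posDef_iff_det_ne_zero.mpr (hdet.mp (h.posSemidef.posDef_iff_det_ne_zero.mp h))
  · intro h
    have h1 := hpsd.mpr h.posSemidef
    exact h1.posDef_iff_det_ne_zero.mpr (hdet.mpr (h.posSemidef.posDef_iff_det_ne_zero.mp h))

lemma posDef_fromBlocks_iff₁₁ {A : Matrix ι ι ℝ} (B : Matrix ι κ ℝ) (D : Matrix κ κ ℝ)
    (hA : A.PosDef) : (fromBlocks A B Bᵀ D).PosDef ↔ (D - Bᵀ * A⁻¹ * B).PosDef := by
  have h1 := posDef_fromBlocks_iff₂₂ D Bᵀ hA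
  rw [transpose_transpose] at h1
  rw [← h1]
  have h2 : (fromBlocks A B Bᵀ D).submatrix (Equiv.sumComm κ ι) (Equiv.sumComm κ ι) =
      fromBlocks D Bᵀ B A := by
    ext (i | i) (j | j) <;> rfl
  rw [← h2]
  constructor
  · exact fun h => h.submatrix (Equiv.sumComm κ ι).injective
  · intro h
    have := h.submatrix (Equiv.sumComm κ ι).symm.injective
    simpa using this

end Schur

/-! ### Equilibria and kernels of storage functions -/

section Storage

variable [Fintype ι] [Fintype μ] {A : Matrix ι ι ℝ} {B : Matrix ι μ ℝ} {C : Matrix μ ι ℝ}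
  {P : Matrix ι ι ℝ}

lemma dotProduct_mulVec_symm (hP : Pᵀ = P) (x y : ι → ℝ) : x ⬝ᵥ P *ᵥ y = (P *ᵥ x) ⬝ᵥ y := by
  rw [dotProduct_mulVec, ← mulVec_transpose, hP]

lemma dotProduct_mulVec_transpose (M : Matrix μ ι ℝ) (u : μ → ℝ) (y : ι → ℝ) :
    u ⬝ᵥ M *ᵥ y = (Mᵀ *ᵥ u) ⬝ᵥ y := by
  rw [dotProduct_mulVec, ← mulVec_transpose]

/-- At an equilibrium both sides vanish, so by the gradient equations Px − Cᵀu is annihilated by Aᵀ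
and Bᵀ; controllability makes it zero. -/
lemma Dissipative.equilibrium (h : Dissipative A B C P) (hc : Controllable A B) (hP : Pᵀ = P)
    {x : ι → ℝ} {u : μ → ℝ} (hx : A *ᵥ x + B *ᵥ u = 0) : P *ᵥ x = Cᵀ *ᵥ u := by
  obtain ⟨h1, h2⟩ := h.gradient hP (x := x) (u := u) (by rw [hx]; simp)
  rw [hx, mulVec_zero, zero_add] at h1 h2
  refine sub_eq_zero.mp (hc.eq_zero ?_ ?_)
  · rw [mulVec_sub, h1, sub_self]
  · rw [mulVec_sub, h2, sub_self]

/-- When Px = Cᵀu, the storage rate equals the supply, and the gradient equations lose all terms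
except those in the velocity. -/
lemma Dissipative.of_storage_gradient (h : Dissipative A B C P) (hP : Pᵀ = P)
    {x : ι → ℝ} {u : μ → ℝ} (hx : P *ᵥ x = Cᵀ *ᵥ u) :
    P *ᵥ (A *ᵥ x + B *ᵥ u) = 0 ∧ C *ᵥ (A *ᵥ x + B *ᵥ u) = 0 := by
  obtain ⟨h1, h2⟩ := h.gradient hP (x := x) (u := u) (by
    rw [dotProduct_mulVec_symm hP, hx, dotProduct_mulVec_transpose])
  rw [hx] at h1 h2
  exact ⟨by simpa using h1, by simpa using h2.symm⟩

omit [Fintype μ] in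
lemma Observable.eq_zero_of_ker (ho : Observable A C)
    (hK : ∀ x, P *ᵥ x = 0 → P *ᵥ (A *ᵥ x) = 0 ∧ C *ᵥ (A *ᵥ x) = 0) {x : ι → ℝ}
    (h1 : P *ᵥ x = 0) (h2 : C *ᵥ x = 0) : x = 0 := by
  have := ho (LinearMap.ker P.mulVecLin ⊓ LinearMap.ker C.mulVecLin)
    (fun x hx => hK x hx.1) (fun x hx => hx.2)
  exact (Submodule.eq_bot_iff _).mp this x ⟨h1, h2⟩

omit [Fintype μ] in
-- The vector Ax lies in both ker P and ker C, so it vanishes by the previous lemma.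
lemma Observable.eq_zero_of_ker_of_isUnit [DecidableEq ι] (ho : Observable A C)
    (hA : IsUnit A) (hK : ∀ x, P *ᵥ x = 0 → P *ᵥ (A *ᵥ x) = 0 ∧ C *ᵥ (A *ᵥ x) = 0) {x : ι → ℝ}
    (h1 : P *ᵥ x = 0) : x = 0 := by
  have h2 := ho.eq_zero_of_ker hK (hK x h1).1 (hK x h1).2
  exact Matrix.mulVec_injective_of_isUnit hA (by rw [h2, mulVec_zero])

end Storage

/-! ### Stability of the loop and its storage function -/

section ClosedLoop

variable [Fintype ι] [DecidableEq ι] [Fintype κ] [DecidableEq κ] [Fintype μ] [DecidableEq μ]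
  {A : Matrix ι ι ℝ} {B : Matrix ι μ ℝ} {C : Matrix μ ι ℝ} {P : Matrix ι ι ℝ}
  {A' : Matrix κ κ ℝ} {B' : Matrix κ μ ℝ} {C' : Matrix μ κ ℝ} {D' : Matrix μ μ ℝ}
  {P' : Matrix κ κ ℝ}

omit [DecidableEq ι] [DecidableEq κ] in
lemma closedLoop_zero : closedLoop A B C 0 A' B' C' D' =
    fromBlocks (A + B * D' * C) (B * C') (B' * C) A' := by
  simp [closedLoop]

/-- The storage function of the interconnection. -/
def loopStorage (P : Matrix ι ι ℝ) (C : Matrix μ ι ℝ) (P' : Matrix κ κ ℝ) (C' : Matrix μ κ ℝ)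
    (D' : Matrix μ μ ℝ) : Matrix (ι ⊕ κ) (ι ⊕ κ) ℝ :=
  fromBlocks (P - Cᵀ * D' * C) (-(Cᵀ * C')) (-(C'ᵀ * C)) P'

omit [Fintype ι] [DecidableEq ι] [Fintype κ] [DecidableEq κ] [DecidableEq μ] in
lemma loopStorage_symm (hP : Pᵀ = P) (hP' : P'ᵀ = P') (hD' : D'ᵀ = D') :
    (loopStorage P C P' C' D')ᵀ = loopStorage P C P' C' D' := by
  simp [loopStorage, fromBlocks_transpose, hP, hP', hD', Matrix.mul_assoc]

omit [DecidableEq ι] [DecidableEq κ] in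
lemma closedLoop_mulVec (x : ι → ℝ) (x' : κ → ℝ) :
    closedLoop A B C 0 A' B' C' D' *ᵥ Sum.elim x x' =
      Sum.elim (A *ᵥ x + B *ᵥ (C' *ᵥ x' + D' *ᵥ (C *ᵥ x))) (A' *ᵥ x' + B' *ᵥ (C *ᵥ x)) := by
  rw [closedLoop_zero, fromBlocks_mulVec]
  simp only [Sum.elim_comp_inl, Sum.elim_comp_inr, add_mulVec, mulVec_add, ← mulVec_mulVec]
  congr 1 <;> abel

omit [DecidableEq ι] [DecidableEq κ] [DecidableEq μ] in
lemma loopStorage_mulVec (x : ι → ℝ) (x' : κ → ℝ) :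
    loopStorage P C P' C' D' *ᵥ Sum.elim x x' =
      Sum.elim (P *ᵥ x - Cᵀ *ᵥ (C' *ᵥ x' + D' *ᵥ (C *ᵥ x))) (P' *ᵥ x' - C'ᵀ *ᵥ (C *ᵥ x)) := by
  rw [loopStorage, fromBlocks_mulVec]
  simp only [Sum.elim_comp_inl, Sum.elim_comp_inr, sub_mulVec, neg_mulVec, mulVec_add,
    ← mulVec_mulVec]
  congr 1 <;> abel

omit [DecidableEq ι] [DecidableEq κ] in
lemma sumElim_dotProduct (x y : ι → ℝ) (x' y' : κ → ℝ) :
    Sum.elim x x' ⬝ᵥ Sum.elim y y' = x ⬝ᵥ y + x' ⬝ᵥ y' := by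
  simp [dotProduct]

omit [DecidableEq ι] [DecidableEq κ] in
-- With input u = C'x' + D'Cx, the gradient of the loop storage is (Px − Cᵀu, P'x' − C'ᵀCx). Its
-- rate is therefore the sum of the defects of the two dissipation inequalities.
lemma loopStorage_dissipated (h : Dissipative A B C P) (h' : Dissipative A' B' C' P')
    (hP : Pᵀ = P) (hP' : P'ᵀ = P') (hD' : D'ᵀ = D') (z : ι ⊕ κ → ℝ) :
    z ⬝ᵥ loopStorage P C P' C' D' *ᵥ (closedLoop A B C 0 A' B' C' D' *ᵥ z) ≤ 0 := by
  obtain ⟨x, x', rfl⟩ : ∃ x x', z = Sum.elim x x' := ⟨_, _, (Sum.elim_comp_inl_inr z).symm⟩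
  rw [dotProduct_mulVec_symm (loopStorage_symm hP hP' hD'), loopStorage_mulVec, closedLoop_mulVec,
    sumElim_dotProduct]
  have h1 := h x (C' *ᵥ x' + D' *ᵥ (C *ᵥ x))
  have h2 := h' x' (C *ᵥ x)
  rw [dotProduct_mulVec_symm hP, dotProduct_mulVec_transpose] at h1
  rw [dotProduct_mulVec_symm hP', dotProduct_mulVec_transpose] at h2
  rw [sub_dotProduct, sub_dotProduct]
  linarith

/-- At a kernel vector both inequalities are tight, so the velocities are killed by P and C and by
P'. Observability and P' > 0 make them zero, and the invertible loop matrix has no equilibrium but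
0. -/
lemma loopStorage_nondegenerate (h : Dissipative A B C P) (h' : Dissipative A' B' C' P')
    (hP : Pᵀ = P) (hP' : P'.PosDef) (ho : Observable A C)
    (hcl : IsUnit (closedLoop A B C 0 A' B' C' D')) (z : ι ⊕ κ → ℝ)
    (hz : loopStorage P C P' C' D' *ᵥ z = 0) : z = 0 := by
  obtain ⟨x, x', rfl⟩ : ∃ x x', z = Sum.elim x x' := ⟨_, _, (Sum.elim_comp_inl_inr z).symm⟩
  have hP's : P'ᵀ = P' := by simpa using hP'.isHermitian.eq
  rw [loopStorage_mulVec] at hz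
  have hz1 : P *ᵥ x = Cᵀ *ᵥ (C' *ᵥ x' + D' *ᵥ (C *ᵥ x)) :=
    sub_eq_zero.mp (funext fun i => congrFun hz (Sum.inl i))
  have hz2 : P' *ᵥ x' = C'ᵀ *ᵥ (C *ᵥ x) :=
    sub_eq_zero.mp (funext fun i => congrFun hz (Sum.inr i))
  obtain ⟨h1, h2⟩ := h.of_storage_gradient hP hz1
  obtain ⟨h3, -⟩ := h'.of_storage_gradient hP's hz2
  have h4 : A' *ᵥ x' + B' *ᵥ (C *ᵥ x) = 0 :=
    Matrix.mulVec_injective_of_isUnit hP'.isUnit (by rw [h3, mulVec_zero])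
  have h5 := ho.eq_zero_of_ker (P := P) (fun y hy => by
    have := h.of_storage_gradient hP (x := y) (u := 0) (by rw [hy, mulVec_zero])
    simpa only [mulVec_zero, add_zero] using this) h1 h2
  refine Matrix.mulVec_injective_of_isUnit hcl ?_
  rw [mulVec_zero, closedLoop_mulVec, h4, h5]
  ext (i | i) <;> rfl

omit [DecidableEq ι] [DecidableEq κ] in
lemma loopStorage_equilibrium (h : Dissipative A B C P) (h' : Dissipative A' B' C' P')
    (hc : Controllable A B) (hc' : Controllable A' B') (hP : Pᵀ = P) (hP' : P'ᵀ = P')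
    {z : ι ⊕ κ → ℝ} (hz : closedLoop A B C 0 A' B' C' D' *ᵥ z = 0) :
    loopStorage P C P' C' D' *ᵥ z = 0 := by
  obtain ⟨x, x', rfl⟩ : ∃ x x', z = Sum.elim x x' := ⟨_, _, (Sum.elim_comp_inl_inr z).symm⟩
  rw [closedLoop_mulVec] at hz
  have hz1 : A *ᵥ x + B *ᵥ (C' *ᵥ x' + D' *ᵥ (C *ᵥ x)) = 0 :=
    funext fun i => congrFun hz (Sum.inl i)
  have hz2 : A' *ᵥ x' + B' *ᵥ (C *ᵥ x) = 0 := funext fun i => congrFun hz (Sum.inr i)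
  rw [loopStorage_mulVec, h.equilibrium hc hP hz1, h'.equilibrium hc' hP' hz2, sub_self, sub_self]
  ext (i | i) <;> rfl

/-- The strict frequency-domain inequality: only zero inputs give sinusoidal trajectories of
nonzero frequency without energy supply. -/
def StrictFrequencyInequality (A : Matrix ι ι ℝ) (B : Matrix ι μ ℝ) (C : Matrix μ ι ℝ) : Prop :=
  ∀ (ω : ℝ) (x : ι → ℂ) (u : μ → ℂ), ω ≠ 0 → (Complex.I * ω) • x = cx A *ᵥ x + cx B *ᵥ u →
    (Complex.I * ω * (star u ⬝ᵥ cx C *ᵥ x)).re ≤ 0 → u = 0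

omit [DecidableEq ι] in
-- In a periodic motion the supplies of plant and controller add up to zero, because the symmetric
-- D' contributes none. Strictness gives Cx = 0; then x' = 0, as jω is no eigenvalue of A', and x =
-- 0 by observability.
lemma closedLoop_no_imaginary_eigenvalue (hf : FrequencyInequality A B C)
    (hf' : StrictFrequencyInequality A' B' C') (hD' : D'ᵀ = D') (ho : Observable A C)
    {ω : ℝ} (hω : ω ≠ 0)
    (hA' : (Complex.I * ω) ∉ spectrum ℂ (cx A')) {z : ι ⊕ κ → ℂ}
    (hz : cx (closedLoop A B C 0 A' B' C' D') *ᵥ z = (Complex.I * ω) • z) : z = 0 := by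
  obtain ⟨x, x', rfl⟩ : ∃ x x', z = Sum.elim x x' := ⟨_, _, (Sum.elim_comp_inl_inr z).symm⟩
  have hcl : cx (closedLoop A B C 0 A' B' C' D') *ᵥ Sum.elim x x' =
      Sum.elim (cx A *ᵥ x + cx B *ᵥ (cx C' *ᵥ x' + cx D' *ᵥ (cx C *ᵥ x)))
        (cx A' *ᵥ x' + cx B' *ᵥ (cx C *ᵥ x)) := by
    rw [closedLoop_zero, cx, fromBlocks_map, fromBlocks_mulVec]
    simp only [Sum.elim_comp_inl, Sum.elim_comp_inr]
    change Sum.elim (cx (A + B * D' * C) *ᵥ x + cx (B * C') *ᵥ x')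
      (cx (B' * C) *ᵥ x + cx A' *ᵥ x') = _
    rw [cx_add, cx_mul, cx_mul, cx_mul, cx_mul]
    simp only [add_mulVec, mulVec_add, ← mulVec_mulVec]
    congr 1 <;> abel
  rw [hcl] at hz
  obtain ⟨u, hu⟩ : ∃ u, u = cx C' *ᵥ x' + cx D' *ᵥ (cx C *ᵥ x) := ⟨_, rfl⟩
  rw [← hu] at hz
  have hz1 : (Complex.I * ω) • x = cx A *ᵥ x + cx B *ᵥ u :=
    (funext fun i => congrFun hz (Sum.inl i)).symm
  have hz2 : (Complex.I * ω) • x' = cx A' *ᵥ x' + cx B' *ᵥ (cx C *ᵥ x) :=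
    (funext fun i => congrFun hz (Sum.inr i)).symm
  have h1 := hf ω x u hz1
  obtain ⟨y, hy⟩ : ∃ y, y = cx C *ᵥ x := ⟨_, rfl⟩
  have hre : ∀ z : ℂ, (Complex.I * ω * z).re = -(ω * z.im) := fun z => by simp
  have hy0 : cx C *ᵥ x = 0 := by
    refine hf' ω x' _ hω hz2 ?_
    rw [hre] at h1 ⊢
    rw [← hy] at h1 hu ⊢
    have h2 : (star u ⬝ᵥ y).im = -(star y ⬝ᵥ cx C' *ᵥ x').im := by
      have h3 : (star u ⬝ᵥ y).im = -(star y ⬝ᵥ u).im := by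
        rw [star_dotProduct, Complex.star_def, Complex.conj_im]
      rw [h3, hu, dotProduct_add, Complex.add_im, star_dotProduct_cx_im hD', add_zero]
    rw [h2] at h1
    linarith
  rw [hy0, mulVec_zero, add_zero] at hz2
  have hx' : x' = 0 := by
    by_contra hne
    exact hA' (mem_spectrum_iff_exists_mulVec.mpr ⟨x', hne, hz2.symm⟩)
  rw [hu, hx', hy0, mulVec_zero, mulVec_zero, add_zero, mulVec_zero, add_zero] at hz1
  have hx : x = 0 := ho.eq_zero_of_eigenvector hz1.symm hy0
  rw [hx, hx']
  ext (i | i) <;> rfl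

/-- The interconnection is stable if and only if its storage function is positive definite. -/
theorem isHurwitz_closedLoop_iff (h : Dissipative A B C P) (h' : Dissipative A' B' C' P')
    (hc : Controllable A B) (hc' : Controllable A' B') (ho : Observable A C)
    (hP : Pᵀ = P) (hP' : P'.PosDef) (hD' : D'ᵀ = D')
    (hf : FrequencyInequality A B C) (hf' : StrictFrequencyInequality A' B' C')
    (hA' : IsHurwitz A') :
    IsHurwitz (closedLoop A B C 0 A' B' C' D') ↔ (loopStorage P C P' C' D').PosDef := by
  have hP's : P'ᵀ = P' := by simpa using hP'.isHermitian.eq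
  have hdis := loopStorage_dissipated h h' hP hP's hD'
  constructor
  · intro hH
    have hu : IsUnit (closedLoop A B C 0 A' B' C' D') := by
      rw [Matrix.isUnit_iff_isUnit_det, isUnit_iff_ne_zero]
      intro hdet
      obtain ⟨z, hz0, hz⟩ := Matrix.exists_mulVec_eq_zero_iff.mpr hdet
      have := hH 0 (mem_spectrum_iff_exists_mulVec.mpr ⟨fun i => (z i : ℂ), fun h0 => hz0 (by
        ext i; have := congrFun h0 i; simpa using this), by
          rw [cx_mulVec_ofReal, hz]; ext i; simp⟩)
      simp at this
    exact posDef_of_lyapunov (loopStorage_symm hP hP's hD')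
      (loopStorage_nondegenerate h h' hP hP' ho hu) hdis
      fun x l hx hl => Or.inl (hH l (mem_spectrum_iff_exists_mulVec.mpr ⟨x, hx, hl⟩))
  · intro hQ s hs
    obtain ⟨z, hz0, hz⟩ := mem_spectrum_iff_exists_mulVec.mp hs
    by_contra hneg
    push Not at hneg
    have hQs := loopStorage_symm (C := C) (C' := C') hP hP's hD'
    obtain ⟨Q, hQd⟩ : ∃ Q, Q = loopStorage P C P' C' D' := ⟨_, rfl⟩
    have hform : (star z ⬝ᵥ cx Q *ᵥ (cx (closedLoop A B C 0 A' B' C' D') *ᵥ z)).re ≤ 0 := by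
      rw [star_dotProduct_re, hQd]
      simp only [cx_mulVec_re, cx_mulVec_im]
      exact add_nonpos (hdis _) (hdis _)
    have hpos : 0 < (star z ⬝ᵥ cx Q *ᵥ z).re := by
      have hQp : ∀ x, 0 ≤ x ⬝ᵥ Q *ᵥ x := fun x => by
        rw [hQd]; simpa using hQ.posSemidef.dotProduct_mulVec_nonneg x
      rw [star_dotProduct_re]
      simp only [cx_mulVec_re, cx_mulVec_im]
      by_contra hle
      push Not at hle
      have h1 := hQp fun i => (z i).re
      have h2 := hQp fun i => (z i).im
      have hzero : ∀ x, x ⬝ᵥ Q *ᵥ x ≤ 0 → x = 0 := fun x hx => by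
        by_contra hx0
        have := hQ.dotProduct_mulVec_pos hx0
        rw [← hQd] at this
        simp only [star_trivial] at this
        linarith
      have h3 := hzero _ (by linarith : (fun i => (z i).re) ⬝ᵥ Q *ᵥ (fun i => (z i).re) ≤ 0)
      have h4 := hzero _ (by linarith : (fun i => (z i).im) ⬝ᵥ Q *ᵥ (fun i => (z i).im) ≤ 0)
      exact hz0 (funext fun i => Complex.ext (congrFun h3 i) (congrFun h4 i))
    rw [hz, mulVec_smul, dotProduct_smul, smul_eq_mul, Complex.mul_re,
      star_dotProduct_cx_im (by rw [hQd]; exact hQs), mul_zero, sub_zero] at hform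
    -- Dissipation reads Re s · z*Qz ≤ 0. An eigenvalue outside the open left half plane is thus
    -- imaginary; zero and nonzero ones are excluded separately.
    have hs0 : s.re = 0 := le_antisymm (by
      by_contra hlt
      push Not at hlt
      have := mul_pos hlt hpos
      linarith) hneg
    have hsI : s = Complex.I * (s.im : ℂ) := by apply Complex.ext <;> simp [hs0]
    by_cases him : s.im = 0
    · have hs00 : s = 0 := Complex.ext hs0 him
      rw [hs00, zero_smul] at hz
      have hreal : ∀ x, closedLoop A B C 0 A' B' C' D' *ᵥ x = 0 → x = 0 := fun x hx =>
        Matrix.mulVec_injective_of_isUnit hQ.isUnit (by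
          rw [loopStorage_equilibrium h h' hc hc' hP hP's hx, mulVec_zero])
      have h3 := hreal (fun i => (z i).re) (by ext i; rw [← cx_mulVec_re, hz]; simp)
      have h4 := hreal (fun i => (z i).im) (by ext i; rw [← cx_mulVec_im, hz]; simp)
      exact hz0 (funext fun i => Complex.ext (congrFun h3 i) (congrFun h4 i))
    · rw [hsI] at hz
      refine hz0 (closedLoop_no_imaginary_eigenvalue hf hf' hD' ho him (fun hmem => ?_) hz)
      have := hA' _ hmem
      simp at this

end ClosedLoop

/-! ### Consequences of the NI and SNI conditions -/

section NISystem

variable [Fintype ι] [DecidableEq ι] [Fintype μ]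
  {A : Matrix ι ι ℝ} {B : Matrix ι μ ℝ} {C : Matrix μ ι ℝ} {D : Matrix μ μ ℝ} {P : Matrix ι ι ℝ}

omit [DecidableEq ι] in
lemma sinusoid_star {ω : ℝ} {x : ι → ℂ} {u : μ → ℂ}
    (h : (Complex.I * ω) • x = cx A *ᵥ x + cx B *ᵥ u) :
    (Complex.I * (-ω : ℝ)) • star x = cx A *ᵥ star x + cx B *ᵥ star u := by
  have := congrArg star h
  rw [star_add, star_smul, star_cx_mulVec, star_cx_mulVec] at this
  rw [← this]
  simp

omit [DecidableEq ι] in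
lemma star_form_star (M : Matrix μ ι ℝ) (x : ι → ℂ) (u : μ → ℂ) :
    star (star u) ⬝ᵥ cx M *ᵥ star x = star (star u ⬝ᵥ cx M *ᵥ x) := by
  rw [← star_cx_mulVec, star_dotProduct_star, dotProduct_comm]

omit [DecidableEq ι] [Fintype μ] in
lemma star_vecMul_cx (M : Matrix ι μ ℝ) (y : ι → ℂ) : star y ᵥ* cx M = star (cx Mᵀ *ᵥ y) := by
  ext i; simp [vecMul, mulVec, dotProduct, mul_comm]

lemma IsNI.frequencyInequality (hNI : IsNI fun s : ℂ => transfer A B C 0 s)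
    (hc : Controllable A B) : FrequencyInequality A B C :=
  frequency_inequality hc (D := 0) transpose_zero fun ω hω hs =>
    hNI.freq ω hω (not_isPole_transfer hs B C 0)

lemma IsNI.re_nonpos (hNI : IsNI fun s : ℂ => transfer A B C 0 s) (hc : Controllable A B)
    (ho : Observable A C) {s : ℂ} (hs : s ∈ spectrum ℂ (cx A)) : s.re ≤ 0 := by
  by_contra hpos
  push Not at hpos
  exact notMem_spectrum_of_not_isPole hc ho (hNI.no_pole s hpos) hs

open scoped ComplexOrder in
lemma IsSNI.feedthrough_symm (hSNI : IsSNI fun s : ℂ => transfer A B C D s) : Dᵀ = D :=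
  NegImag.feedthrough_symm (by
    filter_upwards [eventually_gt_atTop 0] with ω hω using (hSNI.freq ω hω).posSemidef)

open scoped ComplexOrder in
lemma IsSNI.frequencyInequality (hSNI : IsSNI fun s : ℂ => transfer A B C D s)
    (hc : Controllable A B) : FrequencyInequality A B C :=
  frequency_inequality hc hSNI.feedthrough_symm fun ω hω _ => (hSNI.freq ω hω).posSemidef

lemma IsSNI.isHurwitz (hSNI : IsSNI fun s : ℂ => transfer A B C D s)
    (hc : Controllable A B) (ho : Observable A C) : IsHurwitz A := by
  intro s hs
  by_contra hneg
  push Not at hneg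
  exact notMem_spectrum_of_not_isPole hc ho (hSNI.no_pole s hneg) hs

open scoped ComplexOrder in
lemma IsSNI.strictFrequencyInequality (hSNI : IsSNI fun s : ℂ => transfer A B C D s)
    (hA : IsHurwitz A) : StrictFrequencyInequality A B C := by
  have pos : ∀ (ω : ℝ), 0 < ω → ∀ (x : ι → ℂ) (u : μ → ℂ),
      (Complex.I * ω) • x = cx A *ᵥ x + cx B *ᵥ u → 0 ≤ (star u ⬝ᵥ cx C *ᵥ x).im → u = 0 := by
    intro ω hω x u hx him
    by_contra hu
    have h1 := (hSNI.freq ω hω).dotProduct_mulVec_pos hu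
    have hs : (Complex.I * ω) ∉ spectrum ℂ (cx A) := fun hmem => by
      have := hA _ hmem
      simp at this
    rw [star_dotProduct_skew, transfer_mulVec hs hx, dotProduct_add, Complex.add_im,
      star_dotProduct_cx_im hSNI.feedthrough_symm, Complex.zero_lt_real] at h1
    linarith
  intro ω x u hω hx hre
  have hre' : (Complex.I * ω * (star u ⬝ᵥ cx C *ᵥ x)).re =
      -(ω * (star u ⬝ᵥ cx C *ᵥ x).im) := by simp
  rw [hre'] at hre
  rcases lt_or_gt_of_ne hω with h | h
  · have := pos (-ω) (by linarith) (star x) (star u) (sinusoid_star hx) (by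
      rw [star_form_star, Complex.star_def, Complex.conj_im]
      nlinarith)
    exact star_eq_zero.mp this
  · exact pos ω h x u hx (by nlinarith)

omit [DecidableEq ι] in
lemma Dissipative.autonomous (h : Dissipative A B C P) (x : ι → ℝ) : x ⬝ᵥ P *ᵥ (A *ᵥ x) ≤ 0 := by
  simpa using h x 0

omit [DecidableEq ι] in
lemma Dissipative.ker_step (h : Dissipative A B C P) (hP : Pᵀ = P) {x : ι → ℝ}
    (hx : P *ᵥ x = 0) : P *ᵥ (A *ᵥ x) = 0 ∧ C *ᵥ (A *ᵥ x) = 0 := by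
  simpa using h.of_storage_gradient hP (x := x) (u := 0) (by rw [hx, mulVec_zero])

omit [DecidableEq ι] in
lemma Dissipative.gradient_autonomous (h : Dissipative A B C P) (hP : Pᵀ = P) {x : ι → ℝ}
    (hx : x ⬝ᵥ P *ᵥ (A *ᵥ x) = 0) :
    P *ᵥ (A *ᵥ x) + Aᵀ *ᵥ (P *ᵥ x) = 0 ∧ Bᵀ *ᵥ (P *ᵥ x) = C *ᵥ (A *ᵥ x) := by
  simpa using h.gradient hP (x := x) (u := 0) (by simpa using hx)

lemma IsHurwitz.isUnit (hA : IsHurwitz A) : IsUnit A := by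
  rw [Matrix.isUnit_iff_isUnit_det, isUnit_iff_ne_zero]
  intro hdet
  obtain ⟨z, hz0, hz⟩ := Matrix.exists_mulVec_eq_zero_iff.mpr hdet
  have := hA 0 (mem_spectrum_iff_exists_mulVec.mpr ⟨fun i => (z i : ℂ), fun h0 => hz0 (by
    ext i; have := congrFun h0 i; simpa using this), by
      rw [cx_mulVec_ofReal, hz]; ext i; simp⟩)
  simp at this

/-- Observability and invertibility of A make P nondegenerate, and there are no imaginary
eigenvectors to test in Lyapunov's theorem. -/
lemma Dissipative.posDef_of_isHurwitz (h : Dissipative A B C P) (hP : Pᵀ = P)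
    (ho : Observable A C) (hA : IsHurwitz A) : P.PosDef :=
  posDef_of_lyapunov hP
    (fun _ hx => ho.eq_zero_of_ker_of_isUnit hA.isUnit (fun _ hy => h.ker_step hP hy) hx)
    h.autonomous fun x l hx hl => Or.inl (hA l (mem_spectrum_iff_exists_mulVec.mpr ⟨x, hx, hl⟩))

open scoped ComplexOrder in
/-- A storage function of a negative imaginary system is positive on the eigenvectors to nonzero
imaginary eigenvalues. -/
lemma IsNI.form_pos_of_imaginary_eigenvector (hNI : IsNI fun s : ℂ => transfer A B C 0 s)
    (h : Dissipative A B C P) (hP : Pᵀ = P) (hc : Controllable A B) (ho : Observable A C)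
    {ω : ℝ} (hω : ω ≠ 0) {x : ι → ℂ} (hx0 : x ≠ 0) (hx : cx A *ᵥ x = (Complex.I * ω) • x) :
    0 < (star x ⬝ᵥ cx P *ᵥ x).re := by
  have pos : ∀ (ω : ℝ), 0 < ω → ∀ (x : ι → ℂ), x ≠ 0 → cx A *ᵥ x = (Complex.I * ω) • x →
      0 < (star x ⬝ᵥ cx P *ᵥ x).re := by
    intro ω hω x hx0 hx
    have hpole : IsPole (fun s : ℂ => transfer A B C 0 s) (Complex.I * ω) := by
      by_contra hnp
      exact notMem_spectrum_of_not_isPole hc ho hnp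
        (mem_spectrum_iff_exists_mulVec.mpr ⟨x, hx0, hx⟩)
    obtain ⟨-, K, hK, hKpsd⟩ := hNI.imag_pole ω hω hpole
    have hAa : (A *ᵥ fun i => (x i).re) = (-ω) • fun i => (x i).im := by
      ext i; rw [← cx_mulVec_re, hx]; simp
    have hAb : (A *ᵥ fun i => (x i).im) = ω • fun i => (x i).re := by
      ext i; rw [← cx_mulVec_im, hx]; simp
    -- The storage rates at Re x and Im x are nonpositive and cancel, so both are zero and the
    -- gradient equations hold at both.
    have hsum : (fun i => (x i).re) ⬝ᵥ P *ᵥ (A *ᵥ fun i => (x i).re) +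
        (fun i => (x i).im) ⬝ᵥ P *ᵥ (A *ᵥ fun i => (x i).im) = 0 := by
      rw [hAa, hAb, mulVec_smul, mulVec_smul, dotProduct_smul, dotProduct_smul,
        dotProduct_mulVec_symm hP, dotProduct_comm]
      simp
    have h1 := h.autonomous fun i => (x i).re
    have h2 := h.autonomous fun i => (x i).im
    obtain ⟨ga, ba⟩ := h.gradient_autonomous hP (le_antisymm h1 (by linarith))
    obtain ⟨gb, bb⟩ := h.gradient_autonomous hP (le_antisymm h2 (by linarith))
    have hAP : cx Aᵀ *ᵥ (cx P *ᵥ x) = -((Complex.I * ω) • (cx P *ᵥ x)) := by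
      rw [← mulVec_smul, ← hx]
      refine eq_neg_of_add_eq_zero_right ?_
      ext i
      apply Complex.ext
      · have := congrFun ga i
        simp only [Pi.add_apply, Complex.add_re, cx_mulVec_re]
        exact this
      · have := congrFun gb i
        simp only [Pi.add_apply, Complex.add_im, cx_mulVec_im]
        exact this
    have hBP : cx Bᵀ *ᵥ (cx P *ᵥ x) = (Complex.I * ω) • (cx C *ᵥ x) := by
      rw [← mulVec_smul, ← hx]
      ext i
      apply Complex.ext
      · have := congrFun ba i
        simpa only [cx_mulVec_re] using this
      · have := congrFun bb i
        simpa only [cx_mulVec_im] using this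
    obtain ⟨v, hv, hres⟩ := hc.exists_residue (C := C) (D := 0) x (Complex.I * ω)
    have hCx : cx C *ᵥ (Complex.I • x) = K *ᵥ v :=
      hres (fun s => (s - Complex.I * ω) * Complex.I) (fun _ => Complex.I • x) K (by fun_prop)
        continuous_const (by simp) (fun s => by rw [mulVec_smul, hx]; module) hK
    -- The covector (Px)* is a left eigenvector, so pairing it with x may be replaced by pairing it
    -- with Bv. This expresses x*Px through the residue form v*Kv.
    have h3 := hv (star (cx P *ᵥ x)) (by
      rw [star_vecMul_cx, hAP]
      ext i; simp)
    have hCx' : cx C *ᵥ x = (-Complex.I) • (K *ᵥ v) := by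
      rw [← hCx, mulVec_smul, smul_smul]; simp
    have h5 : star ((Complex.I * ω) • ((-Complex.I) • (K *ᵥ v))) = (ω : ℂ) • star (K *ᵥ v) := by
      ext i
      simp only [Pi.star_apply, Pi.smul_apply, smul_eq_mul, Complex.star_def, map_mul, map_neg,
        Complex.conj_I, Complex.conj_ofReal]
      linear_combination (-(ω : ℂ) * (starRingEnd ℂ) ((K *ᵥ v) i)) * Complex.I_mul_I
    have hKv := hKpsd.dotProduct_mulVec_nonneg v
    have hform : star x ⬝ᵥ cx P *ᵥ x = (ω : ℂ) * star (star v ⬝ᵥ K *ᵥ v) := by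
      rw [star_dotProduct_cx_mulVec hP, h3, dotProduct_mulVec, star_vecMul_cx, hBP, hCx', h5, smul_dotProduct,
        smul_eq_mul, star_dotProduct]
    have hre : (star x ⬝ᵥ cx P *ᵥ x).re = ω * (star v ⬝ᵥ K *ᵥ v).re := by
      rw [hform, Complex.re_ofReal_mul, Complex.star_def, Complex.conj_re]
    obtain ⟨hr, hi⟩ := Complex.nonneg_iff.mp hKv
    rw [hre]
    refine mul_pos hω (lt_of_le_of_ne hr fun h0 => hx0 (ho.eq_zero_of_eigenvector hx ?_))
    have hKv0 : K *ᵥ v = 0 :=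
      (hKpsd.dotProduct_mulVec_zero_iff v).mp (Complex.ext h0.symm hi.symm)
    rw [hCx', hKv0, smul_zero]
  rcases lt_or_gt_of_ne hω with hneg | hpos
  · have hx' : cx A *ᵥ star x = (Complex.I * (-ω : ℝ)) • star x := by
      rw [← star_cx_mulVec, hx]; ext i; simp
    have := pos (-ω) (by linarith) (star x) (star_ne_zero.mpr hx0) hx'
    rwa [star_form_star, Complex.star_def, Complex.conj_re] at this
  · exact pos ω hpos x hx0 hx

open scoped ComplexOrder in
/-- A storage function of a negative imaginary system is positive on the double integrator
states. -/
lemma IsNI.form_pos_of_double_integrator (hNI : IsNI fun s : ℂ => transfer A B C 0 s)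
    (h : Dissipative A B C P) (hP : Pᵀ = P) (hc : Controllable A B) (ho : Observable A C)
    {x x' : ι → ℝ} (hx : A *ᵥ x = x') (hx' : A *ᵥ x' = 0) (hx0 : x' ≠ 0) :
    0 < x ⬝ᵥ P *ᵥ x := by
  have hPx' : P *ᵥ x' = 0 := by
    simpa using h.equilibrium hc hP (x := x') (u := 0) (by rw [hx', mulVec_zero, add_zero])
  have hcx0 : (fun i => (x' i : ℂ)) ≠ 0 := fun h0 => hx0 (by
    ext i; have := congrFun h0 i; simpa using this)
  have hAx' : cx A *ᵥ (fun i => (x' i : ℂ)) = (0 : ℂ) • (fun i => (x' i : ℂ)) := by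
    rw [cx_mulVec_ofReal, hx']; ext i; simp
  have hpole : IsPole (fun s : ℂ => transfer A B C 0 s) 0 := by
    by_contra hnp
    exact notMem_spectrum_of_not_isPole hc ho hnp
      (mem_spectrum_iff_exists_mulVec.mpr ⟨_, hcx0, hAx'⟩)
  obtain ⟨-, K, hK, hKpsd⟩ := hNI.zero_pole hpole
  obtain ⟨g, b⟩ := h.gradient_autonomous hP (x := x) (by rw [hx, hPx', dotProduct_zero])
  rw [hx] at g b
  rw [hPx', zero_add] at g
  obtain ⟨v, hv, hres⟩ := hc.exists_residue (C := C) (D := 0) (fun i => (x i : ℂ)) 0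
  -- As Ax = x' and Ax' = 0, y = sx + x' solves sy = Ay + s²x, and y(0) = x'.
  have hCx := hres (fun s => s ^ 2) (fun s => s • (fun i => (x i : ℂ)) + fun i => (x' i : ℂ)) K
    (by fun_prop) (by fun_prop) (by simp) (fun s => by
      rw [mulVec_add, mulVec_smul, hAx', cx_mulVec_ofReal, hx]; module) hK
  simp only [zero_smul, zero_add] at hCx
  have h3 := hv (fun i => ((P *ᵥ x) i : ℂ)) (by
    have : (fun i => ((P *ᵥ x) i : ℂ)) ᵥ* cx A = cx Aᵀ *ᵥ (fun i => ((P *ᵥ x) i : ℂ)) := by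
      ext i; simp [vecMul, mulVec, dotProduct, mul_comm]
    rw [this, cx_mulVec_ofReal, g]; ext i; simp)
  have h4 : (fun i => ((P *ᵥ x) i : ℂ)) ᵥ* cx B = star (K *ᵥ v) := by
    have : (fun i => ((P *ᵥ x) i : ℂ)) ᵥ* cx B = cx Bᵀ *ᵥ (fun i => ((P *ᵥ x) i : ℂ)) := by
      ext i; simp [vecMul, mulVec, dotProduct, mul_comm]
    rw [this, cx_mulVec_ofReal, b, ← hCx, cx_mulVec_ofReal]
    ext i; simp
  rw [dotProduct_mulVec, h4, star_dotProduct] at h3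
  have hform : x ⬝ᵥ P *ᵥ x = (star v ⬝ᵥ K *ᵥ v).re := by
    have := congrArg Complex.re h3
    rw [Complex.star_def, Complex.conj_re] at this
    rw [← this, dotProduct_mulVec_symm hP]
    simp [dotProduct]
  obtain ⟨hr, hi⟩ := Complex.nonneg_iff.mp (hKpsd.dotProduct_mulVec_nonneg v)
  rw [hform]
  refine lt_of_le_of_ne hr fun h0 => hcx0 (ho.eq_zero_of_eigenvector hAx' ?_)
  rw [hCx]
  exact (hKpsd.dotProduct_mulVec_zero_iff v).mp (Complex.ext h0.symm hi.symm)

end NISystem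

/-! ### Eliminating the controller state -/

section Controller

variable [Fintype ι] [DecidableEq ι] [Fintype μ]
  {A : Matrix ι ι ℝ} {B : Matrix ι μ ℝ} {C : Matrix μ ι ℝ} {D : Matrix μ μ ℝ} {P : Matrix ι ι ℝ}

/-- Every constant input u has the equilibrium −A⁻¹Bu, so −PA⁻¹B = Cᵀ. -/
lemma Dissipative.transfer_zero [DecidableEq μ] (h : Dissipative A B C P) (hc : Controllable A B)
    (hP : P.PosDef) (hA : IsUnit A) : transfer A B C D (0 : ℝ) = D + C * P⁻¹ * Cᵀ := by
  have hP's : Pᵀ = P := by simpa using hP.isHermitian.eq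
  have hdet := (Matrix.isUnit_iff_isUnit_det _).mp hA
  have hdetP := (Matrix.isUnit_iff_isUnit_det _).mp hP.isUnit
  have h1 : P * (-(A⁻¹ * B)) = Cᵀ := by
    refine Matrix.toLin'.injective (LinearMap.ext fun u => ?_)
    rw [toLin'_apply, toLin'_apply, ← mulVec_mulVec]
    refine h.equilibrium hc hP's ?_
    rw [neg_mulVec, mulVec_neg, mulVec_mulVec, ← Matrix.mul_assoc, Matrix.mul_nonsing_inv _ hdet,
      Matrix.one_mul, neg_add_cancel]
  have h2 : P⁻¹ * Cᵀ = -(A⁻¹ * B) := by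
    rw [← h1, ← Matrix.mul_assoc, Matrix.nonsing_inv_mul _ hdetP, Matrix.one_mul]
  have h3 : (-A)⁻¹ = -A⁻¹ := by
    refine Matrix.inv_eq_left_inv ?_
    rw [neg_mul_neg, Matrix.nonsing_inv_mul _ hdet]
  rw [Matrix.mul_assoc, h2, transfer]
  simp only [Algebra.algebraMap_self, RingHom.coe_id, Matrix.map_id, zero_smul, zero_sub, h3]
  rw [add_comm]
  simp [Matrix.mul_assoc]

lemma loopStorage_posDef_iff [Fintype κ] [DecidableEq κ] {P' : Matrix κ κ ℝ} {C' : Matrix μ κ ℝ}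
    (hP' : P'.PosDef) :
    (loopStorage P C P' C' D).PosDef ↔ (P - Cᵀ * (D + C' * P'⁻¹ * C'ᵀ) * C).PosDef := by
  have h1 : loopStorage P C P' C' D =
      fromBlocks (P - Cᵀ * D * C) (-(Cᵀ * C')) (-(Cᵀ * C'))ᵀ P' := by
    simp [loopStorage]
  rw [h1, posDef_fromBlocks_iff₂₂ _ _ hP']
  have h2 : P - Cᵀ * D * C - -(Cᵀ * C') * P'⁻¹ * (-(Cᵀ * C'))ᵀ =
      P - Cᵀ * (D + C' * P'⁻¹ * C'ᵀ) * C := by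
    simp only [transpose_neg, transpose_mul, transpose_transpose, Matrix.neg_mul, Matrix.mul_neg,
      neg_neg, Matrix.mul_add, Matrix.add_mul, Matrix.mul_assoc]
    abel
  rw [h2]

end Controller

/-! ### Structure and positivity of the plant storage -/

section Plant

variable {n₁ n₂ k : ℕ} {μ : Type*} [Fintype μ]
  {A₁ : Matrix (Fin n₁) (Fin n₁) ℝ}
  {B₁ : Matrix (Fin n₁) μ ℝ} {B₂ : Matrix (Fin n₂) μ ℝ} {B₃a B₃b : Matrix (Fin k) μ ℝ}
  {C₁ : Matrix μ (Fin n₁) ℝ} {C₂ : Matrix μ (Fin n₂) ℝ} {C₃a C₃b : Matrix μ (Fin k) ℝ}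
  {P : Matrix (Fin n₁ ⊕ (Fin n₂ ⊕ (Fin k ⊕ Fin k))) (Fin n₁ ⊕ (Fin n₂ ⊕ (Fin k ⊕ Fin k))) ℝ}
  {P₁ : Matrix (Fin n₁) (Fin n₁) ℝ} {P₂ : Matrix (Fin k) (Fin k) ℝ}

/-- Storage matrices of a system with state matrix `plantA A₁`. -/
def plantStorage (n₂ : ℕ) (P₁ : Matrix (Fin n₁) (Fin n₁) ℝ) (P₂ : Matrix (Fin k) (Fin k) ℝ) :
    Matrix (Fin n₁ ⊕ (Fin n₂ ⊕ (Fin k ⊕ Fin k))) (Fin n₁ ⊕ (Fin n₂ ⊕ (Fin k ⊕ Fin k))) ℝ :=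
  fromBlocks P₁ 0 0 (fromBlocks 0 0 0 (fromBlocks 0 0 0 P₂))

lemma plantA_mulVec (x₁ : Fin n₁ → ℝ) (x₂ : Fin n₂ → ℝ) (xa xb : Fin k → ℝ) :
    plantA A₁ *ᵥ Sum.elim x₁ (Sum.elim x₂ (Sum.elim xa xb)) =
      Sum.elim (A₁ *ᵥ x₁) (Sum.elim 0 (Sum.elim xb 0)) := by
  simp [plantA, fromBlocks_mulVec]

lemma plantA_transpose_mulVec (x₁ : Fin n₁ → ℝ) (x₂ : Fin n₂ → ℝ) (xa xb : Fin k → ℝ) :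
    (plantA A₁)ᵀ *ᵥ Sum.elim x₁ (Sum.elim x₂ (Sum.elim xa xb)) =
      Sum.elim (A₁ᵀ *ᵥ x₁) (Sum.elim 0 (Sum.elim 0 xa)) := by
  simp [plantA, fromBlocks_mulVec, fromBlocks_transpose]

lemma cx_plantA_mulVec (x₁ : Fin n₁ → ℂ) :
    cx (plantA (n₂ := n₂) (k := k) A₁) *ᵥ Sum.elim x₁ 0 = Sum.elim (cx A₁ *ᵥ x₁) 0 := by
  simp [plantA, cx, fromBlocks_map, fromBlocks_mulVec]

lemma plantStorage_mulVec (x₁ : Fin n₁ → ℝ) (x₂ : Fin n₂ → ℝ) (xa xb : Fin k → ℝ) :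
    plantStorage n₂ P₁ P₂ *ᵥ Sum.elim x₁ (Sum.elim x₂ (Sum.elim xa xb)) =
      Sum.elim (P₁ *ᵥ x₁) (Sum.elim 0 (Sum.elim 0 (P₂ *ᵥ xb))) := by
  simp [plantStorage, fromBlocks_mulVec]

lemma cx_plantStorage_mulVec (x₁ : Fin n₁ → ℂ) :
    cx (plantStorage n₂ P₁ P₂) *ᵥ Sum.elim x₁ 0 = Sum.elim (cx P₁ *ᵥ x₁) 0 := by
  simp [plantStorage, cx, fromBlocks_map, fromBlocks_mulVec]

lemma plantStorage_symm (hP₁ : P₁ᵀ = P₁) (hP₂ : P₂ᵀ = P₂) :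
    (plantStorage n₂ P₁ P₂)ᵀ = plantStorage n₂ P₁ P₂ := by
  simp [plantStorage, fromBlocks_transpose, hP₁, hP₂]

/-- The storage functions of the plant are block diagonal. -/
lemma Dissipative.exists_plantStorage {B : Matrix (Fin n₁ ⊕ (Fin n₂ ⊕ (Fin k ⊕ Fin k))) μ ℝ}
    {C : Matrix μ (Fin n₁ ⊕ (Fin n₂ ⊕ (Fin k ⊕ Fin k))) ℝ}
    (h : Dissipative (plantA A₁) B C P) (hP : Pᵀ = P)
    (hc : Controllable (plantA A₁) B) (hA₁ : IsUnit A₁) :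
    ∃ P₁ P₂, P₁ᵀ = P₁ ∧ P₂ᵀ = P₂ ∧ P = plantStorage n₂ P₁ P₂ := by
  have hsymm : ∀ i j, P i j = P j i := fun i j => by rw [← congrFun (congrFun hP i) j]; rfl
  have hker : ∀ x, plantA A₁ *ᵥ x = 0 → P *ᵥ x = 0 := fun x hx => by
    simpa using h.equilibrium hc hP (x := x) (u := 0) (by rw [hx, mulVec_zero, add_zero])
  -- States in ker A are equilibria without input, so P vanishes on them. This disposes of the zero
  -- block and of the integrator positions.
  have hcol : ∀ j, (plantA A₁).col j = 0 → ∀ i, P i j = 0 := fun j hj i => by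
    have := congrFun (hker (Pi.single j 1) (by rw [mulVec_single_one, hj])) i
    rwa [mulVec_single_one] at this
  have h2 : ∀ i j, P i (Sum.inr (Sum.inl j)) = 0 := fun i j => hcol _ (by
    ext (i | i | i | i) <;> simp [plantA]) i
  have h3 : ∀ i j, P i (Sum.inr (Sum.inr (Sum.inl j))) = 0 := fun i j => hcol _ (by
    ext (i | i | i | i) <;> simp [plantA]) i
  -- For an integrator velocity x, Ax lies in ker P, so the gradient gives AᵀPx = 0; invertibility
  -- of A₁ kills the first component of Px.
  have h4 : ∀ i j, P (Sum.inl i) (Sum.inr (Sum.inr (Sum.inr j))) = 0 := fun i j => by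
    let x := Sum.elim (0 : Fin n₁ → ℝ) (Sum.elim (0 : Fin n₂ → ℝ)
      (Sum.elim (0 : Fin k → ℝ) (Pi.single j 1)))
    have hx : P *ᵥ (plantA A₁ *ᵥ x) = 0 := hker _ (by
      rw [plantA_mulVec, plantA_mulVec]; simp)
    have g := (h.gradient_autonomous hP (x := x) (by rw [hx, dotProduct_zero])).1
    rw [hx, zero_add, ← Sum.elim_comp_inl_inr (P *ᵥ x),
      ← Sum.elim_comp_inl_inr ((P *ᵥ x) ∘ Sum.inr),
      ← Sum.elim_comp_inl_inr (((P *ᵥ x) ∘ Sum.inr) ∘ Sum.inr), plantA_transpose_mulVec] at g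
    have g1 : A₁ᵀ *ᵥ ((P *ᵥ x) ∘ Sum.inl) = 0 := by
      ext i; exact congrFun g (Sum.inl i)
    have g2 : (P *ᵥ x) ∘ Sum.inl = 0 := Matrix.mulVec_injective_of_isUnit
      ((Matrix.isUnit_transpose A₁).mpr hA₁) (by rw [g1, mulVec_zero])
    have hxs : x = Pi.single (Sum.inr (Sum.inr (Sum.inr j))) 1 := by
      ext (i | i | i | i) <;> simp [x, Pi.single_apply]
    have := congrFun g2 i
    rwa [hxs, mulVec_single_one] at this
  refine ⟨fun i j => P (Sum.inl i) (Sum.inl j),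
    fun i j => P (Sum.inr (Sum.inr (Sum.inr i))) (Sum.inr (Sum.inr (Sum.inr j))), ?_, ?_, ?_⟩
  · ext i j; exact hsymm _ _
  · ext i j; exact hsymm _ _
  · ext (i | i | i | i) (j | j | j | j) <;>
      first
      | exact h2 _ _
      | exact h3 _ _
      | exact h4 _ _
      | exact (hsymm _ _).trans (h2 _ _)
      | exact (hsymm _ _).trans (h3 _ _)
      | exact (hsymm _ _).trans (h4 _ _)
      | rfl

local notation "Bp" => fromRows B₁ (fromRows B₂ (fromRows B₃a B₃b))
local notation "Cp" => fromCols C₁ (fromCols C₂ (fromCols C₃a C₃b))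

/-- At an integrator velocity with zero input the velocity vector lies in ker P, so the inequality
is tight; this is the input part of the gradient. -/
lemma Dissipative.double_integrator_gain
    (h : Dissipative (plantA A₁) Bp Cp (plantStorage n₂ P₁ P₂)) (hP₁ : P₁ᵀ = P₁) (hP₂ : P₂ᵀ = P₂) :
    B₃bᵀ * P₂ = C₃a := by
  refine Matrix.toLin'.injective (LinearMap.ext fun u => ?_)
  have := (h.gradient_autonomous (plantStorage_symm hP₁ hP₂) (x := Sum.elim 0 (Sum.elim 0 (Sum.elim 0 u)))
    (by simp [plantA_mulVec, plantStorage_mulVec])).2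
  simpa [plantA_mulVec, plantStorage_mulVec, transpose_fromRows, fromCols_mulVec] using this

/-- Covectors supported on the last block are left null vectors of the state matrix, so by
controllability B₃b has full row rank. -/
lemma Controllable.isUnit_input_gram [DecidableEq μ] (hc : Controllable (plantA A₁) Bp) :
    IsUnit (B₃b * B₃bᵀ) := by
  rw [Matrix.isUnit_iff_isUnit_det, isUnit_iff_ne_zero]
  intro hdet
  obtain ⟨p, hp0, hp⟩ := Matrix.exists_mulVec_eq_zero_iff.mpr hdet
  have hBp : B₃bᵀ *ᵥ p = 0 := by
    rw [← mulVec_mulVec] at hp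
    have : (B₃bᵀ *ᵥ p) ⬝ᵥ (B₃bᵀ *ᵥ p) = 0 := by
      rw [← dotProduct_mulVec_transpose, hp, dotProduct_zero]
    exact dotProduct_self_eq_zero.mp this
  have := hc.eq_zero (p := Sum.elim 0 (Sum.elim 0 (Sum.elim 0 p)))
    (by rw [plantA_transpose_mulVec]; simp)
    (by simp [transpose_fromRows, fromCols_mulVec, hBp])
  exact hp0 (by ext i; exact congrFun this (Sum.inr (Sum.inr (Sum.inr i))))

lemma Dissipative.double_integrator_storage [DecidableEq μ]
    (h : Dissipative (plantA A₁) Bp Cp (plantStorage n₂ P₁ P₂)) (hP₁ : P₁ᵀ = P₁) (hP₂ : P₂ᵀ = P₂)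
    (hc : Controllable (plantA A₁) Bp) :
    C₃aᵀ * B₃bᵀ * (B₃b * B₃bᵀ)⁻¹ = P₂ := by
  rw [← h.double_integrator_gain hP₁ hP₂, transpose_mul, transpose_transpose, hP₂,
    Matrix.mul_assoc P₂, Matrix.mul_assoc P₂, Matrix.mul_nonsing_inv, Matrix.mul_one]
  exact (Matrix.isUnit_iff_isUnit_det _).mp hc.isUnit_input_gram

/-- Lyapunov's theorem for A₁. Nondegeneracy holds because the image of ker P₁ under A₁ is an
unobservable invariant subspace; imaginary eigenvalues are nonzero since A₁ is invertible, and are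
covered by the residue condition. -/
lemma IsNI.posDef_nonsingular_storage [DecidableEq μ]
    {B : Matrix (Fin n₁ ⊕ (Fin n₂ ⊕ (Fin k ⊕ Fin k))) μ ℝ}
    {C : Matrix μ (Fin n₁ ⊕ (Fin n₂ ⊕ (Fin k ⊕ Fin k))) ℝ}
    (hNI : IsNI fun s : ℂ => transfer (plantA A₁) B C 0 s)
    (h : Dissipative (plantA A₁) B C (plantStorage n₂ P₁ P₂)) (hP₁ : P₁ᵀ = P₁) (hP₂ : P₂ᵀ = P₂)
    (hc : Controllable (plantA A₁) B) (ho : Observable (plantA A₁) C) (hA₁ : IsUnit A₁) :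
    P₁.PosDef := by
  have hP := plantStorage_symm (n₂ := n₂) hP₁ hP₂
  have hstep : ∀ x, P₁ *ᵥ x = 0 → P₁ *ᵥ (A₁ *ᵥ x) = 0 ∧
      C *ᵥ Sum.elim (A₁ *ᵥ x) (Sum.elim 0 (Sum.elim 0 0)) = 0 := fun x hx => by
    obtain ⟨k1, k2⟩ := h.ker_step hP (x := Sum.elim x (Sum.elim 0 (Sum.elim 0 0)))
      (by rw [plantStorage_mulVec, hx]; simp)
    rw [plantA_mulVec] at k1 k2
    rw [plantStorage_mulVec] at k1
    exact ⟨by ext i; exact congrFun k1 (Sum.inl i), k2⟩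
  have hnd : ∀ x, P₁ *ᵥ x = 0 → x = 0 := fun x hx => by
    have hU := ho ((LinearMap.ker P₁.mulVecLin).map
      (fromRows A₁ (0 : Matrix (Fin n₂ ⊕ (Fin k ⊕ Fin k)) (Fin n₁) ℝ)).mulVecLin) ?_ ?_
    · have h0 : Sum.elim (A₁ *ᵥ x) (0 : Fin n₂ ⊕ (Fin k ⊕ Fin k) → ℝ) = 0 :=
        (Submodule.eq_bot_iff _).mp hU _ ⟨x, hx, by simp [fromRows_mulVec]⟩
      exact Matrix.mulVec_injective_of_isUnit hA₁ (by
        ext i; simpa using congrFun h0 (Sum.inl i))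
    · rintro _ ⟨y, hy, rfl⟩
      refine ⟨A₁ *ᵥ y, (hstep y hy).1, ?_⟩
      have := plantA_mulVec (A₁ := A₁) (A₁ *ᵥ y) (0 : Fin n₂ → ℝ) (0 : Fin k → ℝ) 0
      simpa [fromRows_mulVec] using this.symm
    · rintro _ ⟨y, hy, rfl⟩
      simpa [fromRows_mulVec] using (hstep y hy).2
  refine posDef_of_lyapunov (A := A₁) hP₁ hnd (fun x => ?_) fun x l hx0 hx => ?_
  · have := h.autonomous (Sum.elim x (Sum.elim 0 (Sum.elim 0 0)))
    rw [plantA_mulVec, plantStorage_mulVec] at this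
    simpa [sumElim_dotProduct] using this
  · have hz0 : Sum.elim x (0 : Fin n₂ ⊕ (Fin k ⊕ Fin k) → ℂ) ≠ 0 := fun h0 => hx0 (by
      ext i; simpa using congrFun h0 (Sum.inl i))
    have hz : cx (plantA A₁) *ᵥ Sum.elim x (0 : Fin n₂ ⊕ (Fin k ⊕ Fin k) → ℂ) =
        l • Sum.elim x 0 := by
      rw [cx_plantA_mulVec, hx]
      ext (i | i) <;> simp
    rcases (hNI.re_nonpos hc ho (mem_spectrum_iff_exists_mulVec.mpr ⟨_, hz0, hz⟩)).lt_or_eq with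
      hl | hl
    · exact Or.inl hl
    · have hlI : l = Complex.I * l.im := by
        apply Complex.ext <;> simp [hl]
      have hω : l.im ≠ 0 := fun h0 => by
        rw [h0, Complex.ofReal_zero, mul_zero] at hlI
        have hu : IsUnit (cx A₁) := hA₁.map (algebraMap ℝ ℂ).mapMatrix
        exact hx0 (Matrix.mulVec_injective_of_isUnit hu (by rw [hx, hlI, zero_smul, mulVec_zero]))
      rw [hlI] at hz
      have := hNI.form_pos_of_imaginary_eigenvector h hP hc ho hω hz0 hz
      rw [cx_plantStorage_mulVec] at this
      refine Or.inr ⟨hl, ?_⟩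
      simpa [dotProduct, Fintype.sum_sum_type] using this

lemma IsNI.posDef_double_integrator_storage [DecidableEq μ]
    {B : Matrix (Fin n₁ ⊕ (Fin n₂ ⊕ (Fin k ⊕ Fin k))) μ ℝ}
    {C : Matrix μ (Fin n₁ ⊕ (Fin n₂ ⊕ (Fin k ⊕ Fin k))) ℝ}
    (hNI : IsNI fun s : ℂ => transfer (plantA A₁) B C 0 s)
    (h : Dissipative (plantA A₁) B C (plantStorage n₂ P₁ P₂)) (hP₁ : P₁ᵀ = P₁) (hP₂ : P₂ᵀ = P₂)
    (hc : Controllable (plantA A₁) B) (ho : Observable (plantA A₁) C) :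
    P₂.PosDef := by
  refine Matrix.PosDef.of_dotProduct_mulVec_pos (by simpa [IsHermitian] using hP₂) fun x hx => ?_
  have := hNI.form_pos_of_double_integrator h (plantStorage_symm hP₁ hP₂) hc ho
    (x := Sum.elim 0 (Sum.elim 0 (Sum.elim 0 x))) (plantA_mulVec _ _ _ _)
    (by rw [plantA_mulVec]; simp)
    fun h0 => hx (by ext i; exact congrFun h0 (Sum.inr (Sum.inr (Sum.inl i))))
  rw [plantStorage_mulVec] at this
  simpa [sumElim_dotProduct] using this

/-- This replaces the identity −PA⁻¹B = Cᵀ, as the plant matrix is singular. For such u, C₃aᵀ =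
P₂B₃b gives B₃bu = 0. At x₁ = −A₁⁻¹B₁u the velocity then lies in ker P and is orthogonal to Cᵀu, so
the inequality is tight. -/
lemma Dissipative.restricted_equilibrium
    (h : Dissipative (plantA A₁) Bp Cp (plantStorage n₂ P₁ P₂)) (hP₁ : P₁ᵀ = P₁)
    (hP₂ : P₂.PosDef) (hA₁ : IsUnit A₁) {u : μ → ℝ} (hu₂ : C₂ᵀ *ᵥ u = 0) (hua : C₃aᵀ *ᵥ u = 0) :
    P₁ *ᵥ (A₁⁻¹ *ᵥ (B₁ *ᵥ u)) = -(C₁ᵀ *ᵥ u) := by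
  have hP₂s : P₂ᵀ = P₂ := by simpa using hP₂.isHermitian.eq
  have hA₁d := (Matrix.isUnit_iff_isUnit_det _).mp hA₁
  have hb : B₃b *ᵥ u = 0 := by
    rw [← h.double_integrator_gain hP₁ hP₂s, transpose_mul, transpose_transpose, hP₂s,
      ← mulVec_mulVec] at hua
    exact Matrix.mulVec_injective_of_isUnit hP₂.isUnit (by rw [hua, mulVec_zero])
  have hx : plantA A₁ *ᵥ Sum.elim (-(A₁⁻¹ *ᵥ (B₁ *ᵥ u))) (Sum.elim 0 (Sum.elim 0 0)) + Bp *ᵥ u =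
      Sum.elim (0 : Fin n₁ → ℝ) (Sum.elim (B₂ *ᵥ u) (Sum.elim (B₃a *ᵥ u) 0)) := by
    rw [plantA_mulVec, fromRows_mulVec, fromRows_mulVec, fromRows_mulVec, hb, mulVec_neg,
      mulVec_mulVec, Matrix.mul_nonsing_inv _ hA₁d, one_mulVec]
    ext (i | i | i | i) <;> simp
  obtain ⟨g, -⟩ := h.gradient (plantStorage_symm hP₁ hP₂s)
    (x := Sum.elim (-(A₁⁻¹ *ᵥ (B₁ *ᵥ u))) (Sum.elim 0 (Sum.elim 0 0))) (u := u) (by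
      rw [hx, plantStorage_mulVec, dotProduct_mulVec_transpose]
      simp [transpose_fromCols, fromRows_mulVec, hu₂, hua])
  rw [hx, plantStorage_mulVec, plantStorage_mulVec, transpose_fromCols, transpose_fromCols,
    transpose_fromCols, fromRows_mulVec, fromRows_mulVec, fromRows_mulVec, plantA_transpose_mulVec,
    plantA_transpose_mulVec] at g
  have g1 : A₁ᵀ *ᵥ (P₁ *ᵥ -(A₁⁻¹ *ᵥ (B₁ *ᵥ u))) = A₁ᵀ *ᵥ (C₁ᵀ *ᵥ u) := by
    ext i; simpa using congrFun g (Sum.inl i)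
  have := Matrix.mulVec_injective_of_isUnit ((Matrix.isUnit_transpose A₁).mpr hA₁) g1
  rw [← this, mulVec_neg, neg_neg]

end Plant

/-! ### Projected gains and matrix square roots -/

section Schur

variable {ι κ μ ν : Type*} [Fintype ι] [DecidableEq ι] [Fintype κ] [DecidableEq κ]
  [Fintype μ] [DecidableEq μ] [Fintype ν] [DecidableEq ν]

omit [DecidableEq μ] in
-- `calP G F` is what remains of G in the Schur complement of the corner −FᵀGF.
lemma posDef_neg_calP_iff {G : Matrix μ μ ℝ} (hG : Gᵀ = G) (F : Matrix μ ν ℝ) (E : Matrix μ κ ℝ)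
    (R : Matrix κ κ ℝ) :
    (fromBlocks (0 : Matrix ν ν ℝ) 0 0 R - (fromCols F E)ᵀ * G * fromCols F E).PosDef ↔
      (-(Fᵀ * G * F)).PosDef ∧ (R - Eᵀ * calP G F * E).PosDef := by
  have h1 : fromBlocks (0 : Matrix ν ν ℝ) 0 0 R - (fromCols F E)ᵀ * G * fromCols F E =
      fromBlocks (-(Fᵀ * G * F)) (-(Fᵀ * G * E)) (-(Fᵀ * G * E))ᵀ (R - Eᵀ * G * E) := by
    rw [transpose_fromCols, fromRows_mul, fromRows_mul_fromCols, sub_eq_add_neg, fromBlocks_neg,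
      fromBlocks_add]
    simp [hG, Matrix.mul_assoc, sub_eq_add_neg]
  have h2 : (-(Fᵀ * G * F)).PosDef → R - Eᵀ * calP G F * E =
      R - Eᵀ * G * E - (-(Fᵀ * G * E))ᵀ * (-(Fᵀ * G * F))⁻¹ * -(Fᵀ * G * E) := fun hpd => by
    have hu := (Matrix.isUnit_iff_isUnit_det _).mp (by simpa using hpd.isUnit.neg :
      IsUnit (Fᵀ * G * F))
    have h3 : (-(Fᵀ * G * F))⁻¹ = -(Fᵀ * G * F)⁻¹ :=
      Matrix.inv_eq_left_inv (by rw [neg_mul_neg, Matrix.nonsing_inv_mul _ hu])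
    rw [h3, calP]
    simp only [transpose_neg, transpose_mul, transpose_transpose, hG, Matrix.neg_mul,
      Matrix.mul_neg, neg_neg, Matrix.mul_sub, Matrix.sub_mul, Matrix.mul_assoc]
    abel
  rw [h1]
  refine ⟨fun h => ?_, fun ⟨hΞ, h⟩ => ?_⟩
  · have hΞ : (-(Fᵀ * G * F)).PosDef := by
      exact h.submatrix (e := (Sum.inl : ν → ν ⊕ κ)) Sum.inl_injective
    exact ⟨hΞ, h2 hΞ ▸ (posDef_fromBlocks_iff₁₁ _ _ hΞ).mp h⟩
  · exact (posDef_fromBlocks_iff₁₁ _ _ hΞ).mpr (h2 hΞ ▸ h)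

/-- Both sides are Schur complements of the block matrix with rows (R, Xᵀ) and (X, I). -/
lemma posDef_sub_iff {R : Matrix κ κ ℝ} (hR : R.PosDef) (X : Matrix μ κ ℝ) :
    (R - Xᵀ * X).PosDef ↔ (1 - X * R⁻¹ * Xᵀ).PosDef := by
  have h1 := posDef_fromBlocks_iff₂₂ R Xᵀ (Matrix.PosDef.one (n := μ) (R := ℝ))
  have h2 := posDef_fromBlocks_iff₁₁ Xᵀ (1 : Matrix μ μ ℝ) hR
  rw [h1] at h2
  simpa using h2

omit [Fintype ι] [DecidableEq ι] [Fintype κ] [DecidableEq κ] in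
lemma posDef_submatrix_equiv {M : Matrix ι ι ℝ} (e : κ ≃ ι) :
    (M.submatrix e e).PosDef ↔ M.PosDef :=
  ⟨fun h => by simpa using h.submatrix e.symm.injective, fun h => h.submatrix e.injective⟩

lemma transpose_sqrt (N : Matrix μ μ ℝ) : (CFC.sqrt N)ᵀ = CFC.sqrt N := by
  simpa using (Matrix.nonneg_iff_posSemidef.mp (CFC.sqrt_nonneg N)).isHermitian.eq

lemma sqrt_mul_sqrt {N : Matrix μ μ ℝ} (hN : N.PosSemidef) : CFC.sqrt N * CFC.sqrt N = N :=
  CFC.sqrt_mul_sqrt_self N (Matrix.nonneg_iff_posSemidef.mpr hN)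

omit [Fintype ν] [DecidableEq ν] in
-- The Gram matrix of √N F is FᵀNF = 0.
lemma transpose_mul_sqrt_eq_zero {N : Matrix μ μ ℝ} (hN : N.PosSemidef) {F : Matrix μ ν ℝ}
    (hF : N * F = 0) : Fᵀ * CFC.sqrt N = 0 := by
  have h : (CFC.sqrt N * F)ᵀ * (CFC.sqrt N * F) = 0 := by
    rw [transpose_mul, transpose_sqrt, Matrix.mul_assoc, ← Matrix.mul_assoc (CFC.sqrt N),
      sqrt_mul_sqrt hN, hF, Matrix.mul_zero]
  rw [← conjTranspose_eq_transpose_of_trivial, Matrix.conjTranspose_mul_self_eq_zero] at h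
  rw [← transpose_sqrt, ← transpose_mul, h, transpose_zero]

omit [DecidableEq μ] in
lemma calP_mul_self {G : Matrix μ μ ℝ} {F : Matrix μ ν ℝ} (h : IsUnit (Fᵀ * G * F)) :
    calP G F * F = 0 := by
  have hd := (Matrix.isUnit_iff_isUnit_det _).mp h
  rw [calP, Matrix.sub_mul, Matrix.mul_assoc _ G F, Matrix.mul_assoc _ Fᵀ, ← Matrix.mul_assoc Fᵀ,
    Matrix.mul_assoc _ _ (Fᵀ * G * F), Matrix.nonsing_inv_mul _ hd, Matrix.mul_one, sub_self]

lemma posDef_diagonal {R₁ : Matrix ι ι ℝ} {R₂ : Matrix κ κ ℝ} (h₁ : R₁.PosDef) (h₂ : R₂.PosDef) :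
    (fromBlocks R₁ 0 0 R₂).PosDef := by
  have := (posDef_fromBlocks_iff₁₁ (0 : Matrix ι κ ℝ) R₂ h₁).mpr (by simpa using h₂)
  simpa using this

lemma inv_diagonal {R₁ : Matrix ι ι ℝ} {R₂ : Matrix κ κ ℝ} (h₁ : R₁.PosDef) (h₂ : R₂.PosDef) :
    (fromBlocks R₁ 0 0 R₂)⁻¹ = fromBlocks R₁⁻¹ 0 0 R₂⁻¹ := by
  refine Matrix.inv_eq_left_inv ?_
  rw [fromBlocks_multiply]
  simp [Matrix.nonsing_inv_mul _ ((Matrix.isUnit_iff_isUnit_det _).mp h₁.isUnit),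
    Matrix.nonsing_inv_mul _ ((Matrix.isUnit_iff_isUnit_det _).mp h₂.isUnit)]

end Schur

/-! ### Reduction of the plant condition to the reduced form -/

section PlantReduction

variable {n₁ n₂ k : ℕ} {μ : Type*} [Fintype μ] [DecidableEq μ]
  {A₁ : Matrix (Fin n₁) (Fin n₁) ℝ}
  {B₁ : Matrix (Fin n₁) μ ℝ} {B₂ : Matrix (Fin n₂) μ ℝ} {B₃a B₃b : Matrix (Fin k) μ ℝ}
  {C₁ : Matrix μ (Fin n₁) ℝ} {C₂ : Matrix μ (Fin n₂) ℝ} {C₃a C₃b : Matrix μ (Fin k) ℝ}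
  {P₁ : Matrix (Fin n₁) (Fin n₁) ℝ} {P₂ : Matrix (Fin k) (Fin k) ℝ}

/-- The plant states, ordered such that the kernel of the storage function comes first. -/
def stateEquiv (n₁ n₂ k : ℕ) :
    (Fin n₂ ⊕ Fin k) ⊕ (Fin n₁ ⊕ Fin k) ≃ Fin n₁ ⊕ (Fin n₂ ⊕ (Fin k ⊕ Fin k)) where
  toFun := Sum.elim (Sum.elim (fun i => .inr (.inl i)) (fun i => .inr (.inr (.inl i))))
    (Sum.elim .inl (fun i => .inr (.inr (.inr i))))
  invFun := Sum.elim (fun i => .inr (.inl i)) (Sum.elim (fun i => .inl (.inl i))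
    (Sum.elim (fun i => .inl (.inr i)) (fun i => .inr (.inr i))))
  left_inv := by rintro ((i | i) | (i | i)) <;> rfl
  right_inv := by rintro (i | i | i | i) <;> rfl

omit [DecidableEq μ] in
lemma plantStorage_sub_posDef_iff {G : Matrix μ μ ℝ} (hG : Gᵀ = G) :
    (plantStorage n₂ P₁ P₂ - (fromCols C₁ (fromCols C₂ (fromCols C₃a C₃b)))ᵀ * G *
        fromCols C₁ (fromCols C₂ (fromCols C₃a C₃b))).PosDef ↔
      (-((fromCols C₂ C₃a)ᵀ * G * fromCols C₂ C₃a)).PosDef ∧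
        (fromBlocks P₁ 0 0 P₂ -
          (fromCols C₁ C₃b)ᵀ * calP G (fromCols C₂ C₃a) * fromCols C₁ C₃b).PosDef := by
  rw [← posDef_neg_calP_iff hG]
  have hC : (fromCols C₁ (fromCols C₂ (fromCols C₃a C₃b))).submatrix id (stateEquiv n₁ n₂ k) =
      fromCols (fromCols C₂ C₃a) (fromCols C₁ C₃b) := by
    ext i ((j | j) | (j | j)) <;> rfl
  have hP : (plantStorage n₂ P₁ P₂).submatrix (stateEquiv n₁ n₂ k) (stateEquiv n₁ n₂ k) =
      fromBlocks 0 0 0 (fromBlocks P₁ 0 0 P₂) := by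
    ext ((i | i) | (i | i)) ((j | j) | (j | j)) <;> rfl
  rw [← hP, ← hC]
  exact (posDef_submatrix_equiv (stateEquiv n₁ n₂ k)).symm

/-- The columns of S are inputs as in `restricted_equilibrium`, which trades A₁⁻¹B₁ for −P₁⁻¹C₁ᵀ. -/
lemma Dissipative.restricted_gain
    (h : Dissipative (plantA A₁) (fromRows B₁ (fromRows B₂ (fromRows B₃a B₃b)))
      (fromCols C₁ (fromCols C₂ (fromCols C₃a C₃b))) (plantStorage n₂ P₁ P₂))
    (hP₁ : P₁.PosDef) (hP₂ : P₂.PosDef) (hA₁ : IsUnit A₁) {S : Matrix μ μ ℝ}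
    (hS : (fromCols C₂ C₃a)ᵀ * S = 0) :
    S * C₁ * A₁⁻¹ * B₁ * S = -(S * C₁ * P₁⁻¹ * C₁ᵀ * S) := by
  have hP₁s : P₁ᵀ = P₁ := by simpa using hP₁.isHermitian.eq
  rw [transpose_fromCols, fromRows_mul] at hS
  have h₂ : C₂ᵀ * S = 0 := by ext i j; exact congrFun (congrFun hS (Sum.inl i)) j
  have ha : C₃aᵀ * S = 0 := by ext i j; exact congrFun (congrFun hS (Sum.inr i)) j
  have key : P₁ * (A₁⁻¹ * (B₁ * S)) = -(C₁ᵀ * S) := by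
    refine Matrix.toLin'.injective (LinearMap.ext fun u => ?_)
    have := h.restricted_equilibrium hP₁s hP₂ hA₁ (u := S *ᵥ u)
      (by rw [mulVec_mulVec, h₂, zero_mulVec]) (by rw [mulVec_mulVec, ha, zero_mulVec])
    simpa [neg_mulVec] using this
  have key' : A₁⁻¹ * (B₁ * S) = -(P₁⁻¹ * (C₁ᵀ * S)) := by
    rw [← Matrix.mul_neg, ← key, ← Matrix.mul_assoc P₁⁻¹, Matrix.nonsing_inv_mul _
      ((Matrix.isUnit_iff_isUnit_det _).mp hP₁.isUnit), Matrix.one_mul]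
  simp only [Matrix.mul_assoc, key', Matrix.mul_neg]

omit [DecidableEq μ] in
lemma sandwich_diagonal (hP₁ : P₁.PosDef) (hP₂ : P₂.PosDef) (S : Matrix μ μ ℝ) (hS : Sᵀ = S) :
    S * fromCols C₁ C₃b * (fromBlocks P₁ 0 0 P₂)⁻¹ * (S * fromCols C₁ C₃b)ᵀ =
      S * C₁ * P₁⁻¹ * C₁ᵀ * S + S * C₃b * P₂⁻¹ * C₃bᵀ * S := by
  rw [inv_diagonal hP₁ hP₂, transpose_mul, hS, transpose_fromCols, mul_fromCols, fromRows_mul,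
    fromCols_mul_fromBlocks, fromCols_mul_fromRows]
  simp [Matrix.mul_assoc]

end PlantReduction

end NegImag

end

/-! ### Assembly of the stability criterion -/

theorem theorem5
    {m n₁ n₂ k n' : ℕ} (hk : k ≠ 0)
    -- the plant, in block form
    (A₁ : Matrix (Fin n₁) (Fin n₁) ℝ) (hA₁ : IsUnit A₁)
    (B₁ : Matrix (Fin n₁) (Fin m) ℝ) (B₂ : Matrix (Fin n₂) (Fin m) ℝ)
    (B₃a B₃b : Matrix (Fin k) (Fin m) ℝ)
    (C₁ : Matrix (Fin m) (Fin n₁) ℝ) (C₂ : Matrix (Fin m) (Fin n₂) ℝ)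
    (C₃a C₃b : Matrix (Fin m) (Fin k) ℝ)
    (A : Matrix (Fin n₁ ⊕ (Fin n₂ ⊕ (Fin k ⊕ Fin k))) (Fin n₁ ⊕ (Fin n₂ ⊕ (Fin k ⊕ Fin k))) ℝ)
    (hA : A = NegImag.plantA A₁)
    (B : Matrix (Fin n₁ ⊕ (Fin n₂ ⊕ (Fin k ⊕ Fin k))) (Fin m) ℝ)
    (hB : B = fromRows B₁ (fromRows B₂ (fromRows B₃a B₃b)))
    (C : Matrix (Fin m) (Fin n₁ ⊕ (Fin n₂ ⊕ (Fin k ⊕ Fin k))) ℝ)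
    (hC : C = fromCols C₁ (fromCols C₂ (fromCols C₃a C₃b)))
    (hmin : NegImag.IsMinimal A B C 0)
    (hNI : NegImag.IsNI (fun s : ℂ => NegImag.transfer A B C 0 s))
    -- the controller
    (A' : Matrix (Fin n') (Fin n') ℝ) (B' : Matrix (Fin n') (Fin m) ℝ)
    (C' : Matrix (Fin m) (Fin n') ℝ) (D' : Matrix (Fin m) (Fin m) ℝ)
    (hmin' : NegImag.IsMinimal A' B' C' D')
    (hSNI : NegImag.IsSNI (fun s : ℂ => NegImag.transfer A' B' C' D' s))
    -- the matrices `Ḡ(0)`, `Ξ`, `N`, `P₂`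
    (G'0 : Matrix (Fin m) (Fin m) ℝ) (hG'0 : G'0 = NegImag.transfer A' B' C' D' (0 : ℝ))
    (Ξ : Matrix (Fin n₂ ⊕ Fin k) (Fin n₂ ⊕ Fin k) ℝ)
    (hΞ : Ξ = (fromCols C₂ C₃a)ᵀ * G'0 * fromCols C₂ C₃a)
    (hΞ_unit : IsUnit Ξ)
    (N : Matrix (Fin m) (Fin m) ℝ) (hN : N = NegImag.calP G'0 (fromCols C₂ C₃a))
    (P₂ : Matrix (Fin k) (Fin k) ℝ) (hP₂ : P₂ = C₃aᵀ * B₃bᵀ * (B₃b * B₃bᵀ)⁻¹) :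
    (N.PosSemidef →
      (NegImag.InternallyStable A B C 0 A' B' C' D' ↔
        (-Ξ).PosDef ∧
        (1 + CFC.sqrt N * C₁ * A₁⁻¹ * B₁ * CFC.sqrt N
          - CFC.sqrt N * C₃b * P₂⁻¹ * C₃bᵀ * CFC.sqrt N).PosDef)) ∧
    ((-N).PosSemidef →
      (NegImag.InternallyStable A B C 0 A' B' C' D' ↔
        (-Ξ).PosDef ∧
        (1 - CFC.sqrt (-N) * C₁ * A₁⁻¹ * B₁ * CFC.sqrt (-N)
          + CFC.sqrt (-N) * C₃b * P₂⁻¹ * C₃bᵀ * CFC.sqrt (-N)).det ≠ 0)) := by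
  have hc := hmin.controllable
  have ho := hmin.observable
  have hc' := hmin'.controllable
  have ho' := hmin'.observable
  have hf := hNI.frequencyInequality hc
  have hH' := hSNI.isHurwitz hc' ho'
  have hD' := hSNI.feedthrough_symm
  obtain ⟨P, hPs, hP⟩ := NegImag.exists_storage hc hf
  obtain ⟨P', hP's, hP'⟩ := NegImag.exists_storage hc' (hSNI.frequencyInequality hc')
  have hP'pd := hP'.posDef_of_isHurwitz hP's ho' hH'
  have hG : G'0 = D' + C' * P'⁻¹ * C'ᵀ := by
    rw [hG'0, hP'.transfer_zero hc' hP'pd hH'.isUnit]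
  have hGs : G'0ᵀ = G'0 := by
    simp [hG, hD', Matrix.mul_assoc, transpose_nonsing_inv, hP's]
  have hstable : NegImag.InternallyStable A B C 0 A' B' C' D' ↔ (P - Cᵀ * G'0 * C).PosDef := by
    rw [NegImag.InternallyStable, NegImag.isHurwitz_closedLoop_iff hP hP' hc hc' ho hPs hP'pd hD' hf
      (hSNI.strictFrequencyInequality hH') hH', NegImag.loopStorage_posDef_iff hP'pd, ← hG]
    simp
  rw [hstable]
  subst hA
  obtain ⟨R₁, R₂, hR₁s, hR₂s, rfl⟩ := hP.exists_plantStorage hPs hc hA₁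
  have hR₁ := hNI.posDef_nonsingular_storage hP hR₁s hR₂s hc ho hA₁
  have hR₂ := hNI.posDef_double_integrator_storage hP hR₁s hR₂s hc ho
  subst hB hC
  rw [hP.double_integrator_storage hR₁s hR₂s hc] at hP₂
  subst hP₂
  have hR := NegImag.posDef_diagonal hR₁ hR₂
  rw [NegImag.plantStorage_sub_posDef_iff hGs, ← hΞ, ← hN]
  -- Nonsingularity of Ξ enters here; it makes [C₂ C₃a]ᵀ annihilate the square root of N or of −N.
  have hNF : N * fromCols C₂ C₃a = 0 := by
    rw [hN]; exact NegImag.calP_mul_self (hΞ ▸ hΞ_unit)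
  refine ⟨fun hNp => and_congr_right fun _ => ?_, fun hNn => and_congr_right fun _ => ?_⟩
  · have hS := NegImag.transpose_sqrt N
    have h1 : (fromCols C₁ C₃b)ᵀ * N * fromCols C₁ C₃b =
        (CFC.sqrt N * fromCols C₁ C₃b)ᵀ * (CFC.sqrt N * fromCols C₁ C₃b) := by
      rw [transpose_mul, hS, Matrix.mul_assoc _ (CFC.sqrt N), ← Matrix.mul_assoc (CFC.sqrt N),
        NegImag.sqrt_mul_sqrt hNp, Matrix.mul_assoc]
    rw [h1, NegImag.posDef_sub_iff hR, NegImag.sandwich_diagonal hR₁ hR₂ _ hS,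
      hP.restricted_gain hR₁ hR₂ hA₁ (NegImag.transpose_mul_sqrt_eq_zero hNp hNF), ← sub_sub,
      ← sub_eq_add_neg]
  · have hS := NegImag.transpose_sqrt (-N)
    have h1 : (fromCols C₁ C₃b)ᵀ * N * fromCols C₁ C₃b =
        -((CFC.sqrt (-N) * fromCols C₁ C₃b)ᵀ * (CFC.sqrt (-N) * fromCols C₁ C₃b)) := by
      rw [transpose_mul, hS, Matrix.mul_assoc _ (CFC.sqrt (-N)),
        ← Matrix.mul_assoc (CFC.sqrt (-N)), NegImag.sqrt_mul_sqrt hNn, Matrix.neg_mul, Matrix.mul_neg,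
        neg_neg, Matrix.mul_assoc]
    have h2 := NegImag.sandwich_diagonal (C₁ := C₁) (C₃b := C₃b) hR₁ hR₂ _ hS
    have h3 : (1 + CFC.sqrt (-N) * fromCols C₁ C₃b * (fromBlocks R₁ 0 0 P₂)⁻¹ *
        (CFC.sqrt (-N) * fromCols C₁ C₃b)ᵀ).PosDef := by
      refine Matrix.PosDef.one.add_posSemidef ?_
      rw [← conjTranspose_eq_transpose_of_trivial]
      exact hR.inv.posSemidef.mul_mul_conjTranspose_same _
    rw [h1, hP.restricted_gain hR₁ hR₂ hA₁
      (NegImag.transpose_mul_sqrt_eq_zero hNn (by rw [Matrix.neg_mul, hNF, neg_zero])), sub_neg_eq_add,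
      sub_neg_eq_add, add_assoc, ← h2]
    -- For N ⪯ 0 a semidefinite term is added to a definite one on both sides, so both conditions
    -- are automatic.
    refine iff_of_true (hR.add_posSemidef ?_) h3.det_pos.ne'
    rw [← conjTranspose_eq_transpose_of_trivial]
    exact Matrix.posSemidef_conjTranspose_mul_self _
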